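/- **Setting.** Let $G$ be a real Lie group with Lie algebra $\mathfrak g$, $s$ an involutive automorphism of $G$, and $K\subset G$ a closed Lie subgroup contained in the fixed point group of $s$ and with the same Lie algebra $\mathfrak k$ as that group, so that $M=G/K$ is a symmetric space and $\mathfrak g=\mathfrak k\oplus\mathfrak p$, where $\mathfrak p$ is the $(-1)$-eigenspace of $s_*$. Assume that $\mathfrak k=[\mathfrak p,\mathfrak p]$ and that $\mathfrak k$ acts faithfully on $\mathfrak p$ (i.e. $W\in\mathfrak k$ and $[W,\mathfrak p]=0$ imply $W=0$). Let $\Omega$ be an $\operatorname{Ad}K$-invariant symplectic form on $\mathfrak p$ (it defines the $G$-invariant symplectic form of $M$), and let $\widetilde A$ be an invertible endomorphism of $\mathfrak p$ which commutes with $\operatorname{Ad}K$ and satisfies $\Omega(\widetilde AX,Y)=-\Omega(X,\widetilde AY)$ (it defines the $G$-invariant field $A$ in $\mathfrak{sp}(TM)$). On $\mathfrak p$ put $B(X,Y)=-\Omega(X,\widetilde A^{-1}Y)$. Fix $\hbar>0$, $h=2\pi\hbar$, and a positive compatible complex structure $j$ on $V=(\mathfrak p,\Omega)$, of real dimension $2n$;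 put $\langle v,w\rangle_j=\Omega(v,jw)-i\Omega(v,w)$ and $|v|_j^2=\langle v,v\rangle_j$. Let $\mathcal H$ be the Fock space of holomorphic functions $f$ on $(V,j)$ with $\|f\|^2=h^{-n}\int_V|f(z)|^2e^{-|z|_j^2/2\hbar}dz<\infty$, where $dz$ is the Lebesgue measure normalised for $|\cdot|_j$. The Heisenberg group $V\times\mathbb R$, with product $(v,t)(v',t')=(v+v',t+t'-\frac12\Omega(v,v'))$, acts on $\mathcal H$ by $$(U_j(v,t)f)(z)=e^{-it/\hbar+\langle z,v\rangle_j/2\hbar-|v|_j^2/4\hbar}f(z-v).$$ Let $\mathcal H^\infty$ be the Fréchet space of smooth vectors and $cl(v)=dU_j(v,0)$ on $\mathcal H^\infty$; then $cl(u)cl(v)-cl(v)cl(u)=\frac i\hbar\Omega(u,v)$, and $cl$ extends to the symplectic Clifford algebra $Cl(V,\Omega)$, the complex unital algebra generated by $V$ with $uv-vu=\frac i\hbar\Omega(u,v)$. Let $\nu:\mathfrak{sp}(V,\Omega)\to Cl(V,\Omega)$ be the linear map with $\nu\big(\Omega(v,\cdot)w+\Omega(w,\cdot)v\big)=-\frac{i\hbar}2(vw+wv)$.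 Write $N(W)=cl(\nu(\operatorname{ad}W|_{\mathfrak p}))$ for $W\in\mathfrak k$. Let $Mp^c(V,\Omega,j)$ be the group of pairs $(U,g)$ of a unitary operator $U$ of $\mathcal H$ and $g\in Sp(V,\Omega)$ with $U_j(gv,t)=U\,U_j(v,t)\,U^{-1}$, with $\sigma(U,g)=g$, $\mathbf U(U,g)=U$ and the character $\eta(U,g)=\lambda^2\det_{\mathbb C}\big(\frac12(g-jgj)\big)$, where $\lambda=(U1)(0)$; its Lie group structure is given by the parameters $(g,\lambda)$. Assume that the isotropy representation $\tau(k)=\operatorname{Ad}(k)|_{\mathfrak p}$ lifts to a Lie group homomorphism $\widetilde\tau:K\to Mp^c(V,\Omega,j)$, $\sigma\circ\widetilde\tau=\tau$. Let $\chi:K\to U(1)$ be a smooth character, and put $\chi'(k)=\eta(\chi(k)\widetilde\tau(k))$, with differential $\chi'_*:\mathfrak k\to\mathbb C$ (this is the character of the canonical line bundle of the $Mp^c$-structure $G\times_{K,\chi\times\widetilde\tau}Mp^c(V,\Omega,j)$). A spinor field is a smooth map $\widetilde\varphi:G\to\mathcal H^\infty$ with $\widetilde\varphi(gk)=\mathbf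 U\big(\chi(k^{-1})\widetilde\tau(k^{-1})\big)\widetilde\varphi(g)$ for all $g\in G$, $k\in K$. For $X\in\mathfrak g$ let $\widetilde X$ denote the derivative along the left-invariant vector field defined by $X$. For a basis $(X_a)$ of $\mathfrak p$, with $\Omega$-dual basis $(X^a)$ defined by $\Omega(X_a,X^b)=\delta_a^b$, the Dirac operators of the symmetric connection $\alpha_g(L_{g*}X)=X_{\mathfrak k}$ are $$D=\sum_a cl(X_a)\,\widetilde{X^a},\qquad D_A=\sum_a cl(\widetilde AX_a)\,\widetilde{X^a}.$$ **Proposition.** There is exactly one $\operatorname{Ad}K$- and $\operatorname{ad}\mathfrak g$-invariant symmetric bilinear form $\widetilde B$ on $\mathfrak g$ which extends $B$ and satisfies, for $X,Y,Z,T\in\mathfrak p$, $$\widetilde B(X,[Y,Z])=0,\qquad \widetilde B([X,T],[Y,Z])=B(X,[T,[Y,Z]]).$$ It is non-degenerate on $\mathfrak g$ and on $\mathfrak k$. For any basis $(W_r)$ of $\mathfrak k$ let $(\widetilde B^{rs})$ be the inverse of the matrix $(\widetilde B(W_r,W_s))$. For any basis $(E_p)$ of $\mathfrak g$, with $(\widetilde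 B^{pq})$ the inverse of the matrix $(\widetilde B(E_p,E_q))$, let $\widetilde\Omega_{\mathfrak g}=\sum_{p,q}\widetilde B^{pq}\widetilde E_p\widetilde E_q$ be the operator given by the Casimir element of $\mathfrak g$; and for a linear map $f$ from $\mathfrak k$ to an associative algebra, let $f(\Omega_{\mathfrak k})=\sum_{r,s}\widetilde B^{rs}f(W_r)f(W_s)$ denote the image of the Casimir element of $\mathfrak k$. Then for every spinor field $\widetilde\varphi$ $$(DD_A-D_AD)\widetilde\varphi=\Big(\frac i\hbar\widetilde\Omega_{\mathfrak g}-\frac{3i}\hbar N(\Omega_{\mathfrak k})-\frac i{4\hbar}\sum_{r,s}\widetilde B^{rs}\chi'_*(W_r)\chi'_*(W_s)-\frac{2i}\hbar\sum_{r,s}\widetilde B^{rs}\chi'_*(W_r)N(W_s)\Big)\widetilde\varphi$$ $$=\frac i\hbar\Big(\widetilde\Omega_{\mathfrak g}+N(\Omega_{\mathfrak k})-4\big(N+\tfrac14\chi'_*\big)(\Omega_{\mathfrak k})\Big)\widetilde\varphi .$$ -/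

import Mathlib

set_option linter.style.haveILetI false
set_option linter.unusedSectionVars false
open MeasureTheory
open scoped ContDiff Manifold

namespace MpcDirac

noncomputable section Fock

/-- A finite-dimensional real symplectic vector space `(V, Ω)` with a positive compatible complex
structure `j`, together with the value of `ħ > 0`. (Nondegeneracy of `Ω` follows from `j_pos`.) -/
structure FockModel (V : Type*) [NormedAddCommGroup V] [NormedSpace ℝ V] where
  /-- the symplectic form -/
  Ω : LinearMap.BilinForm ℝ V
  alt : ∀ v, Ω v v = 0
  /-- the positive compatible complex structure -/
  j : V →ₗ[ℝ] V
  j_sq : ∀ v, j (j v) = -v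
  j_symp : ∀ v w, Ω (j v) (j w) = Ω v w
  j_pos : ∀ v, v ≠ 0 → 0 < Ω v (j v)
  /-- Planck's constant divided by `2π` -/
  hbar : ℝ
  hbar_pos : 0 < hbar

namespace FockModel

variable {V : Type*} [NormedAddCommGroup V] [NormedSpace ℝ V] (S : FockModel V)

/-- The Hermitian form `⟨v, w⟩_j = Ω(v, j w) - i Ω(v, w)`. -/
def herm (v w : V) : ℂ := (S.Ω v (S.j w) : ℂ) - Complex.I * (S.Ω v w : ℂ)

/-- `|v|_j² = ⟨v, v⟩_j = Ω(v, j v)`. -/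
def sqNorm (v : V) : ℝ := S.Ω v (S.j v)

theorem skew (v w : V) : S.Ω v w = -S.Ω w v := by
  have h := S.alt (v + w)
  simp only [map_add, LinearMap.add_apply, S.alt] at h
  linarith

theorem metric_symm (v w : V) : S.Ω v (S.j w) = S.Ω w (S.j v) := by
  have h := S.j_symp v (S.j w)
  rw [S.j_sq, map_neg, ← S.skew w (S.j v)] at h
  exact h.symm

theorem nondegenerate [FiniteDimensional ℝ V] : S.Ω.Nondegenerate := by
  refine LinearMap.BilinForm.Nondegenerate.ofSeparatingLeft fun v hv => ?_
  by_contra h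
  exact (S.j_pos v h).ne' (hv (S.j v))

/-- A function on `V` is holomorphic for the complex structure `j`. -/
def IsHolo (f : V → ℂ) : Prop :=
  Differentiable ℝ f ∧ ∀ z v, fderiv ℝ f z (S.j v) = Complex.I * fderiv ℝ f z v

/-- The operator `(U_j(v, t) f)(z) = exp(-i t / ħ + ⟨z, v⟩_j / 2ħ - |v|_j² / 4ħ) f(z - v)` of the
Heisenberg group `V × ℝ`, on functions. -/
def heisFun (p : V × ℝ) (f : V → ℂ) (z : V) : ℂ :=
  Complex.exp (-(Complex.I * p.2 / S.hbar) + S.herm z p.1 / (2 * S.hbar)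
    - (S.sqNorm p.1 : ℂ) / (4 * S.hbar)) * f (z - p.1)

/-- The multiplication of the Heisenberg group `V × ℝ`. -/
def heisMul (p q : V × ℝ) : V × ℝ := (p.1 + q.1, p.2 + q.2 - S.Ω p.1 q.1 / 2)

theorem herm_add_left (u v w : V) : S.herm (u + v) w = S.herm u w + S.herm v w := by
  simp only [herm, map_add, LinearMap.add_apply]; push_cast; ring

theorem herm_add_right (u v w : V) : S.herm u (v + w) = S.herm u v + S.herm u w := by
  simp only [herm, map_add]; push_cast; ring

theorem herm_sub_left (u v w : V) : S.herm (u - v) w = S.herm u w - S.herm v w := by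
  simp only [herm, map_sub, LinearMap.sub_apply]; push_cast; ring

theorem herm_j_left (v w : V) : S.herm (S.j v) w = Complex.I * S.herm v w := by
  have h := S.metric_symm (S.j v) w
  rw [S.j_sq, map_neg, ← S.skew v w] at h
  have h2 : S.Ω (S.j v) w = - S.Ω v (S.j w) := by rw [S.skew, ← S.metric_symm]
  simp only [herm, h2, S.j_symp]
  push_cast
  linear_combination (S.Ω v w : ℂ) * Complex.I_sq

theorem sqNorm_add (v w : V) : S.sqNorm (v + w) = S.sqNorm v + 2 * S.Ω v (S.j w) + S.sqNorm w := by
  simp only [sqNorm, map_add, LinearMap.add_apply, S.metric_symm w v]; ring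

theorem sqNorm_sub (v w : V) : S.sqNorm (v - w) = S.sqNorm v - 2 * S.Ω v (S.j w) + S.sqNorm w := by
  simp only [sqNorm, map_sub, LinearMap.sub_apply, S.metric_symm w v]; ring

theorem heisFun_heisFun (p q : V × ℝ) (f : V → ℂ) :
    S.heisFun p (S.heisFun q f) = S.heisFun (S.heisMul p q) f := by
  ext z
  simp only [heisFun, heisMul, ← mul_assoc, ← Complex.exp_add, sub_sub]
  congr 2
  have hh : (S.hbar : ℂ) ≠ 0 := by exact_mod_cast S.hbar_pos.ne'
  simp only [herm_sub_left, herm_add_right, sqNorm_add]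
  simp only [herm]
  push_cast
  field_simp
  ring

theorem heisFun_zero (f : V → ℂ) : S.heisFun 0 f = f := by
  ext z
  simp [heisFun, herm, sqNorm]

variable [FiniteDimensional ℝ V]

/-- `⟨·, w⟩_j` as a real linear map. -/
def hermL (w : V) : V →L[ℝ] ℂ := LinearMap.toContinuousLinearMap
  { toFun := fun z => S.herm z w
    map_add' := fun u v => S.herm_add_left u v w
    map_smul' := fun r v => by simp [herm]; ring }

theorem hermL_apply (w z : V) : S.hermL w z = S.herm z w := rfl

theorem continuous_sqNorm : Continuous S.sqNorm := by
  have h1 : Continuous fun v : V => LinearMap.toContinuousBilinearMap S.Ω v (S.j v) :=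
    (LinearMap.toContinuousBilinearMap S.Ω).continuous.clm_apply
      (LinearMap.toContinuousLinearMap S.j).continuous
  exact h1

theorem IsHolo.heisFun {f : V → ℂ} (hf : S.IsHolo f) (p : V × ℝ) : S.IsHolo (S.heisFun p f) := by
  have hd : ∀ z, HasFDerivAt (S.heisFun p f)
      (Complex.exp (-(Complex.I * p.2 / S.hbar) + S.herm z p.1 / (2 * S.hbar)
        - (S.sqNorm p.1 : ℂ) / (4 * S.hbar)) • fderiv ℝ f (z - p.1) +
      f (z - p.1) • (Complex.exp (-(Complex.I * p.2 / S.hbar) + S.herm z p.1 / (2 * S.hbar)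
        - (S.sqNorm p.1 : ℂ) / (4 * S.hbar)) • ((2 * S.hbar : ℂ)⁻¹ • S.hermL p.1))) z := by
    intro z
    have h1 : HasFDerivAt (fun z => S.herm z p.1) (S.hermL p.1) z := (S.hermL p.1).hasFDerivAt
    have h2 : HasFDerivAt (fun z => -(Complex.I * p.2 / S.hbar) + S.herm z p.1 / (2 * S.hbar)
        - (S.sqNorm p.1 : ℂ) / (4 * S.hbar)) ((2 * S.hbar : ℂ)⁻¹ • S.hermL p.1) z := by
      simp only [div_eq_mul_inv]
      exact ((h1.mul_const _).const_add _).sub_const _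
    have h3 : HasFDerivAt (fun z => f (z - p.1)) (fderiv ℝ f (z - p.1)) z := by
      have := (hf.1 (z - p.1)).hasFDerivAt.comp z ((hasFDerivAt_id z).sub_const p.1)
      rwa [ContinuousLinearMap.comp_id] at this
    exact h2.cexp.mul h3
  refine ⟨fun z => (hd z).differentiableAt, fun z v => ?_⟩
  rw [(hd z).fderiv]
  simp only [add_apply, smul_apply, hf.2, hermL_apply,
    herm_j_left, smul_eq_mul]
  ring

/-- The Lebesgue measure on `V` normalised for the Euclidean norm `|·|_j`: in any basis `(e_a)`, it
is `√det(Ω(e_a, j e_b))` times the measure giving mass one to the parallelepiped on `(e_a)`. -/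
def vol : @Measure V (borel V) :=
  letI : MeasurableSpace V := borel V
  haveI : BorelSpace V := ⟨rfl⟩
  ENNReal.ofReal (Real.sqrt (Matrix.of fun a b => S.Ω (Module.finBasis ℝ V a)
    (S.j (Module.finBasis ℝ V b))).det) • (Module.finBasis ℝ V).addHaar

/-- The measure `h^{-n} exp(-|z|_j² / 2ħ) dz`, where `h = 2πħ` and `dim V = 2n`. -/
def gaussian : @Measure V (borel V) :=
  letI : MeasurableSpace V := borel V
  S.vol.withDensity fun z => ENNReal.ofReal
    (((2 * Real.pi * S.hbar) ^ (Module.finrank ℝ V / 2))⁻¹ * Real.exp (-S.sqNorm z / (2 * S.hbar)))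

theorem gram_det_pos : 0 < (Matrix.of fun a b => S.Ω (Module.finBasis ℝ V a)
    (S.j (Module.finBasis ℝ V b))).det := by
  refine Matrix.PosDef.det_pos ⟨?_, fun x hx => ?_⟩
  · ext a b
    simp [S.metric_symm]
  · have key : (x.sum fun i xi => x.sum fun k xk => star xi *
        (Matrix.of fun a b => S.Ω (Module.finBasis ℝ V a) (S.j (Module.finBasis ℝ V b))) i k * xk)
        = S.sqNorm (Finsupp.linearCombination ℝ (Module.finBasis ℝ V) x) := by
      simp only [sqNorm, Finsupp.linearCombination_apply, Finsupp.sum, map_sum,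
        LinearMap.sum_apply, map_smul, LinearMap.smul_apply, smul_eq_mul, Matrix.of_apply,
        star_trivial, Finset.mul_sum]
      rw [Finset.sum_comm]
      refine Finset.sum_congr rfl fun i _ => Finset.sum_congr rfl fun k _ => ?_
      ring
    rw [key]
    refine S.j_pos _ fun h => hx ?_
    have := (Module.finBasis ℝ V).linearIndependent
    exact (linearIndependent_iff.1 this) x h

theorem isAddHaar_vol : letI : MeasurableSpace V := borel V
    haveI : BorelSpace V := ⟨rfl⟩
    S.vol.IsAddHaarMeasure := by
  letI : MeasurableSpace V := borel V
  haveI : BorelSpace V := ⟨rfl⟩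
  refine Measure.IsAddHaarMeasure.smul _ ?_ ENNReal.ofReal_ne_top
  simpa using Real.sqrt_pos.2 S.gram_det_pos

theorem isOpenPos_gaussian : letI : MeasurableSpace V := borel V
    S.gaussian.IsOpenPosMeasure := by
  letI : MeasurableSpace V := borel V
  haveI : BorelSpace V := ⟨rfl⟩
  haveI := S.isAddHaar_vol
  have hac : S.vol ≪ S.gaussian := by
    refine withDensity_absolutelyContinuous' ?_ (Filter.Eventually.of_forall fun z => ?_)
    · have := S.continuous_sqNorm
      exact (Measurable.ennreal_ofReal (Continuous.measurable (by fun_prop))).aemeasurable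
    · have := S.hbar_pos
      have := Real.pi_pos
      simp only [ne_eq, ENNReal.ofReal_eq_zero, not_le]
      positivity
  exact hac.isOpenPosMeasure

/-- The underlying space of the Fock space: holomorphic functions on `(V, j)` that are square
integrable for `h^{-n} exp(-|z|_j² / 2ħ) dz`. -/
def fockSubmodule : Submodule ℂ (V → ℂ) where
  carrier := {f | S.IsHolo f ∧ MemLp f 2 S.gaussian}
  add_mem' := by
    rintro f g ⟨⟨hf, hf'⟩, hf2⟩ ⟨⟨hg, hg'⟩, hg2⟩
    refine ⟨⟨hf.add hg, fun z v => ?_⟩, hf2.add hg2⟩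
    rw [fderiv_add (hf z) (hg z)]
    simp only [add_apply, hf', hg']
    ring
  zero_mem' := by
    refine ⟨⟨differentiable_const 0, fun z v => ?_⟩, ?_⟩
    · have : (0 : V → ℂ) = fun _ => 0 := rfl
      simp [this]
    · letI : MeasurableSpace V := borel V
      exact MemLp.zero'
  smul_mem' := by
    rintro c f ⟨⟨hf, hf'⟩, hf2⟩
    refine ⟨⟨hf.const_smul c, fun z v => ?_⟩, hf2.const_smul c⟩
    rw [fderiv_const_smul (hf z)]
    simp only [smul_apply, hf', smul_eq_mul]
    ring

/-- The Fock space `H(V, Ω, j)`. -/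
def Fock : Type _ := S.fockSubmodule

instance : AddCommGroup S.Fock := inferInstanceAs (AddCommGroup S.fockSubmodule)

instance : Module ℂ S.Fock := inferInstanceAs (Module ℂ S.fockSubmodule)

instance : CoeFun S.Fock fun _ => V → ℂ := ⟨fun f => (f : S.fockSubmodule).1⟩

variable {S}

@[ext] theorem Fock.ext {f g : S.Fock} (h : ∀ z, f z = g z) : f = g := Subtype.ext (funext h)

@[simp] theorem Fock.add_apply (f g : S.Fock) (z : V) : (f + g) z = f z + g z := rfl

@[simp] theorem Fock.smul_apply (c : ℂ) (f : S.Fock) (z : V) : (c • f) z = c * f z := rfl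

theorem Fock.isHolo (f : S.Fock) : S.IsHolo f := (f : S.fockSubmodule).2.1

theorem Fock.memLp (f : S.Fock) : MemLp f 2 S.gaussian :=
  (f : S.fockSubmodule).2.2

variable (S)

/-- The inclusion of the Fock space in `L²`. -/
def toL2 : S.Fock →ₗ[ℂ] Lp ℂ 2 S.gaussian :=
  letI : MeasurableSpace V := borel V
  { toFun := fun f => (Fock.memLp f).toLp f
    map_add' := fun _ _ => rfl
    map_smul' := fun _ _ => rfl }

theorem toL2_injective : Function.Injective S.toL2 := by
  letI : MeasurableSpace V := borel V
  haveI := S.isOpenPos_gaussian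
  intro f g h
  have h1 := (MemLp.toLp_eq_toLp_iff (Fock.memLp f) (Fock.memLp g)).1 h
  have h2 := (Continuous.ae_eq_iff_eq S.gaussian (Fock.isHolo f).1.continuous
    (Fock.isHolo g).1.continuous).1 h1
  exact Fock.ext fun z => congrFun h2 z

/-- The norm `‖f‖_j² = h^{-n} ∫ |f(z)|² exp(-|z|_j² / 2ħ) dz` of the Fock space. -/
instance : NormedAddCommGroup S.Fock :=
  NormedAddCommGroup.induced S.Fock _ S.toL2 S.toL2_injective

instance : NormedSpace ℂ S.Fock := NormedSpace.induced ℂ S.Fock _ S.toL2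

instance : NormedSpace ℝ S.Fock := NormedSpace.restrictScalars ℝ ℂ S.Fock

theorem eLpNorm_heisFun (p : V × ℝ) {f : V → ℂ} (hf : Continuous f) :
    eLpNorm (S.heisFun p f) 2 S.gaussian
      = eLpNorm f 2 S.gaussian := by
  letI : MeasurableSpace V := borel V
  haveI : BorelSpace V := ⟨rfl⟩
  haveI := S.isAddHaar_vol
  have hh := S.hbar_pos
  have hc := S.continuous_sqNorm
  have hw : Measurable fun z => ENNReal.ofReal (((2 * Real.pi * S.hbar) ^
      (Module.finrank ℝ V / 2))⁻¹ * Real.exp (-S.sqNorm z / (2 * S.hbar))) :=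
    Measurable.ennreal_ofReal (Continuous.measurable (by fun_prop))
  have hH : Continuous (S.heisFun p f) := by
    have := (S.hermL p.1).continuous
    simp only [funext (S.hermL_apply p.1)] at this
    unfold heisFun
    fun_prop
  rw [eLpNorm_eq_lintegral_rpow_enorm_toReal (by norm_num) (by norm_num),
    eLpNorm_eq_lintegral_rpow_enorm_toReal (by norm_num) (by norm_num)]
  congr 1
  simp only [gaussian, ENNReal.toReal_ofNat]
  rw [lintegral_withDensity_eq_lintegral_mul _ hw ((Continuous.measurable hH).enorm.pow_const _),
    lintegral_withDensity_eq_lintegral_mul _ hw ((Continuous.measurable hf).enorm.pow_const _)]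
  symm
  rw [← lintegral_sub_right_eq_self _ p.1]
  refine lintegral_congr fun z => ?_
  symm
  simp only [Pi.mul_apply, heisFun, enorm_mul]
  have e1 : ∀ x : ENNReal, x ^ (2 : ℝ) = x * x := fun x => by
    rw [show (2 : ℝ) = ((2 : ℕ) : ℝ) by norm_num, ENNReal.rpow_natCast, sq]
  simp only [e1]
  have e2 : ‖Complex.exp (-(Complex.I * p.2 / S.hbar) + S.herm z p.1 / (2 * S.hbar)
        - (S.sqNorm p.1 : ℂ) / (4 * S.hbar))‖ₑ = ENNReal.ofReal
        (Real.exp (S.Ω z (S.j p.1) / (2 * S.hbar) - S.sqNorm p.1 / (4 * S.hbar))) := by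
    rw [← ofReal_norm, Complex.norm_exp]
    congr 2
    have : (-(Complex.I * p.2 / S.hbar) + S.herm z p.1 / (2 * S.hbar)
        - (S.sqNorm p.1 : ℂ) / (4 * S.hbar)) =
        ((S.Ω z (S.j p.1) / (2 * S.hbar) - S.sqNorm p.1 / (4 * S.hbar) : ℝ) : ℂ) +
        ((- (p.2 / S.hbar) - S.Ω z p.1 / (2 * S.hbar) : ℝ) : ℂ) * Complex.I := by
      simp only [herm]; push_cast; ring
    rw [this, Complex.add_re, Complex.re_ofReal_mul, Complex.ofReal_re, Complex.I_re, mul_zero,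
      add_zero]
  have e3 : S.sqNorm (z - p.1) = S.sqNorm z - 2 * S.Ω z (S.j p.1) + S.sqNorm p.1 :=
    S.sqNorm_sub z p.1
  rw [e2, e3]
  generalize ‖f (z - p.1)‖ₑ = c
  have hk : (0 : ℝ) ≤ ((2 * Real.pi * S.hbar) ^ (Module.finrank ℝ V / 2))⁻¹ := by
    have := Real.pi_pos
    positivity
  have e4 : ∀ x y : ℝ, ENNReal.ofReal (Real.exp x) * ENNReal.ofReal (Real.exp y)
      = ENNReal.ofReal (Real.exp (x + y)) := fun x y => by
    rw [← ENNReal.ofReal_mul (Real.exp_pos x).le, Real.exp_add]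
  rw [ENNReal.ofReal_mul hk, ENNReal.ofReal_mul hk]
  have e5 : -(S.sqNorm z - 2 * S.Ω z (S.j p.1) + S.sqNorm p.1) / (2 * S.hbar) =
      -S.sqNorm z / (2 * S.hbar) + ((S.Ω z (S.j p.1) / (2 * S.hbar) - S.sqNorm p.1 / (4 * S.hbar))
        + (S.Ω z (S.j p.1) / (2 * S.hbar) - S.sqNorm p.1 / (4 * S.hbar))) := by
    field_simp
    ring
  rw [e5, ← e4, ← e4]
  ring

/-- The unitary representation `U_j` of the Heisenberg group on the Fock space. -/
def heis (p : V × ℝ) : S.Fock →ₗᵢ[ℂ] S.Fock where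
  toFun f := ⟨S.heisFun p f, IsHolo.heisFun S (Fock.isHolo f) p, by
    letI : MeasurableSpace V := borel V
    haveI : BorelSpace V := ⟨rfl⟩
    exact (IsHolo.heisFun S (Fock.isHolo f) p).1.continuous.measurable.aestronglyMeasurable,
    (S.eLpNorm_heisFun p (Fock.isHolo f).1.continuous).trans_lt (Fock.memLp f).2⟩
  map_add' f g := Fock.ext fun z => mul_add _ _ _
  map_smul' c f := Fock.ext fun z => mul_left_comm _ _ _
  norm_map' f := by
    letI : MeasurableSpace V := borel V
    have h : ∀ g : S.Fock, ‖g‖ = (eLpNorm g 2 S.gaussian).toReal :=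
      fun g => Lp.norm_toLp _ (Fock.memLp g)
    rw [h, h]
    exact congrArg ENNReal.toReal (S.eLpNorm_heisFun p (Fock.isHolo f).1.continuous)

theorem heis_apply (p : V × ℝ) (f : S.Fock) (z : V) : S.heis p f z = S.heisFun p f z := rfl

theorem heis_heis (p q : V × ℝ) (f : S.Fock) :
    S.heis p (S.heis q f) = S.heis (S.heisMul p q) f :=
  Fock.ext fun z => congrFun (S.heisFun_heisFun p q f) z

theorem heis_zero (f : S.Fock) : S.heis 0 f = f := Fock.ext fun z => congrFun (S.heisFun_zero f) z

theorem exists_sqNorm_ge : ∃ c > 0, ∀ v : V, c * ‖v‖ ^ 2 ≤ S.sqNorm v := by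
  rcases subsingleton_or_nontrivial V with h | h
  · refine ⟨1, one_pos, fun v => ?_⟩
    simp [Subsingleton.elim v 0, sqNorm]
  obtain ⟨u, hu, hmin⟩ := (isCompact_sphere (0 : V) 1).exists_isMinOn
    (NormedSpace.sphere_nonempty.2 zero_le_one) S.continuous_sqNorm.continuousOn
  have hu0 : u ≠ 0 := by
    rintro rfl
    simp at hu
  refine ⟨S.sqNorm u, S.j_pos u hu0, fun v => ?_⟩
  rcases eq_or_ne v 0 with rfl | hv
  · simp [sqNorm]
  have hv' : ‖v‖ ≠ 0 := norm_ne_zero_iff.2 hv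
  have h1 : S.sqNorm u ≤ S.sqNorm (‖v‖⁻¹ • v) := hmin (by simp [norm_smul, hv'])
  have h2 : S.sqNorm (‖v‖⁻¹ • v) = (‖v‖ ^ 2)⁻¹ * S.sqNorm v := by
    simp only [sqNorm, map_smul, LinearMap.smul_apply, smul_eq_mul]
    ring
  rw [h2] at h1
  have h3 : 0 < ‖v‖ ^ 2 := by positivity
  rwa [inv_mul_eq_div, le_div_iff₀ h3] at h1

theorem one_mem_fock : (fun _ => 1 : V → ℂ) ∈ S.fockSubmodule := by
  refine ⟨⟨differentiable_const 1, fun z v => by simp⟩, ?_⟩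
  letI : MeasurableSpace V := borel V
  haveI : BorelSpace V := ⟨rfl⟩
  haveI := S.isAddHaar_vol
  obtain ⟨c, hc, hle⟩ := S.exists_sqNorm_ge
  have hh := S.hbar_pos
  have hcont := S.continuous_sqNorm
  have hint : Integrable (fun z => ((2 * Real.pi * S.hbar) ^ (Module.finrank ℝ V / 2))⁻¹ *
      Real.exp (-S.sqNorm z / (2 * S.hbar))) S.vol := by
    refine Integrable.const_mul ?_ _
    set r : ℕ := Module.finrank ℝ V + 1
    have hJ := integrable_one_add_norm (E := V) (μ := S.vol) (r := (r : ℝ)) (by simp [r])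
    set d : ℝ := c / (2 * S.hbar) with hd
    have hdpos : 0 < d := by positivity
    have hbound : ∃ C : ℝ, ∀ x : ℝ, 0 ≤ x → (1 + x) ^ r * Real.exp (-(d * x ^ 2)) ≤ C := by
      refine ⟨r.factorial * Real.exp (1 + 1 / (4 * d)), fun x hx => ?_⟩
      have h1 : (1 + x) ^ r ≤ r.factorial * Real.exp (1 + x) := by
        have := Real.pow_div_factorial_le_exp (1 + x) (by positivity) r
        rwa [div_le_iff₀ (by positivity), mul_comm] at this
      calc (1 + x) ^ r * Real.exp (-(d * x ^ 2))
          ≤ r.factorial * Real.exp (1 + x) * Real.exp (-(d * x ^ 2)) := by gcongr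
        _ = r.factorial * Real.exp (1 + x - d * x ^ 2) := by
            rw [mul_assoc, ← Real.exp_add, sub_eq_add_neg]
        _ ≤ _ := by
            gcongr
            have h2 : 0 ≤ d * (x - 1 / (2 * d)) ^ 2 := by positivity
            have h3 : d * (x - 1 / (2 * d)) ^ 2 = d * x ^ 2 - x + 1 / (4 * d) := by
              field_simp
              ring
            linarith
    obtain ⟨C, hC⟩ := hbound
    refine (hJ.const_mul C).mono' (Continuous.aestronglyMeasurable (by fun_prop))
      (Filter.Eventually.of_forall fun z => ?_)
    rw [Real.norm_eq_abs, abs_of_pos (Real.exp_pos _)]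
    have h1 : Real.exp (-S.sqNorm z / (2 * S.hbar)) ≤ Real.exp (-(d * ‖z‖ ^ 2)) := by
      refine Real.exp_le_exp.2 ?_
      rw [neg_div, neg_le_neg_iff, hd, div_mul_eq_mul_div]
      exact div_le_div_of_nonneg_right (hle z) (by positivity)
    refine h1.trans ?_
    have hpos : (0 : ℝ) < (1 + ‖z‖) ^ r := by positivity
    rw [Real.rpow_neg (by positivity), Real.rpow_natCast, ← div_eq_mul_inv, le_div_iff₀ hpos,
      mul_comm]
    exact hC _ (norm_nonneg z)
  haveI : IsFiniteMeasure S.gaussian := isFiniteMeasure_withDensity_ofReal hint.2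
  exact memLp_const 1

/-- The vacuum vector `e_0`, the constant function one. -/
def vac : S.Fock := ⟨fun _ => 1, S.one_mem_fock⟩


/-- The smooth vectors of the representation `U_j` of the Heisenberg group. -/
def Smooth : Submodule ℂ S.Fock where
  carrier := {f | ContDiff ℝ ∞ fun p : V × ℝ => S.heis p f}
  add_mem' := by
    intro f g hf hg
    simp only [Set.mem_ofPred_eq, map_add] at *
    exact hf.add hg
  zero_mem' := by
    simp only [Set.mem_ofPred_eq, map_zero]
    exact contDiff_const
  smul_mem' := by
    intro c f hf
    simp only [Set.mem_ofPred_eq, map_smul] at *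
    exact hf.const_smul c

theorem contDiff_heis (f : S.Smooth) : ContDiff ℝ ∞ fun p : V × ℝ => S.heis p f := f.2

theorem heis_deriv (v : V) {f : S.Fock} (hf : ContDiff ℝ ∞ fun p : V × ℝ => S.heis p f)
    (p : V × ℝ) : S.heis p (deriv (fun t : ℝ => S.heis (t • v, 0) f) 0) =
      fderiv ℝ (fun p : V × ℝ => S.heis p f) p (v, -(S.Ω p.1 v) / 2) := by
  have h0 : DifferentiableAt ℝ (fun t : ℝ => S.heis (t • v, 0) f) 0 := by
    have h1 : ContDiff ℝ ∞ fun t : ℝ => S.heis (t • v, 0) f :=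
      hf.comp ((contDiff_id.smul contDiff_const).prodMk contDiff_const)
    exact h1.differentiable (by simp) 0
  have h2 : HasDerivAt (fun t : ℝ => S.heis p (S.heis (t • v, 0) f))
      (S.heis p (deriv (fun t : ℝ => S.heis (t • v, 0) f) 0)) 0 :=
    ((S.heis p).toContinuousLinearMap.restrictScalars ℝ).hasFDerivAt.comp_hasDerivAt 0
      h0.hasDerivAt
  have h3 : HasDerivAt (fun t : ℝ => S.heisMul p (t • v, 0)) (v, -(S.Ω p.1 v) / 2) 0 := by
    have e : (fun t : ℝ => S.heisMul p (t • v, 0)) =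
        fun t : ℝ => p + t • (v, -(S.Ω p.1 v) / 2) := by
      ext t
      · simp [heisMul]
      · simp [heisMul]; ring
    rw [e]
    simpa using ((hasDerivAt_id (0 : ℝ)).smul_const (v, -(S.Ω p.1 v) / 2)).const_add p
  have h4 : HasDerivAt (fun t : ℝ => S.heis (S.heisMul p (t • v, 0)) f)
      (fderiv ℝ (fun p : V × ℝ => S.heis p f) p (v, -(S.Ω p.1 v) / 2)) 0 := by
    have h5 : HasFDerivAt (fun p : V × ℝ => S.heis p f)
        (fderiv ℝ (fun p : V × ℝ => S.heis p f) p) (S.heisMul p ((0 : ℝ) • v, 0)) := by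
      have : S.heisMul p ((0 : ℝ) • v, 0) = p := by simp [heisMul]
      rw [this]
      exact (hf.differentiable (by simp) p).hasFDerivAt
    exact h5.comp_hasDerivAt 0 h3
  simp only [heis_heis] at h2
  exact h2.unique h4

theorem deriv_heis_mem (v : V) (f : S.Smooth) :
    deriv (fun t : ℝ => S.heis (t • v, 0) (f : S.Fock)) 0 ∈ S.Smooth := by
  have h : (fun p => S.heis p (deriv (fun t : ℝ => S.heis (t • v, 0) (f : S.Fock)) 0)) = fun p =>
      fderiv ℝ (fun p : V × ℝ => S.heis p f) p (v, -(S.Ω p.1 v) / 2) :=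
    funext fun p => S.heis_deriv v f.2 p
  change ContDiff ℝ ∞ fun p => _
  rw [h]
  have h1 : ContDiff ℝ ∞ fun p : V × ℝ => fderiv ℝ (fun p : V × ℝ => S.heis p f) p :=
    (S.contDiff_heis f).fderiv_right (by simp)
  have h2 : ContDiff ℝ ∞ fun p : V × ℝ => S.Ω p.1 v :=
    ((LinearMap.toContinuousLinearMap (S.Ω.flip v)).contDiff).comp contDiff_fst
  exact h1.clm_apply (contDiff_const.prodMk (h2.neg.div_const _))

/-- Clifford multiplication `cl(v) = dU_j(v, 0)`, an operator on the smooth vectors. -/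
def cl (v : V) : Module.End ℂ S.Smooth where
  toFun f := ⟨deriv (fun t : ℝ => S.heis (t • v, 0) (f : S.Fock)) 0, S.deriv_heis_mem v f⟩
  map_add' f g := by
    refine Subtype.ext ?_
    have h := S.heis_deriv v (f + g).2 0
    have hf := S.heis_deriv v f.2 0
    have hg := S.heis_deriv v g.2 0
    simp only [heis_zero] at h hf hg
    change deriv _ 0 = deriv _ 0 + deriv _ 0
    rw [h, hf, hg]
    simp only [Submodule.coe_add, map_add]
    rw [fderiv_fun_add ((S.contDiff_heis f).differentiable (by simp) _)
      ((S.contDiff_heis g).differentiable (by simp) _)]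
    rfl
  map_smul' c f := by
    refine Subtype.ext ?_
    have h := S.heis_deriv v (c • f).2 0
    have hf := S.heis_deriv v f.2 0
    simp only [heis_zero] at h hf
    change deriv _ 0 = c • deriv _ 0
    rw [h, hf]
    simp only [Submodule.coe_smul, map_smul]
    rw [fderiv_fun_const_smul ((S.contDiff_heis f).differentiable (by simp) _)]
    rfl

theorem heis_cl (v : V) (f : S.Smooth) (p : V × ℝ) : S.heis p (S.cl v f : S.Fock) =
    fderiv ℝ (fun p : V × ℝ => S.heis p f) p (v, -(S.Ω p.1 v) / 2) := S.heis_deriv v f.2 p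

theorem coe_cl (v : V) (f : S.Smooth) : (S.cl v f : S.Fock) =
    fderiv ℝ (fun p : V × ℝ => S.heis p f) 0 (v, 0) := by
  simpa [heis_zero] using S.heis_cl v f 0

theorem cl_add (v w : V) : S.cl (v + w) = S.cl v + S.cl w := by
  refine LinearMap.ext fun f => Subtype.ext ?_
  simp only [LinearMap.add_apply, Submodule.coe_add, coe_cl, ← map_add]
  simp

theorem cl_smul (r : ℝ) (v : V) : S.cl (r • v) = (r : ℂ) • S.cl v := by
  refine LinearMap.ext fun f => Subtype.ext ?_
  simp only [LinearMap.smul_apply, Submodule.coe_smul, coe_cl]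
  have : ((r • v, 0) : V × ℝ) = r • (v, 0) := by simp
  rw [this, map_smul]
  rfl

theorem heis_central (p : V × ℝ) (t : ℝ) (f : S.Fock) :
    S.heis (p.1, p.2 + t) f = Complex.exp (-(Complex.I * t / S.hbar)) • S.heis p f := by
  refine Fock.ext fun z => ?_
  simp only [heis_apply, heisFun, Fock.smul_apply, ← mul_assoc, ← Complex.exp_add]
  congr 2
  push_cast
  ring

theorem fderiv_heis_central (f : S.Smooth) :
    fderiv ℝ (fun p : V × ℝ => S.heis p f) 0 (0, 1) = (-(Complex.I / S.hbar)) • (f : S.Fock) := by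
  have h1 : HasDerivAt (fun t : ℝ => S.heis ((0 : V), t) f)
      (fderiv ℝ (fun p : V × ℝ => S.heis p f) 0 (0, 1)) 0 := by
    have h2 : HasDerivAt (fun t : ℝ => ((0 : V), t)) (0, 1) 0 :=
      (hasDerivAt_const _ _).prodMk (hasDerivAt_id _)
    exact (((S.contDiff_heis f).differentiable (by simp) 0).hasFDerivAt).comp_hasDerivAt 0 h2
  have h3 : (fun t : ℝ => S.heis ((0 : V), t) f) =
      fun t : ℝ => Complex.exp (-(Complex.I * t / S.hbar)) • (f : S.Fock) := by
    ext t : 1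
    have := S.heis_central 0 t f
    rw [heis_zero] at this
    simpa using this
  rw [h3] at h1
  refine h1.unique ?_
  have h4 : HasDerivAt (fun t : ℝ => Complex.exp (-(Complex.I * t / S.hbar)))
      (-(Complex.I / S.hbar)) 0 := by
    have h5 : HasDerivAt (fun t : ℝ => -(Complex.I * (t : ℂ) / S.hbar)) (-(Complex.I / S.hbar)) 0 := by
      have := (((Complex.ofRealCLM.hasDerivAt (x := 0)).const_mul Complex.I).div_const
        (S.hbar : ℂ)).neg
      rw [Complex.ofRealCLM_apply, Complex.ofReal_one, mul_one] at this
      exact this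
    simpa using h5.cexp
  exact h4.smul_const _

theorem cl_commutator (v w : V) :
    S.cl v * S.cl w - S.cl w * S.cl v = ((Complex.I / S.hbar) * (S.Ω v w : ℂ)) • 1 := by
  refine LinearMap.ext fun f => Subtype.ext ?_
  set F : V × ℝ → S.Fock := fun p => S.heis p f with hF
  have hFs : ContDiff ℝ ∞ F := S.contDiff_heis f
  have key : ∀ v w : V, ((S.cl v (S.cl w f) : S.Smooth) : S.Fock) =
      fderiv ℝ (fderiv ℝ F) 0 (v, 0) (w, 0) + fderiv ℝ F 0 (0, -(S.Ω v w) / 2) := by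
    intro v w
    rw [coe_cl]
    have h1 : (fun p => S.heis p (S.cl w f : S.Fock)) =
        fun p => fderiv ℝ F p (w, -(S.Ω p.1 w) / 2) := funext fun p => S.heis_cl w f p
    rw [h1]
    have h2 : HasFDerivAt (fderiv ℝ F) (fderiv ℝ (fderiv ℝ F) 0) 0 :=
      ((hFs.fderiv_right (m := ∞) (by simp)).differentiable (by simp) 0).hasFDerivAt
    have h3 : HasFDerivAt (fun p : V × ℝ => (w, -(S.Ω p.1 w) / 2))
        ((0 : V × ℝ →L[ℝ] V).prod ((-(1 / 2 : ℝ)) •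
          (LinearMap.toContinuousLinearMap (S.Ω.flip w)).comp (ContinuousLinearMap.fst ℝ V ℝ)))
        0 := by
      refine (hasFDerivAt_const _ _).prodMk ?_
      have e : (fun p : V × ℝ => -(S.Ω p.1 w) / 2) = fun p => ((-(1 / 2 : ℝ)) •
          (LinearMap.toContinuousLinearMap (S.Ω.flip w)).comp (ContinuousLinearMap.fst ℝ V ℝ)) p := by
        ext p
        simp
        ring
      rw [e]
      exact ContinuousLinearMap.hasFDerivAt _
    rw [(h2.clm_apply h3).fderiv]
    simp [neg_div]
    rw [add_comm]
    congr 3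
    ring
  have hsymm : fderiv ℝ (fderiv ℝ F) 0 (v, 0) (w, 0) = fderiv ℝ (fderiv ℝ F) 0 (w, 0) (v, 0) := by
    have : IsSymmSndFDerivAt ℝ F 0 :=
      ContDiffAt.isSymmSndFDerivAt hFs.contDiffAt (by simpa using ENat.LEInfty.out)
    exact this _ _
  have hc : ∀ r : ℝ, fderiv ℝ F 0 ((0 : V), r) = r • ((-(Complex.I / S.hbar)) • (f : S.Fock)) := by
    intro r
    rw [← S.fderiv_heis_central f, ← map_smul]
    simp [hF]
  simp only [LinearMap.sub_apply, Module.End.mul_apply, AddSubgroupClass.coe_sub, key, hsymm, hc,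
    LinearMap.smul_apply, Module.End.one_apply, Submodule.coe_smul]
  rw [S.skew w v, add_sub_add_left_eq_sub, ← sub_smul, ← Complex.coe_smul, smul_smul]
  congr 1
  push_cast
  ring

/-- The relations of the symplectic Clifford algebra: linearity of `V → Cl(V, Ω)` over `ℝ`, and
`u v - v u = (i / ħ) Ω(u, v)`. -/
inductive CliffordRel : FreeAlgebra ℂ V → FreeAlgebra ℂ V → Prop
  | add (u v : V) : CliffordRel (FreeAlgebra.ι ℂ (u + v)) (FreeAlgebra.ι ℂ u + FreeAlgebra.ι ℂ v)
  | smul (r : ℝ) (v : V) :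
      CliffordRel (FreeAlgebra.ι ℂ (r • v)) ((r : ℂ) • FreeAlgebra.ι ℂ v)
  | comm (u v : V) : CliffordRel
      (FreeAlgebra.ι ℂ u * FreeAlgebra.ι ℂ v - FreeAlgebra.ι ℂ v * FreeAlgebra.ι ℂ u)
      (algebraMap ℂ _ ((Complex.I / S.hbar) * (S.Ω u v : ℂ)))

/-- The symplectic Clifford algebra `Cl(V, Ω)`. -/
abbrev Clifford : Type _ := RingQuot S.CliffordRel

/-- The generators of the symplectic Clifford algebra. -/
def gen (v : V) : S.Clifford := RingQuot.mkAlgHom ℂ S.CliffordRel (FreeAlgebra.ι ℂ v)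

/-- Clifford multiplication, as a representation of the symplectic Clifford algebra on the smooth
vectors. -/
def clAlg : S.Clifford →ₐ[ℂ] Module.End ℂ S.Smooth :=
  RingQuot.liftAlgHom ℂ ⟨FreeAlgebra.lift ℂ S.cl, by
    rintro x y (⟨u, v⟩ | ⟨r, v⟩ | ⟨u, v⟩)
    · simp [cl_add]
    · simp only [FreeAlgebra.lift_ι_apply, cl_smul, map_smul]
    · refine Eq.trans ?_ (AlgHom.commutes _ _).symm
      rw [Algebra.algebraMap_eq_smul_one, ← cl_commutator]
      simp only [map_sub, map_mul, FreeAlgebra.lift_ι_apply]⟩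

theorem clAlg_gen (v : V) : S.clAlg (S.gen v) = S.cl v := by
  simp [clAlg, gen]

theorem gen_add (v w : V) : S.gen (v + w) = S.gen v + S.gen w := by
  simpa [gen] using RingQuot.mkAlgHom_rel ℂ (CliffordRel.add (S := S) v w)

theorem gen_smul (r : ℝ) (v : V) : S.gen (r • v) = (r : ℂ) • S.gen v := by
  rw [gen, gen, ← map_smul]
  exact RingQuot.mkAlgHom_rel ℂ (CliffordRel.smul (S := S) r v)

/-- The `Ω`-dual basis `(b^a)` of a basis `(b_a)` of `V`: `Ω(b_a, b^c) = δ_{ac}`. -/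
def dualBasis {ι : Type*} [Finite ι] [DecidableEq ι] (b : Module.Basis ι ℝ V) (a : ι) : V :=
  -(S.Ω.dualBasis S.nondegenerate b a)

theorem apply_dualBasis {ι : Type*} [Finite ι] [DecidableEq ι] (b : Module.Basis ι ℝ V)
    (a c : ι) : S.Ω (b a) (S.dualBasis b c) = if a = c then 1 else 0 := by
  rw [dualBasis, map_neg, ← S.skew, LinearMap.BilinForm.apply_dualBasis_left]

/-- The map `ν` from `sp(V, Ω)` to the Clifford algebra. It is the linear map taking
`Ω(v, ·) ⊗ w + Ω(w, ·) ⊗ v` to `-(iħ/2)(v w + w v)`, see `nu_rankOne`; since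
`ξ = ∑ Ω(e_a, ·) ⊗ ξ(e^a)`, an element `ξ` of `sp(V, Ω)` is sent to
`-(iħ/4) ∑ (e_a ξ(e^a) + ξ(e^a) e_a)`. -/
def nu (ξ : Module.End ℝ V) : S.Clifford :=
  (-(Complex.I * S.hbar / 4)) • ∑ a, (S.gen (Module.finBasis ℝ V a) *
    S.gen (ξ (S.dualBasis (Module.finBasis ℝ V) a)) +
    S.gen (ξ (S.dualBasis (Module.finBasis ℝ V) a)) * S.gen (Module.finBasis ℝ V a))

/-- The endomorphism `Ω(v, ·) ⊗ w`. -/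
def rankOne (v w : V) : Module.End ℝ V := (S.Ω v).smulRight w

theorem nu_rankOne (v w : V) : S.nu (S.rankOne v w + S.rankOne w v) =
    (-(Complex.I * S.hbar / 2)) • (S.gen v * S.gen w + S.gen w * S.gen v) := by
  set b := Module.finBasis ℝ V
  have hv : ∀ v : V, ∑ a, ((S.Ω v (S.dualBasis b a) : ℝ) : ℂ) • S.gen (b a) = S.gen v := by
    intro v
    have h1 : v = ∑ a, S.Ω v (S.dualBasis b a) • b a := by
      conv_lhs => rw [← b.sum_repr v]
      refine Finset.sum_congr rfl fun a _ => ?_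
      congr 1
      conv_rhs => rw [← b.sum_repr v]
      simp only [map_sum, LinearMap.sum_apply, map_smul, LinearMap.smul_apply, apply_dualBasis,
        smul_eq_mul, mul_ite, mul_one, mul_zero, Finset.sum_ite_eq', Finset.mem_univ, if_true]
    have h2 : ∀ s : Finset (Fin (Module.finrank ℝ V)), ∑ a ∈ s, ((S.Ω v (S.dualBasis b a) : ℝ) : ℂ)
        • S.gen (b a) = S.gen (∑ a ∈ s, S.Ω v (S.dualBasis b a) • b a) := by
      intro s
      induction s using Finset.induction_on with
      | empty => simpa using (S.gen_smul 0 0).symm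
      | insert a s ha ih => rw [Finset.sum_insert ha, Finset.sum_insert ha, gen_add, gen_smul, ih]
    rw [h2, ← h1]
  have hsum : ∀ v w : V, ∑ a, (S.gen (b a) * (((S.Ω v (S.dualBasis b a) : ℝ) : ℂ) • S.gen w) +
      (((S.Ω v (S.dualBasis b a) : ℝ) : ℂ) • S.gen w) * S.gen (b a)) =
      S.gen v * S.gen w + S.gen w * S.gen v := by
    intro v w
    conv_rhs => rw [← hv v]
    rw [Finset.sum_mul, Finset.mul_sum, ← Finset.sum_add_distrib]
    refine Finset.sum_congr rfl fun a _ => ?_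
    simp
  have e : ∀ a, S.gen ((S.rankOne v w + S.rankOne w v) (S.dualBasis b a)) =
      ((S.Ω v (S.dualBasis b a) : ℝ) : ℂ) • S.gen w +
      ((S.Ω w (S.dualBasis b a) : ℝ) : ℂ) • S.gen v := by
    intro a
    simp [rankOne, gen_add, gen_smul]
  have h3 : ∑ a, (S.gen (b a) * S.gen ((S.rankOne v w + S.rankOne w v) (S.dualBasis b a)) +
      S.gen ((S.rankOne v w + S.rankOne w v) (S.dualBasis b a)) * S.gen (b a)) =
      (2 : ℂ) • (S.gen v * S.gen w + S.gen w * S.gen v) := by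
    simp only [e, mul_add, add_mul]
    have := congrArg₂ (· + ·) (hsum v w) (hsum w v)
    simp only [← Finset.sum_add_distrib] at this
    rw [two_smul]
    refine Eq.trans ?_ (this.trans (by abel))
    refine Finset.sum_congr rfl fun a _ => ?_
    abel
  rw [nu, h3, smul_smul]
  congr 1
  ring


/-- The group `Mp^c(V, Ω, j)`: pairs `(U, g)` of a unitary operator `U` of the Fock space and a
symplectic map `g` of `V` with `U_j(g v, t) = U U_j(v, t) U⁻¹`. -/
def Mpc : Subgroup ((S.Fock ≃ₗᵢ[ℂ] S.Fock) × (V ≃ₗ[ℝ] V)) where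
  carrier := {x | (∀ v w, S.Ω (x.2 v) (x.2 w) = S.Ω v w) ∧
    ∀ (v : V) (t : ℝ) (f : S.Fock), S.heis (x.2 v, t) f = x.1 (S.heis (v, t) (x.1⁻¹ f))}
  mul_mem' := by
    rintro x y ⟨hx, hx'⟩ ⟨hy, hy'⟩
    refine ⟨fun v w => ?_, fun v t f => ?_⟩
    · exact (hx _ _).trans (hy _ _)
    · have h := hx' (y.2 v) t f
      rw [hy'] at h
      simpa [mul_inv_rev] using h
  one_mem' := ⟨fun _ _ => rfl, fun _ _ _ => rfl⟩
  inv_mem' := by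
    rintro x ⟨hx, hx'⟩
    have e : ∀ v, x.2 (x.2⁻¹ v) = v := fun v => x.2.apply_symm_apply v
    have ee : ∀ f, x.1⁻¹ (x.1 f) = f := fun f => x.1.symm_apply_apply f
    refine ⟨fun v w => ?_, fun v t f => ?_⟩
    · simpa only [e, Prod.snd_inv] using (hx (x.2⁻¹ v) (x.2⁻¹ w)).symm
    · have h := hx' (x.2⁻¹ v) t (x.1 f)
      rw [e, ee] at h
      simp only [Prod.snd_inv, Prod.fst_inv, inv_inv, h, ee]

/-- The unitary operator `U` of `(U, g)`; this is the representation of `Mp^c` on the Fock space. -/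
def Mpc.U (m : S.Mpc) : S.Fock ≃ₗᵢ[ℂ] S.Fock := m.1.1

/-- The homomorphism `σ(U, g) = g`. -/
def Mpc.σ (m : S.Mpc) : V ≃ₗ[ℝ] V := m.1.2

/-- The parameter `λ = (U e_0)(0)` of `(U, g)`. -/
def Mpc.lam (m : S.Mpc) : ℂ := (Mpc.U S m S.vac) 0

/-- The vector space `V` regarded as a complex vector space through `j`. -/
def Cplx (_ : FockModel V) : Type _ := V

instance : AddCommGroup S.Cplx := inferInstanceAs (AddCommGroup V)

/-- The algebra homomorphism `ℂ → End(V)`, `a + i b ↦ a + b j`. -/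
def cplxAction : ℂ →ₐ[ℝ] Module.End ℝ V :=
  Complex.lift ⟨(S.j : Module.End ℝ V), LinearMap.ext S.j_sq⟩

theorem cplxAction_apply (c : ℂ) (v : V) : S.cplxAction c v = c.re • v + c.im • S.j v := by
  rw [cplxAction, Complex.lift_apply, Complex.liftAux_apply]
  rfl

/-- `(a + i b) v = a v + b j v`. -/
instance : Module ℂ S.Cplx := Module.compHom V S.cplxAction.toRingHom

/-- The complex linear part `C_g = (g - j g j) / 2` of `g`. -/
def linPart (g : V →ₗ[ℝ] V) : V →ₗ[ℝ] V := (1 / 2 : ℝ) • (g - S.j ∘ₗ g ∘ₗ S.j)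

theorem linPart_j (g : V →ₗ[ℝ] V) (v : V) : S.linPart g (S.j v) = S.j (S.linPart g v) := by
  simp only [linPart, LinearMap.smul_apply, LinearMap.sub_apply, LinearMap.comp_apply, S.j_sq,
    map_neg, map_smul, map_sub]
  module

/-- `C_g` as an endomorphism of the complex vector space `(V, j)`. -/
def linPartC (g : V →ₗ[ℝ] V) : S.Cplx →ₗ[ℂ] S.Cplx where
  toFun := S.linPart g
  map_add' := (S.linPart g).map_add
  map_smul' c v := by
    have h : ∀ v : V, S.linPart g (S.cplxAction c v) = S.cplxAction c (S.linPart g v) := fun v => by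
      simp only [cplxAction_apply, map_add, map_smul, linPart_j]
    exact h v

/-- The complex determinant `Det_j C_g`. -/
def detC (g : V →ₗ[ℝ] V) : ℂ := LinearMap.det (S.linPartC g)

/-- The character `η(U, g) = λ² Det_j C_g` of `Mp^c`. -/
def Mpc.η (m : S.Mpc) : ℂ := (Mpc.lam S m) ^ 2 * S.detC (Mpc.σ S m)

/-- The unitary multiples of the identity of the Fock space. -/
def scalarIsom (c : Circle) : S.Fock ≃ₗᵢ[ℂ] S.Fock where
  toLinearEquiv := LinearEquiv.smulOfNeZero ℂ S.Fock (c : ℂ) c.coe_ne_zero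
  norm_map' f := by
    change ‖(c : ℂ) • f‖ = ‖f‖
    rw [norm_smul, Circle.norm_coe, one_mul]

/-- The inclusion `c ↦ (c Id, Id)` of the central `U(1)` in `Mp^c`. -/
def Mpc.ofCircle (c : Circle) : S.Mpc :=
  ⟨(S.scalarIsom c, 1), fun _ _ => rfl, fun v t f => by
    have h : ∀ f, S.scalarIsom c f = (c : ℂ) • f := fun f => rfl
    have h' : S.scalarIsom c ((S.scalarIsom c)⁻¹ f) = f := (S.scalarIsom c).apply_symm_apply f
    change S.heis (v, t) f = S.scalarIsom c (S.heis (v, t) ((S.scalarIsom c)⁻¹ f))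
    rw [h, ← map_smul, ← h, h']⟩

end FockModel

end Fock

noncomputable section Spinors

/-- A partial derivative of a smooth map depends smoothly on the parameter. -/
theorem contMDiff_mfderiv_param {F E W : Type*} [NormedAddCommGroup F] [NormedSpace ℝ F]
    [NormedAddCommGroup E] [NormedSpace ℝ E] [NormedAddCommGroup W] [NormedSpace ℝ W]
    {H : Type*} [TopologicalSpace H] {J : ModelWithCorners ℝ F H}
    {N M : Type*} [TopologicalSpace N] [ChartedSpace H N] [IsManifold J 1 N]
    [TopologicalSpace M] [ChartedSpace E M] [IsManifold 𝓘(ℝ, E) 1 M] (f : N → M → W)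
    (hf : ContMDiff (J.prod 𝓘(ℝ, E)) 𝓘(ℝ, W) ∞ (Function.uncurry f)) (x : M) (X : E) :
    ContMDiff J 𝓘(ℝ, W) ∞ fun q => (show E →L[ℝ] W from mfderiv 𝓘(ℝ, E) 𝓘(ℝ, W) (f q) x) X := by
  intro q₀
  have h := ContMDiffAt.mfderiv_apply (J := J) (J' := J) (I := 𝓘(ℝ, E)) (I' := 𝓘(ℝ, W)) (n := ∞)
    (m := ∞) f (fun _ => x) id (fun _ => X) (x₀ := q₀) (hf _) contMDiffAt_const contMDiffAt_id
    contMDiffAt_const (by simp)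
  refine h.congr_of_eventuallyEq (Filter.Eventually.of_forall fun q => ?_)
  have e := inTangentCoordinates_eq (I := 𝓘(ℝ, E)) (I' := 𝓘(ℝ, W)) (fun _ : N => x)
    (fun q => f q x) (fun q => mfderiv 𝓘(ℝ, E) 𝓘(ℝ, W) (f q) x) (x₀ := q₀) (x := q)
    (mem_chart_source E x) (by exact Set.mem_univ _)
  rw [tangentBundleCore_coordChange_model_space] at e
  refine Eq.trans ?_ (congrArg (fun A : E →L[ℝ] W => A X) e).symm
  have e2 := (tangentBundleCore 𝓘(ℝ, E) M).coordChange_self (achart E x) x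
    (by exact mem_chart_source E x) X
  exact (congrArg (show E →L[ℝ] W from mfderiv 𝓘(ℝ, E) 𝓘(ℝ, W) (f q) x) e2).symm

variable {V : Type*} [NormedAddCommGroup V] [NormedSpace ℝ V] [FiniteDimensional ℝ V]
variable {E : Type*} [NormedAddCommGroup E] [NormedSpace ℝ E]

/-- Real Lie groups are of class `C^3`, which provides the Lie bracket on the Lie algebra. -/
instance lieGroupMinSmoothness (G : Type*) [TopologicalSpace G] [ChartedSpace E G] [Group G]
    [LieGroup 𝓘(ℝ, E) ∞ G] : LieGroup 𝓘(ℝ, E) (minSmoothness ℝ 3) G :=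
  LieGroup.of_le (n := ∞) (by simpa using ENat.LEInfty.out)

variable {G : Type*} [TopologicalSpace G] [ChartedSpace E G] [Group G] [LieGroup 𝓘(ℝ, E) ∞ G]

theorem isManifold_one : IsManifold 𝓘(ℝ, E) 1 G :=
  haveI : IsManifold 𝓘(ℝ, E) ∞ G :=
    (inferInstance : LieGroup 𝓘(ℝ, E) ∞ G).toContMDiffMul.toIsManifold
  IsManifold.of_le (n := ∞) (by simp)

variable (E G) in
/-- The smooth functions from `G` to the Fréchet space `H^∞` of smooth vectors. The topology of
`H^∞` is the one induced by `f ↦ (p ↦ U_j(p) f)` from the smooth `H`-valued functions on the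
Heisenberg group, so that `φ` is smooth if and only if `(g, p) ↦ U_j(p) φ(g)` is smooth. -/
def SmoothFun (S : FockModel V) : Submodule ℂ (G → S.Smooth) where
  carrier := {φ | ContMDiff (𝓘(ℝ, E).prod 𝓘(ℝ, V × ℝ)) 𝓘(ℝ, S.Fock) ∞
    fun q : G × (V × ℝ) => S.heis q.2 (φ q.1 : S.Fock)}
  add_mem' := by
    intro φ ψ hφ hψ
    simp only [Set.mem_ofPred_eq, Pi.add_apply, Submodule.coe_add, map_add] at *
    exact hφ.add hψ
  zero_mem' := by
    simp only [Set.mem_ofPred_eq, Pi.zero_apply, Submodule.coe_zero, map_zero]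
    exact contMDiff_const
  smul_mem' := by
    intro c φ hφ
    simp only [Set.mem_ofPred_eq, Pi.smul_apply, Submodule.coe_smul, map_smul] at *
    have h : ContDiff ℝ ∞ fun f : S.Fock => c • f := contDiff_const_smul c
    exact h.contMDiff.comp hφ

theorem SmoothFun.contMDiff {S : FockModel V} {φ : G → S.Smooth} (hφ : φ ∈ SmoothFun E G S) :
    ContMDiff 𝓘(ℝ, E) 𝓘(ℝ, S.Fock) ∞ fun g => (φ g : S.Fock) := by
  have h : ContMDiff 𝓘(ℝ, E) (𝓘(ℝ, E).prod 𝓘(ℝ, V × ℝ)) ∞ fun g : G => (g, (0 : V × ℝ)) :=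
    contMDiff_id.prodMk contMDiff_const
  have h2 := ContMDiff.comp hφ h
  simpa [Function.comp_def, FockModel.heis_zero] using h2

/-- The derivative of `φ : G → H^∞` along the left-invariant vector field defined by `X`, with
values in the Hilbert space. -/
def leftDerivFun (S : FockModel V) (X : GroupLieAlgebra 𝓘(ℝ, E) G) (φ : G → S.Smooth) (g : G) :
    S.Fock :=
  mfderiv 𝓘(ℝ, E) 𝓘(ℝ, S.Fock) (fun g => (φ g : S.Fock)) g (mulInvariantVectorField X g)

theorem heis_leftDerivFun (S : FockModel V) (X : GroupLieAlgebra 𝓘(ℝ, E) G) {φ : G → S.Smooth}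
    (hφ : φ ∈ SmoothFun E G S) (g : G) (p : V × ℝ) : S.heis p (leftDerivFun S X φ g) =
      mfderiv 𝓘(ℝ, E) 𝓘(ℝ, S.Fock) (fun h => S.heis p (φ (g * h) : S.Fock)) 1 X := by
  have hd : MDifferentiableAt 𝓘(ℝ, E) 𝓘(ℝ, S.Fock) (fun g => (φ g : S.Fock)) (g * 1) :=
    (SmoothFun.contMDiff hφ).mdifferentiableAt (by simp)
  have hm : MDifferentiableAt 𝓘(ℝ, E) 𝓘(ℝ, E) (fun h => g * h) (1 : G) :=
    (contMDiff_mul_left (I := 𝓘(ℝ, E)) (n := ∞)).mdifferentiableAt (by simp)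
  set L : S.Fock →L[ℝ] S.Fock := (S.heis p).toContinuousLinearMap.restrictScalars ℝ
  have hL : MDifferentiableAt 𝓘(ℝ, S.Fock) 𝓘(ℝ, S.Fock) L (φ (g * 1) : S.Fock) :=
    L.differentiableAt.mdifferentiableAt
  have h1 := mfderiv_comp (1 : G) (hL.comp (g * 1) hd) hm
  have h2 := mfderiv_comp (g * 1) hL hd
  have h3 : mfderiv 𝓘(ℝ, S.Fock) 𝓘(ℝ, S.Fock) L (φ (g * 1) : S.Fock) = L := by
    rw [mfderiv_eq_fderiv]
    exact L.fderiv
  have h4 : (fun h => S.heis p (φ (g * h) : S.Fock)) =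
    (L ∘ fun g => (φ g : S.Fock)) ∘ fun h => g * h := rfl
  rw [h4, h1, h2, h3]
  have h5 := congrArg (fun g' : G => (show E →L[ℝ] S.Fock from
    mfderiv 𝓘(ℝ, E) 𝓘(ℝ, S.Fock) (fun g => (φ g : S.Fock)) g')
      (show E from mulInvariantVectorField X g)) (mul_one g)
  exact (congrArg L h5).symm

theorem contMDiff_leftDerivFun (S : FockModel V) (X : GroupLieAlgebra 𝓘(ℝ, E) G) {φ : G → S.Smooth}
    (hφ : φ ∈ SmoothFun E G S) : ContMDiff (𝓘(ℝ, E).prod 𝓘(ℝ, V × ℝ)) 𝓘(ℝ, S.Fock) ∞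
      fun q : G × (V × ℝ) => S.heis q.2 (leftDerivFun S X φ q.1) := by
  haveI : IsManifold 𝓘(ℝ, E) 1 G := isManifold_one
  have h : ContMDiff ((𝓘(ℝ, E).prod 𝓘(ℝ, V × ℝ)).prod 𝓘(ℝ, E)) (𝓘(ℝ, E).prod 𝓘(ℝ, V × ℝ)) ∞
      fun q : (G × (V × ℝ)) × G => (q.1.1 * q.2, q.1.2) :=
    (contMDiff_fst.fst.mul contMDiff_snd).prodMk contMDiff_fst.snd
  refine (contMDiff_mfderiv_param (fun (q : G × (V × ℝ)) h => S.heis q.2 (φ (q.1 * h) : S.Fock))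
    (ContMDiff.comp hφ h) 1 X).congr fun q => ?_
  exact heis_leftDerivFun S X hφ q.1 q.2

theorem leftDerivFun_mem (S : FockModel V) (X : GroupLieAlgebra 𝓘(ℝ, E) G) {φ : G → S.Smooth}
    (hφ : φ ∈ SmoothFun E G S) (g : G) : leftDerivFun S X φ g ∈ S.Smooth := by
  have h : ContMDiff 𝓘(ℝ, V × ℝ) (𝓘(ℝ, E).prod 𝓘(ℝ, V × ℝ)) ∞ fun p : V × ℝ => (g, p) :=
    contMDiff_const.prodMk contMDiff_id
  exact ((contMDiff_leftDerivFun S X hφ).comp h).contDiff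

/-- The action of `X ∈ 𝔤` on the smooth functions `G → H^∞` as a left-invariant vector field. -/
def leftDeriv (S : FockModel V) (X : GroupLieAlgebra 𝓘(ℝ, E) G) :
    Module.End ℂ (SmoothFun E G S) where
  toFun φ := ⟨fun g => ⟨leftDerivFun S X φ g, leftDerivFun_mem S X φ.2 g⟩,
    contMDiff_leftDerivFun S X φ.2⟩
  map_add' φ ψ := by
    refine Subtype.ext (funext fun g => Subtype.ext ?_)
    have hφ := (SmoothFun.contMDiff φ.2).mdifferentiableAt (x := g) (by simp)
    have hψ := (SmoothFun.contMDiff ψ.2).mdifferentiableAt (x := g) (by simp)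
    change mfderiv _ _ ((fun g => (φ.1 g : S.Fock)) + fun g => (ψ.1 g : S.Fock)) g _ = _
    rw [mfderiv_add hφ hψ]
    rfl
  map_smul' c φ := by
    refine Subtype.ext (funext fun g => Subtype.ext ?_)
    have hφ := (SmoothFun.contMDiff φ.2).mdifferentiableAt (x := g) (by simp)
    set L : S.Fock →L[ℝ] S.Fock := (c • ContinuousLinearMap.id ℂ S.Fock).restrictScalars ℝ
    have hL : MDifferentiableAt 𝓘(ℝ, S.Fock) 𝓘(ℝ, S.Fock) L (φ.1 g : S.Fock) :=
      L.differentiableAt.mdifferentiableAt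
    change mfderiv _ _ (L ∘ fun g => (φ.1 g : S.Fock)) g _ = _
    rw [mfderiv_comp g hL hφ, mfderiv_eq_fderiv, L.fderiv]
    rfl

theorem hasDerivAt_heis_cl (S : FockModel V) (v : V) (f : S.Smooth) (p : V × ℝ) :
    HasDerivAt (fun t : ℝ => S.heis (p + t • (v, -(S.Ω p.1 v) / 2)) (f : S.Fock))
      (S.heis p (S.cl v f : S.Fock)) 0 := by
  rw [S.heis_cl]
  have h3 : HasDerivAt (fun t : ℝ => p + t • (v, -(S.Ω p.1 v) / 2)) (v, -(S.Ω p.1 v) / 2) 0 := by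
    simpa using ((hasDerivAt_id (0 : ℝ)).smul_const (v, -(S.Ω p.1 v) / 2)).const_add p
  have h4 : HasFDerivAt (fun p : V × ℝ => S.heis p (f : S.Fock))
      (fderiv ℝ (fun p : V × ℝ => S.heis p (f : S.Fock)) p)
      (p + (0 : ℝ) • (v, -(S.Ω p.1 v) / 2)) := by
    rw [zero_smul, add_zero]
    exact ((S.contDiff_heis f).differentiable (by simp) p).hasFDerivAt
  exact h4.comp_hasDerivAt 0 h3

theorem contDiff_shift (S : FockModel V) (v : V) :
    ContDiff ℝ ∞ fun q : (V × ℝ) × ℝ => q.1 + q.2 • (v, -(S.Ω q.1.1 v) / 2) := by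
  have h2 : ContDiff ℝ ∞ fun q : (V × ℝ) × ℝ => S.Ω q.1.1 v :=
    ((LinearMap.toContinuousLinearMap (S.Ω.flip v)).contDiff).comp
      (contDiff_fst.comp contDiff_fst)
  exact contDiff_fst.add (contDiff_snd.smul (contDiff_const.prodMk (h2.neg.div_const _)))

theorem contMDiff_shift (S : FockModel V) (v : V) :
    ContMDiff ((𝓘(ℝ, E).prod 𝓘(ℝ, V × ℝ)).prod 𝓘(ℝ, ℝ)) (𝓘(ℝ, E).prod 𝓘(ℝ, V × ℝ)) ∞
      fun q : (G × (V × ℝ)) × ℝ => (q.1.1, q.1.2 + q.2 • (v, -(S.Ω q.1.2.1 v) / 2)) := by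
  have h2 : ContMDiff ((𝓘(ℝ, E).prod 𝓘(ℝ, V × ℝ)).prod 𝓘(ℝ, ℝ)) 𝓘(ℝ, (V × ℝ) × ℝ) ∞
      fun q : (G × (V × ℝ)) × ℝ => (q.1.2, q.2) :=
    contMDiff_fst.snd.prodMk_space contMDiff_snd
  exact contMDiff_fst.fst.prodMk ((contDiff_shift S v).contMDiff.comp h2)

theorem contMDiff_comp_shift {W : Type*} [NormedAddCommGroup W] [NormedSpace ℝ W]
    (S : FockModel V) (v : V) (F : G × (V × ℝ) → W)
    (hF : ContMDiff (𝓘(ℝ, E).prod 𝓘(ℝ, V × ℝ)) 𝓘(ℝ, W) ∞ F) :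
    ContMDiff ((𝓘(ℝ, E).prod 𝓘(ℝ, V × ℝ)).prod 𝓘(ℝ, ℝ)) 𝓘(ℝ, W) ∞
      fun q : (G × (V × ℝ)) × ℝ => F (q.1.1, q.1.2 + q.2 • (v, -(S.Ω q.1.2.1 v) / 2)) :=
  hF.comp (contMDiff_shift S v)

theorem contMDiff_cl (S : FockModel V) (v : V) {φ : G → S.Smooth} (hφ : φ ∈ SmoothFun E G S) :
    ContMDiff (𝓘(ℝ, E).prod 𝓘(ℝ, V × ℝ)) 𝓘(ℝ, S.Fock) ∞
      fun q : G × (V × ℝ) => S.heis q.2 (S.cl v (φ q.1) : S.Fock) := by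
  haveI : IsManifold 𝓘(ℝ, E) 1 G := isManifold_one
  have h0 : ContMDiff (𝓘(ℝ, E).prod 𝓘(ℝ, V × ℝ)) 𝓘(ℝ, S.Fock) ∞
    fun q : G × (V × ℝ) => S.heis q.2 (φ q.1 : S.Fock) := hφ
  have h1 : ContMDiff ((𝓘(ℝ, E).prod 𝓘(ℝ, V × ℝ)).prod 𝓘(ℝ, ℝ)) 𝓘(ℝ, S.Fock) ∞
    fun q : (G × (V × ℝ)) × ℝ =>
      S.heis (q.1.2 + q.2 • (v, -(S.Ω q.1.2.1 v) / 2)) (φ q.1.1 : S.Fock) :=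
    contMDiff_comp_shift S v _ h0
  have h := contMDiff_mfderiv_param (fun (q : G × (V × ℝ)) (t : ℝ) =>
    S.heis (q.2 + t • (v, -(S.Ω q.2.1 v) / 2)) (φ q.1 : S.Fock)) h1 0 (1 : ℝ)
  refine h.congr fun q => ?_
  have h5 := (hasDerivAt_heis_cl S v (φ q.1) q.2).hasFDerivAt.hasMFDerivAt.mfderiv
  have h6 := congrArg (fun A : ℝ →L[ℝ] S.Fock => A 1) h5
  refine Eq.trans ?_ h6.symm
  simp

/-- Clifford multiplication by `v ∈ V` on the smooth functions `G → H^∞`. -/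
def clFun (S : FockModel V) (v : V) : Module.End ℂ (SmoothFun E G S) where
  toFun φ := ⟨fun g => S.cl v (φ.1 g), contMDiff_cl S v φ.2⟩
  map_add' _ _ := Subtype.ext (funext fun _ => (S.cl v).map_add _ _)
  map_smul' c _ := Subtype.ext (funext fun _ => (S.cl v).map_smul c _)

end Spinors

noncomputable section SymmetricSpaces

open VectorField

section Differential

variable {E : Type*} [NormedAddCommGroup E] [NormedSpace ℝ E]
variable {E₂ : Type*} [NormedAddCommGroup E₂] [NormedSpace ℝ E₂]
variable {G : Type*} [TopologicalSpace G] [ChartedSpace E G] [Group G]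
variable {G₂ : Type*} [TopologicalSpace G₂] [ChartedSpace E₂ G₂] [Group G₂]

variable (E E₂) in
/-- The differential at the identity of a homomorphism of Lie groups. -/
def differential (f : G →* G₂) : GroupLieAlgebra 𝓘(ℝ, E) G →L[ℝ] GroupLieAlgebra 𝓘(ℝ, E₂) G₂ :=
  mfderiv 𝓘(ℝ, E) 𝓘(ℝ, E₂) f 1

theorem differential_comp {E₃ : Type*} [NormedAddCommGroup E₃] [NormedSpace ℝ E₃]
    {G₃ : Type*} [TopologicalSpace G₃] [ChartedSpace E₃ G₃] [Group G₃] {f : G →* G₂}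
    {f' : G₂ →* G₃} (hf : ContMDiff 𝓘(ℝ, E) 𝓘(ℝ, E₂) ∞ f)
    (hf' : ContMDiff 𝓘(ℝ, E₂) 𝓘(ℝ, E₃) ∞ f') (X : GroupLieAlgebra 𝓘(ℝ, E) G) :
    differential E E₃ (f'.comp f) X = differential E₂ E₃ f' (differential E E₂ f X) := by
  have h := mfderiv_comp (1 : G) (hf'.mdifferentiableAt (x := f 1) (by simp))
    (hf.mdifferentiableAt (x := 1) (by simp))
  have h1 := congrArg (fun A : E →L[ℝ] E₃ => A X) h
  have h2 := congrArg (fun x : G₂ => (show E₂ →L[ℝ] E₃ from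
    mfderiv 𝓘(ℝ, E₂) 𝓘(ℝ, E₃) f' x) (show E₂ from mfderiv 𝓘(ℝ, E) 𝓘(ℝ, E₂) f 1 X)) (map_one f)
  exact h1.trans h2

theorem differential_id (X : GroupLieAlgebra 𝓘(ℝ, E) G) :
    differential E E (MonoidHom.id G) X = X :=
  congrArg (fun A : E →L[ℝ] E => A X) (mfderiv_id (I := 𝓘(ℝ, E)) (x := (1 : G)))

variable [LieGroup 𝓘(ℝ, E) ∞ G] [LieGroup 𝓘(ℝ, E₂) ∞ G₂]

theorem mfderiv_mulInvariantVectorField {f : G →* G₂} (hf : ContMDiff 𝓘(ℝ, E) 𝓘(ℝ, E₂) ∞ f)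
    (X : GroupLieAlgebra 𝓘(ℝ, E) G) (g : G) :
    mfderiv 𝓘(ℝ, E) 𝓘(ℝ, E₂) f g (mulInvariantVectorField X g) =
      mulInvariantVectorField (differential E E₂ f X) (f g) := by
  have hm : ContMDiff 𝓘(ℝ, E) 𝓘(ℝ, E) ∞ (fun h : G => g * h) := contMDiff_mul_left
  have hm' : ContMDiff 𝓘(ℝ, E₂) 𝓘(ℝ, E₂) ∞ (fun h : G₂ => f g * h) := contMDiff_mul_left
  have e : (f ∘ fun h : G => g * h) = (fun h : G₂ => f g * h) ∘ f := by
    ext h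
    simp
  have h1 := mfderiv_comp (1 : G) (hf.mdifferentiableAt (x := g * 1) (by simp))
    (hm.mdifferentiableAt (x := 1) (by simp))
  have h2 := mfderiv_comp (1 : G) (hm'.mdifferentiableAt (x := f 1) (by simp))
    (hf.mdifferentiableAt (x := 1) (by simp))
  have h1' := congrArg (fun A : E →L[ℝ] E₂ => A X) h1
  have h2' := congrArg (fun A : E →L[ℝ] E₂ => A X) h2
  have h3 := congrArg (fun F : G → G₂ => (show E →L[ℝ] E₂ from
    mfderiv 𝓘(ℝ, E) 𝓘(ℝ, E₂) F 1) X) e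
  have h4 := congrArg (fun x : G => (show E →L[ℝ] E₂ from
    mfderiv 𝓘(ℝ, E) 𝓘(ℝ, E₂) f x) (show E from mulInvariantVectorField X g)) (mul_one g)
  have h5 := congrArg (fun x : G₂ => (show E₂ →L[ℝ] E₂ from
    mfderiv 𝓘(ℝ, E₂) 𝓘(ℝ, E₂) (fun h : G₂ => f g * h) x)
    (show E₂ from mfderiv 𝓘(ℝ, E) 𝓘(ℝ, E₂) f 1 X)) (map_one f)
  exact h4.symm.trans (h1'.symm.trans (h3.trans (h2'.trans h5)))

/-- The differential of an isomorphism of Lie groups respects the Lie brackets. -/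
theorem differential_lie [CompleteSpace E] [CompleteSpace E₂] (f : G ≃* G₂)
    (hf : ContMDiff 𝓘(ℝ, E) 𝓘(ℝ, E₂) ∞ f) (hf' : ContMDiff 𝓘(ℝ, E₂) 𝓘(ℝ, E) ∞ f.symm)
    (X Y : GroupLieAlgebra 𝓘(ℝ, E) G) : differential E E₂ f.toMonoidHom ⁅X, Y⁆ =
      ⁅differential E E₂ f.toMonoidHom X, differential E E₂ f.toMonoidHom Y⁆ := by
  have hinv : ∀ g : G, (mfderiv 𝓘(ℝ, E) 𝓘(ℝ, E₂) f g).inverse =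
      (show E₂ →L[ℝ] E from mfderiv 𝓘(ℝ, E₂) 𝓘(ℝ, E) f.symm (f g)) ∧
      (∀ v : E, (show E₂ →L[ℝ] E from mfderiv 𝓘(ℝ, E₂) 𝓘(ℝ, E) f.symm (f g))
        ((show E →L[ℝ] E₂ from mfderiv 𝓘(ℝ, E) 𝓘(ℝ, E₂) f g) v) = v) ∧
      (∀ v : E₂, (show E →L[ℝ] E₂ from mfderiv 𝓘(ℝ, E) 𝓘(ℝ, E₂) f g)
        ((show E₂ →L[ℝ] E from mfderiv 𝓘(ℝ, E₂) 𝓘(ℝ, E) f.symm (f g)) v) = v) := by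
    intro g
    have e1 : f.symm ∘ f = id := funext f.symm_apply_apply
    have e2 : f ∘ f.symm = id := funext f.apply_symm_apply
    have h1 := mfderiv_comp g (hf'.mdifferentiableAt (x := f g) (by simp))
      (hf.mdifferentiableAt (x := g) (by simp))
    have h2 := mfderiv_comp (f g) (hf.mdifferentiableAt (x := f.symm (f g)) (by simp))
      (hf'.mdifferentiableAt (x := f g) (by simp))
    have h3 := congrArg (fun F : G → G => (show E →L[ℝ] E from mfderiv 𝓘(ℝ, E) 𝓘(ℝ, E) F g)) e1
    have h4 := congrArg (fun F : G₂ → G₂ => (show E₂ →L[ℝ] E₂ from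
      mfderiv 𝓘(ℝ, E₂) 𝓘(ℝ, E₂) F (f g))) e2
    have h5 := congrArg (fun x : G => (show E →L[ℝ] E₂ from
      mfderiv 𝓘(ℝ, E) 𝓘(ℝ, E₂) f x).comp (show E₂ →L[ℝ] E from
        mfderiv 𝓘(ℝ, E₂) 𝓘(ℝ, E) f.symm (f g))) (f.symm_apply_apply g)
    have h6 := mfderiv_id (I := 𝓘(ℝ, E)) (x := g)
    have h7 := mfderiv_id (I := 𝓘(ℝ, E₂)) (x := f g)
    have h8 := h5.symm.trans (h2.symm.trans (h4.trans h7))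
    have h9 := h1.symm.trans (h3.trans h6)
    exact ⟨ContinuousLinearMap.inverse_eq (f := (show E →L[ℝ] E₂ from
      mfderiv 𝓘(ℝ, E) 𝓘(ℝ, E₂) f g)) h8 h9,
      fun v => congrArg (fun A : E →L[ℝ] E => A v) h9,
      fun v => congrArg (fun A : E₂ →L[ℝ] E₂ => A v) h8⟩
  have hpull : ∀ X : GroupLieAlgebra 𝓘(ℝ, E) G, mpullback 𝓘(ℝ, E) 𝓘(ℝ, E₂) f
      (mulInvariantVectorField (differential E E₂ f.toMonoidHom X)) =
        mulInvariantVectorField X := by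
    intro X
    ext g
    have h1 := mfderiv_mulInvariantVectorField (f := f.toMonoidHom) hf X g
    have h2 := congrArg (fun A : E₂ →L[ℝ] E =>
      A (show E₂ from mulInvariantVectorField (differential E E₂ f.toMonoidHom X) (f g))) (hinv g).1
    have h3 := congrArg (show E₂ →L[ℝ] E from mfderiv 𝓘(ℝ, E₂) 𝓘(ℝ, E) f.symm (f g)) h1
    exact h2.trans (h3.symm.trans ((hinv g).2.1 _))
  haveI : IsManifold 𝓘(ℝ, E) (minSmoothness ℝ 3) G :=
    (inferInstance : LieGroup 𝓘(ℝ, E) (minSmoothness ℝ 3) G).toContMDiffMul.toIsManifold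
  haveI : IsManifold 𝓘(ℝ, E₂) (minSmoothness ℝ 3) G₂ :=
    (inferInstance : LieGroup 𝓘(ℝ, E₂) (minSmoothness ℝ 3) G₂).toContMDiffMul.toIsManifold
  have key := mpullback_mlieBracket (n := minSmoothness ℝ 3) (f := f) (x₀ := (1 : G))
    (mdifferentiableAt_mulInvariantVectorField (differential E E₂ f.toMonoidHom X))
    (mdifferentiableAt_mulInvariantVectorField (differential E E₂ f.toMonoidHom Y))
    ((hf.of_le (by simpa using ENat.LEInfty.out)) 1) (minSmoothness_monotone (by norm_cast))
  rw [hpull, hpull] at key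
  set L := mlieBracket 𝓘(ℝ, E₂) (mulInvariantVectorField (differential E E₂ f.toMonoidHom X))
    (mulInvariantVectorField (differential E E₂ f.toMonoidHom Y)) with hL
  have h1 : (show E₂ →L[ℝ] E from mfderiv 𝓘(ℝ, E₂) 𝓘(ℝ, E) f.symm (f 1)) (show E₂ from L (f 1)) =
      (show E from (⁅X, Y⁆ : GroupLieAlgebra 𝓘(ℝ, E) G)) :=
    (congrArg (fun A : E₂ →L[ℝ] E => A (show E₂ from L (f 1))) (hinv 1).1).symm.trans key
  have h2 := congrArg (show E →L[ℝ] E₂ from mfderiv 𝓘(ℝ, E) 𝓘(ℝ, E₂) f 1) h1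
  have h3 : (show E₂ from L (f 1)) = (show E₂ from L 1) :=
    congrArg (fun x : G₂ => (show E₂ from L x)) (map_one f)
  exact h2.symm.trans (((hinv 1).2.2 _).trans h3)

end Differential

variable {E : Type*} [NormedAddCommGroup E] [NormedSpace ℝ E]
variable {EK : Type*} [NormedAddCommGroup EK] [NormedSpace ℝ EK]
variable {G : Type*} [TopologicalSpace G] [ChartedSpace E G] [Group G] [LieGroup 𝓘(ℝ, E) ∞ G]

variable (E) in
/-- The adjoint action of `G` on its Lie algebra. -/
def Ad (g : G) : GroupLieAlgebra 𝓘(ℝ, E) G →L[ℝ] GroupLieAlgebra 𝓘(ℝ, E) G :=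
  differential E E (MulAut.conj g).toMonoidHom

theorem contMDiff_conj (g : G) : ContMDiff 𝓘(ℝ, E) 𝓘(ℝ, E) ∞ (MulAut.conj g) := by
  have h : ContMDiff 𝓘(ℝ, E) 𝓘(ℝ, E) ∞ fun x : G => g * x * g⁻¹ :=
    (contMDiff_const.mul contMDiff_id).mul contMDiff_const
  exact h

variable (E EK) in
/-- The Lie-theoretic data of a symmetric space `G/K`: an involutive automorphism `s` of the Lie
group `G`, and a closed Lie subgroup `K` of `G` which is contained in the fixed point group of `s`
and has the same Lie algebra as this group. -/
structure SymmetricPair (K : Subgroup G) [ChartedSpace EK K] where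
  /-- the involution -/
  s : G ≃* G
  contMDiff_s : ContMDiff 𝓘(ℝ, E) 𝓘(ℝ, E) ∞ s
  s_s : ∀ g, s (s g) = g
  s_fix : ∀ k ∈ K, s k = k
  isClosed : IsClosed (K : Set G)
  contMDiff_incl : ContMDiff 𝓘(ℝ, EK) 𝓘(ℝ, E) ∞ (K.subtype)
  incl_injective : Function.Injective (differential EK E K.subtype)
  fixed : ∀ X, differential E E s.toMonoidHom X = X → ∃ W, differential EK E K.subtype W = X

namespace SymmetricPair

variable {K : Subgroup G} [ChartedSpace EK K] (P : SymmetricPair E EK K)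

/-- The inclusion `𝔨 → 𝔤`. -/
def incl (_ : SymmetricPair E EK K) :
    GroupLieAlgebra 𝓘(ℝ, EK) K →L[ℝ] GroupLieAlgebra 𝓘(ℝ, E) G :=
  differential EK E K.subtype

/-- The involution of `𝔤`. -/
def sLie : GroupLieAlgebra 𝓘(ℝ, E) G →L[ℝ] GroupLieAlgebra 𝓘(ℝ, E) G :=
  differential E E P.s.toMonoidHom

/-- The complement `𝔭` of `𝔨` in `𝔤`, the `-1` eigenspace of the involution. -/
def p : Submodule ℝ (GroupLieAlgebra 𝓘(ℝ, E) G) where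
  carrier := {X | P.sLie X = -X}
  add_mem' := by
    intro X Y hX hY
    simp only [Set.mem_ofPred_eq, map_add, neg_add] at *
    rw [hX, hY]
  zero_mem' := by simp
  smul_mem' := by
    intro c X hX
    simp only [Set.mem_ofPred_eq, map_smul] at *
    rw [hX, smul_neg]

theorem mem_p {X : GroupLieAlgebra 𝓘(ℝ, E) G} : X ∈ P.p ↔ P.sLie X = -X := Iff.rfl

theorem Ad_mem_p (k : K) {X : GroupLieAlgebra 𝓘(ℝ, E) G} (hX : X ∈ P.p) :
    Ad E (k : G) X ∈ P.p := by
  rw [mem_p] at *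
  have h1 := differential_comp (f := (MulAut.conj (k : G)).toMonoidHom) (f' := P.s.toMonoidHom)
    (contMDiff_conj (k : G)) P.contMDiff_s X
  have h2 := differential_comp (f' := (MulAut.conj (k : G)).toMonoidHom) (f := P.s.toMonoidHom)
    P.contMDiff_s (contMDiff_conj (k : G)) X
  have h3 : P.s.toMonoidHom.comp (MulAut.conj (k : G)).toMonoidHom =
      (MulAut.conj (k : G)).toMonoidHom.comp P.s.toMonoidHom := by
    ext g
    simp [P.s_fix k k.2]
  rw [h3] at h1
  exact (h1.symm.trans h2).trans ((congrArg (Ad E (k : G)) hX).trans (map_neg _ _))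

theorem sLie_incl (W : GroupLieAlgebra 𝓘(ℝ, EK) K) : P.sLie (P.incl W) = P.incl W := by
  have h1 := differential_comp (f := K.subtype) (f' := P.s.toMonoidHom) P.contMDiff_incl
    P.contMDiff_s W
  have h3 : P.s.toMonoidHom.comp K.subtype = K.subtype := by
    ext k
    exact P.s_fix k k.2
  rw [h3] at h1
  exact h1.symm

theorem sLie_lie [CompleteSpace E] (X Y : GroupLieAlgebra 𝓘(ℝ, E) G) :
    P.sLie ⁅X, Y⁆ = ⁅P.sLie X, P.sLie Y⁆ := by
  have h : ⇑P.s.symm = P.s := funext fun g => P.s.symm_apply_eq.2 (P.s_s g).symm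
  exact differential_lie P.s P.contMDiff_s (by rw [h]; exact P.contMDiff_s) X Y

theorem lie_incl_mem_p [CompleteSpace E] (W : GroupLieAlgebra 𝓘(ℝ, EK) K)
    {X : GroupLieAlgebra 𝓘(ℝ, E) G} (hX : X ∈ P.p) : ⁅P.incl W, X⁆ ∈ P.p := by
  rw [mem_p] at *
  rw [sLie_lie, sLie_incl, hX, lie_neg]

end SymmetricPair

variable {V : Type*} [NormedAddCommGroup V] [NormedSpace ℝ V]

variable (E EK) in
/-- A symplectic symmetric space `G/K`. The tangent space `𝔭` at the base point is identified by
`θ` with the symplectic vector space `(V, Ω)` underlying the Fock model, and `Ω` is invariant under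
`K`, so that it defines the `G`-invariant symplectic form of `G/K`. The group `G` is the
transvection group up to a covering, i.e. `𝔨 = [𝔭, 𝔭]` and `𝔨` acts faithfully on `𝔭`. -/
structure SymplecticSymmetricSpace (S : FockModel V) (K : Subgroup G) [ChartedSpace EK K]
    [CompleteSpace E] extends SymmetricPair E EK K where
  /-- the identification of the model `V` with `𝔭` -/
  θ : V ≃ₗ[ℝ] toSymmetricPair.p
  Ω_Ad : ∀ (k : K) (v v' w w' : V), (θ v' : GroupLieAlgebra 𝓘(ℝ, E) G) = Ad E (k : G) (θ v) →
    (θ w' : GroupLieAlgebra 𝓘(ℝ, E) G) = Ad E (k : G) (θ w) → S.Ω v' w' = S.Ω v w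
  lie_p_p : ∀ W, toSymmetricPair.incl W ∈ Submodule.span ℝ
    {Z : GroupLieAlgebra 𝓘(ℝ, E) G | ∃ v w : V,
      Z = ⁅(θ v : GroupLieAlgebra 𝓘(ℝ, E) G), (θ w : GroupLieAlgebra 𝓘(ℝ, E) G)⁆}
  faithful : ∀ W, (∀ v : V,
    ⁅toSymmetricPair.incl W, (θ v : GroupLieAlgebra 𝓘(ℝ, E) G)⁆ = 0) → W = 0

namespace SymplecticSymmetricSpace

variable {S : FockModel V} {K : Subgroup G} [ChartedSpace EK K] [CompleteSpace E]
  (M : SymplecticSymmetricSpace E EK S K)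

/-- The inclusion of `V = 𝔭` in `𝔤`. -/
def vec (v : V) : GroupLieAlgebra 𝓘(ℝ, E) G := M.θ v

/-- The isotropy representation `τ(k) = Ad(k)|_𝔭`, on `V = 𝔭`. -/
def τ (k : K) : V →ₗ[ℝ] V :=
  M.θ.symm.toLinearMap ∘ₗ ((Ad E (k : G) : GroupLieAlgebra 𝓘(ℝ, E) G →L[ℝ] _).toLinearMap.restrict
    fun _ => M.Ad_mem_p k) ∘ₗ M.θ.toLinearMap

theorem vec_τ (k : K) (v : V) : M.vec (M.τ k v) = Ad E (k : G) (M.vec v) := by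
  simp [vec, τ]

/-- `ad(W)|_𝔭` for `W ∈ 𝔨`, on `V = 𝔭`. -/
def adp (W : GroupLieAlgebra 𝓘(ℝ, EK) K) : Module.End ℝ V :=
  M.θ.symm.toLinearMap ∘ₗ ((LieAlgebra.ad ℝ (GroupLieAlgebra 𝓘(ℝ, E) G) (M.incl W)).restrict
    fun _ => M.lie_incl_mem_p W) ∘ₗ M.θ.toLinearMap

theorem vec_adp (W : GroupLieAlgebra 𝓘(ℝ, EK) K) (v : V) :
    M.vec (M.adp W v) = ⁅M.incl W, M.vec v⁆ := by
  simp only [vec, adp, LinearMap.comp_apply, LinearEquiv.coe_coe, LinearEquiv.apply_symm_apply]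
  rfl

/-- `B` is the extension to `𝔤` of the form `B_A(X, Y) = -Ω(X, A⁻¹ Y)` on `𝔭`: an `Ad K`- and
`ad 𝔤`-invariant symmetric bilinear form with `B(X, [Y, Z]) = 0` and
`B([X, T], [Y, Z]) = B_A(X, [T, [Y, Z]])` for `X, Y, Z, T ∈ 𝔭`. -/
structure IsExtension (A : V ≃ₗ[ℝ] V)
    (B : LinearMap.BilinForm ℝ (GroupLieAlgebra 𝓘(ℝ, E) G)) : Prop where
  symm : ∀ X Y, B X Y = B Y X
  on_p : ∀ x y, B (M.vec x) (M.vec y) = -S.Ω x (A.symm y)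
  mixed : ∀ x y z, B (M.vec x) ⁅M.vec y, M.vec z⁆ = 0
  on_k : ∀ x y z t, B ⁅M.vec x, M.vec t⁆ ⁅M.vec y, M.vec z⁆ =
    B (M.vec x) ⁅M.vec t, ⁅M.vec y, M.vec z⁆⁆
  ad_inv : ∀ X Y Z : GroupLieAlgebra 𝓘(ℝ, E) G, B ⁅Z, X⁆ Y + B X ⁅Z, Y⁆ = 0
  Ad_inv : ∀ (k : K) (X Y), B (Ad E (k : G) X) (Ad E (k : G) Y) = B X Y

variable [FiniteDimensional ℝ V]

/-- A lift `K → Mp^c(V, Ω, j)` of the isotropy representation, as a homomorphism of Lie groups.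
The smooth structure of `Mp^c` is given by the parameters `(g, λ)`. -/
structure Lift where
  /-- the homomorphism `K → Mp^c(V, Ω, j)` -/
  hom : K →* S.Mpc
  σ_hom : ∀ k v, FockModel.Mpc.σ S (hom k) v = M.τ k v
  smooth_σ : ∀ v, ContMDiff 𝓘(ℝ, EK) 𝓘(ℝ, V) ∞ fun k => FockModel.Mpc.σ S (hom k) v
  smooth_lam : ContMDiff 𝓘(ℝ, EK) 𝓘(ℝ, ℂ) ∞ fun k => FockModel.Mpc.lam S (hom k)

variable {M}

/-- The element `χ(k) τ̃(k)` of `Mp^c`, for a character `χ` of `K`. -/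
def Lift.twist (T : M.Lift) (χ : K →* Circle) (k : K) : S.Mpc :=
  FockModel.Mpc.ofCircle S (χ k) * T.hom k

/-- The character `χ'(k) = η(χ(k) τ̃(k))`, which defines the canonical line bundle. -/
def Lift.canChar (T : M.Lift) (χ : K →* Circle) (k : K) : ℂ := FockModel.Mpc.η S (T.twist χ k)

/-- The differential `χ'_*` of `χ'` at the identity. -/
def Lift.canCharLie (T : M.Lift) (χ : K →* Circle) (W : GroupLieAlgebra 𝓘(ℝ, EK) K) : ℂ :=
  mfderiv 𝓘(ℝ, EK) 𝓘(ℝ, ℂ) (T.canChar χ) 1 W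

/-- The spinor fields, as equivariant functions `φ : G → H^∞`:
`φ(g k) = U(χ(k⁻¹) τ̃(k⁻¹)) φ(g)`. -/
def Lift.IsSpinorField (T : M.Lift) (χ : K →* Circle) (φ : SmoothFun E G S) : Prop :=
  ∀ (g : G) (k : K), (φ.1 (g * k) : S.Fock) = FockModel.Mpc.U S (T.twist χ k⁻¹) (φ.1 g : S.Fock)

variable (M)

/-- The `A`-twisted Dirac operator `D_A φ = ∑ₐ cl(A eₐ) ∇_{eᵃ} φ` of the symmetric connection, where
`Ω(eₐ, eᵇ) = δₐᵇ`. The horizontal subspaces of the symmetric connection of `G → G/K` are the left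
translates of `𝔭`, so that the covariant derivative at `g` in the direction of `X ∈ 𝔭` is the
derivative along the left-invariant vector field defined by `X`. -/
def twistedDirac {ι : Type*} [Fintype ι] [DecidableEq ι] (A : V →ₗ[ℝ] V) (e : Module.Basis ι ℝ V) :
    Module.End ℂ (SmoothFun E G S) :=
  ∑ a, clFun S (A (e a)) * leftDeriv S (M.vec (S.dualBasis e a))

/-- The Dirac operator `D φ = ∑ₐ cl(eₐ) ∇_{eᵃ} φ` of the symmetric connection. -/
def dirac {ι : Type*} [Fintype ι] [DecidableEq ι] (e : Module.Basis ι ℝ V) :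
    Module.End ℂ (SmoothFun E G S) :=
  M.twistedDirac LinearMap.id e

/-- The operator `cl(ν(ad(W)|_𝔭))` on `H^∞`, for `W ∈ 𝔨`. -/
def clNuAd (W : GroupLieAlgebra 𝓘(ℝ, EK) K) : Module.End ℂ S.Smooth := S.clAlg (S.nu (M.adp W))

end SymplecticSymmetricSpace

/-- The components `B^{rs}` of the inverse of the matrix `B(b_r, b_s)`. -/
def invGram {L ι : Type*} [AddCommGroup L] [Module ℝ L] [Fintype ι] [DecidableEq ι]
    (B : LinearMap.BilinForm ℝ L) (b : ι → L) : Matrix ι ι ℝ :=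
  (Matrix.of fun r s => B (b r) (b s))⁻¹

/-- The image `∑ B^{rs} f(b_r) f(b_s)` of the Casimir element `∑ B^{rs} b_r b_s` of a Lie algebra
with basis `(b_r)` and invariant form `B`, under a linear map `f` from the Lie algebra to an
associative algebra. -/
def casimirImage {L ι R : Type*} [AddCommGroup L] [Module ℝ L] [Fintype ι] [DecidableEq ι]
    [Ring R] [Algebra ℂ R] (B : LinearMap.BilinForm ℝ L) (b : ι → L) (f : L → R) : R :=
  ∑ r, ∑ s, (invGram B b r s : ℂ) • (f (b r) * f (b s))

end SymmetricSpaces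

end MpcDirac

open MpcDirac

/-! Clifford multiplication acts pointwise and commutes with left-invariant derivatives
(`clFun_mul_leftDeriv`). Hence only two things contribute to the commutator of `D` and `D_A`
(`clifford_sum_commutator`): the relation `cl v cl w - cl w cl v = (i/ħ) Ω(v, w)`, and the brackets
of elements of 𝔭. The first gives `i/ħ` times the sum of the second derivatives along the pairs `A
eₐ`, `eᵃ`. These pairs are dual for `B` on 𝔭, so the sum is the Casimir operator of 𝔤 minus that of
𝔨 (`casimir_g`). The brackets lie in 𝔨; when they are expanded there by means of the extended form,
the Clifford coefficients reassemble to `ν(ad W)` (`sum_clifford_lieP`). The outcome,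
`dirac_commutator`, is an operator identity on all smooth functions.

Spinor fields enter through the differentiated equivariance `W̃ φ = -(N(W) + χ'_*(W)/2) φ`
(`Lift.leftDeriv_incl`). Inserting it into the two 𝔨-terms produces the coefficients 3, 1/4 and 2,
and completing a square gives the second form of the result.

The extended form is forced by `𝔨 = [𝔭, 𝔭]`. It exists because the tensor `B(x, [[y, z], t])` has
the symmetries of a curvature tensor, in particular the exchange of pairs (`exists_curvature_form`).
It is non-degenerate on 𝔨 because 𝔨 acts faithfully on 𝔭.

The analytic core is `Lift.leftDeriv_incl`. The unitary operator of an element of `Mp^c` is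
accessible only through `(g, λ)`, but its value on the vacuum is an explicit Gaussian in these
parameters (`Mpc.U_vac_linPart`). Evaluation at a point is a scalar product with a translated
vacuum, so equivariance becomes a scalar product of this Gaussian curve with a differentiable curve.
The Gaussian curve is differentiated weakly: its difference quotients converge pointwise and are
bounded in norm, which suffices by density of the coherent states (`tendsto_inner_of_bounded`). Its
derivative is a constant plus a quadratic function, and the scalar product with the quadratic part
is `-ν(ξ) - tr_ℂ(ξ)/2` evaluated at 0 (`exists_quadratic`). Since `η = λ² det`, the trace and the
derivative of `λ` combine to `χ'_*/2`. -/

namespace MpcDirac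
-- Calculus on manifolds: curves, mixed derivatives, brackets of vector fields.
noncomputable section LieCalculus
open VectorField Filter Topology

variable {E F : Type*} [NormedAddCommGroup E] [NormedSpace ℝ E] [NormedAddCommGroup F]
  [NormedSpace ℝ F] {M : Type*} [TopologicalSpace M] [ChartedSpace E M]

variable {E₂ E₃ : Type*} [NormedAddCommGroup E₂] [NormedSpace ℝ E₂] [NormedAddCommGroup E₃]
  [NormedSpace ℝ E₃] {M₂ M₃ : Type*} [TopologicalSpace M₂] [ChartedSpace E₂ M₂]
  [TopologicalSpace M₃] [ChartedSpace E₃ M₃]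

variable (E E₂) in
/-- The differential of a map between boundaryless manifolds, as a linear map of the model spaces. -/
def dM (f : M → M₂) (x : M) : E →L[ℝ] E₂ := mfderiv 𝓘(ℝ, E) 𝓘(ℝ, E₂) f x

theorem dM_comp {f : M → M₂} {g : M₂ → M₃} (x : M)
    (hg : MDifferentiableAt 𝓘(ℝ, E₂) 𝓘(ℝ, E₃) g (f x))
    (hf : MDifferentiableAt 𝓘(ℝ, E) 𝓘(ℝ, E₂) f x) (v : E) :
    dM E E₃ (g ∘ f) x v = dM E₂ E₃ g (f x) (dM E E₂ f x v) :=
  congrArg (fun A : E →L[ℝ] E₃ => A v) (mfderiv_comp x hg hf)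

theorem dM_fderiv (f : E → F) (x : E) : dM E F f x = fderiv ℝ f x := mfderiv_eq_fderiv

theorem hasDerivAt_comp_curve {f : M → F} {c : ℝ → M} {t : ℝ}
    (hf : MDifferentiableAt 𝓘(ℝ, E) 𝓘(ℝ, F) f (c t))
    (hc : MDifferentiableAt 𝓘(ℝ, ℝ) 𝓘(ℝ, E) c t) :
    HasDerivAt (fun t => f (c t)) (dM E F f (c t) (dM ℝ E c t 1)) t := by
  have h : DifferentiableAt ℝ (f ∘ c) t := (hf.comp t hc).differentiableAt
  have h1 := h.hasDerivAt
  rw [← fderiv_apply_one_eq_deriv, ← dM_fderiv, dM_comp t hf hc] at h1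
  exact h1

/-- A straight line in the chart at `x`. Smoothness is claimed only at 0, since the line may leave
the target of the chart. -/
theorem exists_curve [IsManifold 𝓘(ℝ, E) ∞ M] (x : M) (X : E) : ∃ c : ℝ → M, c 0 = x ∧
    ContMDiffAt 𝓘(ℝ, ℝ) 𝓘(ℝ, E) ∞ c 0 ∧ dM ℝ E c 0 1 = X := by
  haveI : IsManifold 𝓘(ℝ, E) 1 M := IsManifold.of_le (n := ∞) (by simp)
  set φ := extChartAt 𝓘(ℝ, E) x
  set l : ℝ → E := fun t => φ x + t • X with hl
  have hl0 : l 0 = φ x := by simp [hl]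
  have hls : ContDiff ℝ ∞ l := contDiff_const.add (contDiff_id.smul contDiff_const)
  have hsm : ContMDiffAt 𝓘(ℝ, E) 𝓘(ℝ, E) ∞ φ.symm (l 0) := by
    rw [hl0]
    have := contMDiffWithinAt_extChartAt_symm_range (I := 𝓘(ℝ, E)) (n := ∞) x
      (mem_extChartAt_target x)
    rwa [modelWithCornersSelf_coe, Set.range_id, contMDiffWithinAt_univ] at this
  have hc0 : φ.symm (l 0) = x := by rw [hl0]; exact extChartAt_to_inv x
  have hc : ContMDiffAt 𝓘(ℝ, ℝ) 𝓘(ℝ, E) ∞ (φ.symm ∘ l) 0 := hsm.comp 0 hls.contMDiff.contMDiffAt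
  refine ⟨φ.symm ∘ l, hc0, hc, ?_⟩
  have h1 : MDifferentiableAt 𝓘(ℝ, E) 𝓘(ℝ, E) φ x := mdifferentiableAt_extChartAt (mem_chart_source E x)
  have h1' : MDifferentiableAt 𝓘(ℝ, E) 𝓘(ℝ, E) φ ((φ.symm ∘ l) 0) := by
    rw [Function.comp_apply, hc0]; exact h1
  have h2 := hasDerivAt_comp_curve h1' (hc.mdifferentiableAt (by simp))
  have h3 : HasDerivAt l X 0 := by
    simpa [hl] using ((hasDerivAt_id (0 : ℝ)).smul_const X).const_add (φ x)
  have h4 : (fun t => φ ((φ.symm ∘ l) t)) =ᶠ[𝓝 0] l := by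
    have : ∀ᶠ t in 𝓝 (0 : ℝ), l t ∈ φ.target := by
      refine hls.continuous.continuousAt.eventually_mem ?_
      rw [hl0]
      exact (isOpen_extChartAt_target x).mem_nhds (mem_extChartAt_target x)
    filter_upwards [this] with t ht
    exact φ.right_inv ht
  have h5 := (h3.congr_of_eventuallyEq h4).unique h2
  have h6 : dM E E φ ((φ.symm ∘ l) 0) = ContinuousLinearMap.id ℝ E := by
    rw [Function.comp_apply, hc0]
    exact mfderiv_extChartAt_self
  rw [h6] at h5
  exact h5.symm

/-- Interchange of the order of the derivatives of a function of two real variables. -/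
theorem hasDerivAt_deriv_swap {Ψ : ℝ × ℝ → F} (hΨ : ContDiffAt ℝ 2 Ψ (0, 0)) {u w : ℝ → F} {w' : F}
    (hu : ∀ᶠ t in 𝓝 0, HasDerivAt (fun s => Ψ (s, t)) (u t) 0)
    (hw : ∀ᶠ s in 𝓝 0, HasDerivAt (fun t => Ψ (s, t)) (w s) 0) (h : HasDerivAt w w' 0) :
    HasDerivAt u w' 0 := by
  have hd : ∀ᶠ p in 𝓝 ((0 : ℝ), (0 : ℝ)), DifferentiableAt ℝ Ψ p := by
    filter_upwards [hΨ.eventually (by simp)] with p hp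
    exact hp.differentiableAt (by simp)
  have hD : HasFDerivAt (fderiv ℝ Ψ) (fderiv ℝ (fderiv ℝ Ψ) (0, 0)) (0, 0) :=
    ((hΨ.fderiv_right (m := 1) (by norm_num)).differentiableAt (by norm_num)).hasFDerivAt
  have hl1 : HasDerivAt (fun t : ℝ => ((0 : ℝ), t)) (0, 1) 0 :=
    (hasDerivAt_const _ _).prodMk (hasDerivAt_id _)
  have hl2 : HasDerivAt (fun s : ℝ => (s, (0 : ℝ))) (1, 0) 0 :=
    (hasDerivAt_id _).prodMk (hasDerivAt_const _ _)
  have hu' : u =ᶠ[𝓝 0] fun t => fderiv ℝ Ψ (0, t) (1, 0) := by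
    filter_upwards [hu, hl1.continuousAt.eventually hd] with t ht htd
    have h2 : HasDerivAt (fun s : ℝ => (s, t)) (1, 0) 0 :=
      (hasDerivAt_id _).prodMk (hasDerivAt_const _ _)
    exact ht.unique (htd.hasFDerivAt.comp_hasDerivAt (0 : ℝ) h2)
  have hw' : w =ᶠ[𝓝 0] fun s => fderiv ℝ Ψ (s, 0) (0, 1) := by
    filter_upwards [hw, hl2.continuousAt.eventually hd] with s hs hsd
    have h2 : HasDerivAt (fun t : ℝ => (s, t)) (0, 1) 0 :=
      (hasDerivAt_const _ _).prodMk (hasDerivAt_id _)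
    exact hs.unique (hsd.hasFDerivAt.comp_hasDerivAt (0 : ℝ) h2)
  have h1 : HasDerivAt (fun t => fderiv ℝ Ψ (0, t) (1, 0))
      (fderiv ℝ (fderiv ℝ Ψ) (0, 0) (0, 1) (1, 0)) 0 := by
    have := (HasFDerivAt.comp_hasDerivAt (f := fun t : ℝ => ((0 : ℝ), t)) (0 : ℝ) hD hl1).clm_apply (hasDerivAt_const (0 : ℝ) ((1 : ℝ), (0 : ℝ)))
    simpa using this
  have h2 : HasDerivAt (fun s => fderiv ℝ Ψ (s, 0) (0, 1))
      (fderiv ℝ (fderiv ℝ Ψ) (0, 0) (1, 0) (0, 1)) 0 := by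
    have := (HasFDerivAt.comp_hasDerivAt (f := fun s : ℝ => (s, (0 : ℝ))) (0 : ℝ) hD hl2).clm_apply (hasDerivAt_const (0 : ℝ) ((0 : ℝ), (1 : ℝ)))
    simpa using this
  have h3 := (h.congr_of_eventuallyEq hw'.symm).unique h2
  rw [h3, (hΨ.isSymmSndFDerivAt (by simp)) (1, 0) (0, 1)]
  exact h1.congr_of_eventuallyEq hu'

theorem mfderiv_eq_fderiv_chart [IsManifold 𝓘(ℝ, E) 1 M] {f : M → F} (x : M) {y : M}
    (hy : y ∈ (chartAt E x).source) (hf : MDifferentiableAt 𝓘(ℝ, E) 𝓘(ℝ, F) f y) :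
    DifferentiableAt ℝ (f ∘ (extChartAt 𝓘(ℝ, E) x).symm) (extChartAt 𝓘(ℝ, E) x y) ∧
    ∀ v : E, dM E F f y v =
      fderiv ℝ (f ∘ (extChartAt 𝓘(ℝ, E) x).symm) (extChartAt 𝓘(ℝ, E) x y)
        (dM E E (extChartAt 𝓘(ℝ, E) x) y v) := by
  set φ := extChartAt 𝓘(ℝ, E) x
  have hy' : y ∈ φ.source := by simpa [φ] using hy
  have e0 : φ.symm (φ y) = y := φ.left_inv hy'
  have h1 : MDifferentiableAt 𝓘(ℝ, E) 𝓘(ℝ, E) φ.symm (φ y) :=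
    (mdifferentiableWithinAt_extChartAt_symm (φ.map_source hy')).mdifferentiableAt (by simp)
  have h2 : MDifferentiableAt 𝓘(ℝ, E) 𝓘(ℝ, F) f (φ.symm (φ y)) := by rwa [e0]
  have h3 : MDifferentiableAt 𝓘(ℝ, E) 𝓘(ℝ, F) (f ∘ φ.symm) (φ y) := h2.comp _ h1
  have h4 : DifferentiableAt ℝ (f ∘ φ.symm) (φ y) := h3.differentiableAt
  refine ⟨h4, fun v => ?_⟩
  have h5 : MDifferentiableAt 𝓘(ℝ, E) 𝓘(ℝ, E) φ y := mdifferentiableAt_extChartAt hy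
  have h6 := mfderiv_comp y h3 h5
  have h7 : (f ∘ φ.symm) ∘ φ =ᶠ[𝓝 y] f := by
    filter_upwards [extChartAt_source_mem_nhds' (I := 𝓘(ℝ, E)) hy'] with z hz
    exact congrArg f (φ.left_inv hz)
  rw [mfderiv_eq_fderiv] at h6
  have h8 := h7.mfderiv_eq (I := 𝓘(ℝ, E)) (I' := 𝓘(ℝ, F))
  have h9 := congrArg (fun A : E →L[ℝ] F => A v) h6
  have h10 := congrArg (fun A : E →L[ℝ] F => A v) h8
  exact h10.symm.trans h9

/-- A bracket of vector fields acts on functions as the commutator of the derivations. In the chart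
both sides are expanded by the product rule, and the terms with the second derivative of `f` cancel
by its symmetry. -/
theorem mfderiv_mlieBracket [CompleteSpace E] [IsManifold 𝓘(ℝ, E) 2 M] {f : M → F} {x : M}
    (hf : ContMDiffAt 𝓘(ℝ, E) 𝓘(ℝ, F) 2 f x) {X Y : M → E}
    (hX : MDifferentiableAt 𝓘(ℝ, E) 𝓘(ℝ, E).tangent
      (fun y => (⟨y, X y⟩ : TangentBundle 𝓘(ℝ, E) M)) x)
    (hY : MDifferentiableAt 𝓘(ℝ, E) 𝓘(ℝ, E).tangent
      (fun y => (⟨y, Y y⟩ : TangentBundle 𝓘(ℝ, E) M)) x) :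
    MDifferentiableAt 𝓘(ℝ, E) 𝓘(ℝ, F) (fun y => dM E F f y (X y)) x ∧
    dM E F f x
      (mlieBracket 𝓘(ℝ, E) (M := M) X Y x) =
    dM E F (fun y => dM E F f y (Y y)) x (X x) -
    dM E F (fun y => dM E F f y (X y)) x (Y x) := by
  haveI : IsManifold 𝓘(ℝ, E) 1 M := IsManifold.of_le (n := 2) (by norm_num)
  set φ := extChartAt 𝓘(ℝ, E) x with hφ
  set g : E → F := f ∘ φ.symm with hg
  set Xh : E → E := mpullbackWithin 𝓘(ℝ, E) 𝓘(ℝ, E) φ.symm X (Set.range 𝓘(ℝ, E)) with hXh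
  set Yh : E → E := mpullbackWithin 𝓘(ℝ, E) 𝓘(ℝ, E) φ.symm Y (Set.range 𝓘(ℝ, E)) with hYh
  have hxs : x ∈ (chartAt E x).source := mem_chart_source E x
  have hgd : ContDiffAt ℝ 2 g (φ x) := by
    have h1 : ContDiffWithinAt ℝ 2 (f ∘ φ.symm) (Set.range 𝓘(ℝ, E)) (φ x) :=
      (contMDiffAt_iff.1 hf).2
    rwa [modelWithCornersSelf_coe, Set.range_id, contDiffWithinAt_univ] at h1
  have hhat : ∀ Z : M → E, ∀ y ∈ (chartAt E x).source,
      dM E E φ y (Z y) =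
        (mpullbackWithin 𝓘(ℝ, E) 𝓘(ℝ, E) φ.symm Z (Set.range 𝓘(ℝ, E)) (φ y)) := by
    intro Z y hy
    have hy' : y ∈ φ.source := by simpa [φ] using hy
    have h1 := ContinuousLinearMap.inverse_eq
      (mfderivWithin_extChartAt_symm_comp_mfderiv_extChartAt (φ.map_source hy'))
      (mfderiv_extChartAt_comp_mfderivWithin_extChartAt_symm (φ.map_source hy'))
    have h2 := congrArg (fun A : E →L[ℝ] E => A (Z (φ.symm (φ y)))) h1
    have h3 := congrArg (fun y' => dM E E φ y' (Z y')) (φ.left_inv hy')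
    exact h3.symm.trans h2.symm
  have hdiff : ∀ Z : M → E, MDifferentiableAt 𝓘(ℝ, E) 𝓘(ℝ, E).tangent
      (fun y => (⟨y, Z y⟩ : TangentBundle 𝓘(ℝ, E) M)) x → DifferentiableAt ℝ
        (mpullbackWithin 𝓘(ℝ, E) 𝓘(ℝ, E) φ.symm Z (Set.range 𝓘(ℝ, E)) : E → E) (φ x) := by
    intro Z hZ
    have := MDifferentiableWithinAt.differentiableWithinAt_mpullbackWithin_vectorField
      (mdifferentiableWithinAt_univ.2 hZ)
    rw [modelWithCornersSelf_coe, Set.range_id, Set.preimage_univ, Set.univ_inter] at this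
    rw [modelWithCornersSelf_coe, Set.range_id]
    exact (differentiableWithinAt_univ (f := (mpullbackWithin 𝓘(ℝ, E) 𝓘(ℝ, E) φ.symm Z Set.univ : E → E))).1 this
  have hXd := hdiff X hX
  have hYd := hdiff Y hY
  have hev : ∀ Z : M → E, (fun y => dM E F f y (Z y)) =ᶠ[𝓝 x] fun y => fderiv ℝ g (φ y)
        (mpullbackWithin 𝓘(ℝ, E) 𝓘(ℝ, E) φ.symm Z (Set.range 𝓘(ℝ, E)) (φ y)) := by
    intro Z
    have h1 := (contMDiffAt_iff_contMDiffAt_nhds (by simp)).1 hf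
    filter_upwards [h1, (chartAt E x).open_source.mem_nhds hxs] with y hy hys
    rw [(mfderiv_eq_fderiv_chart x hys (hy.mdifferentiableAt (by simp))).2, ← hhat Z y hys]
  have hφd : MDifferentiableAt 𝓘(ℝ, E) 𝓘(ℝ, E) φ x := mdifferentiableAt_extChartAt hxs
  have hg1 : DifferentiableAt ℝ (fderiv ℝ g) (φ x) :=
    (hgd.fderiv_right (m := 1) (by norm_num)).differentiableAt (by norm_num)
  have hder : ∀ Z : M → E, DifferentiableAt ℝ
      (mpullbackWithin 𝓘(ℝ, E) 𝓘(ℝ, E) φ.symm Z (Set.range 𝓘(ℝ, E)) : E → E) (φ x) →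
      ∀ v : E, dM E F (fun y => dM E F f y (Z y)) x v = fderiv ℝ (fun a => fderiv ℝ g a
        (mpullbackWithin 𝓘(ℝ, E) 𝓘(ℝ, E) φ.symm Z (Set.range 𝓘(ℝ, E)) a)) (φ x)
        (dM E E φ x v) := by
    intro Z hZ v
    have h1 := (hev Z).mfderiv_eq (I := 𝓘(ℝ, E)) (I' := 𝓘(ℝ, F))
    have h2 : DifferentiableAt ℝ (fun a => fderiv ℝ g a
        (mpullbackWithin 𝓘(ℝ, E) 𝓘(ℝ, E) φ.symm Z (Set.range 𝓘(ℝ, E)) a)) (φ x) :=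
      hg1.clm_apply hZ
    have h3 := mfderiv_comp x h2.mdifferentiableAt hφd
    rw [mfderiv_eq_fderiv] at h3
    exact (congrArg (fun A : E →L[ℝ] F => A v) h1).trans
      (congrArg (fun A : E →L[ℝ] F => A v) h3)
  refine ⟨((hg1.clm_apply hXd).mdifferentiableAt.comp x hφd).congr_of_eventuallyEq (hev X), ?_⟩
  rw [hder X hXd, hder Y hYd]
  refine ((mfderiv_eq_fderiv_chart x hxs (hf.mdifferentiableAt (by simp))).2 _).trans ?_
  have hbr : dM E E φ x
      (mlieBracket 𝓘(ℝ, E) (M := M) X Y x) = lieBracket ℝ Xh Yh (φ x) := by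
    have h1 : (mlieBracket 𝓘(ℝ, E) (M := M) X Y x) =
        (dM E E φ x).inverse
          (lieBracketWithin ℝ Xh Yh (φ.symm ⁻¹' Set.univ ∩ Set.range 𝓘(ℝ, E)) (φ x)) := rfl
    rw [h1, modelWithCornersSelf_coe, Set.range_id, Set.preimage_univ, Set.univ_inter,
      lieBracketWithin_univ]
    exact (isInvertible_mfderiv_extChartAt (mem_extChartAt_source x)).self_apply_inverse _
  refine (congrArg (fderiv ℝ g (φ x)) hbr).trans ?_
  rw [hhat X x hxs, hhat Y x hxs, fderiv_clm_apply hg1 hXd, fderiv_clm_apply hg1 hYd]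
  have hsymm : fderiv ℝ (fderiv ℝ g) (φ x) (Xh (φ x)) (Yh (φ x)) =
      fderiv ℝ (fderiv ℝ g) (φ x) (Yh (φ x)) (Xh (φ x)) :=
    (hgd.isSymmSndFDerivAt (by simp)) _ _
  simp only [lieBracket, map_sub]
  change _ = _ + fderiv ℝ (fderiv ℝ g) (φ x) (Xh (φ x)) (Yh (φ x)) -
    (_ + fderiv ℝ (fderiv ℝ g) (φ x) (Yh (φ x)) (Xh (φ x)))
  rw [hsymm]
  abel

end LieCalculus
end MpcDirac

/-! ### Left-invariant derivatives and the differential of the adjoint action. -/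

namespace MpcDirac
noncomputable section LieCalculusGroup
open VectorField Filter Topology

variable {E F : Type*} [NormedAddCommGroup E] [NormedSpace ℝ E] [NormedAddCommGroup F]
  [NormedSpace ℝ F] {G : Type*} [TopologicalSpace G] [ChartedSpace E G] [Group G]
  [LieGroup 𝓘(ℝ, E) ∞ G]

variable (E G) in
theorem isManifold_infty : IsManifold 𝓘(ℝ, E) ∞ G :=
  (inferInstance : LieGroup 𝓘(ℝ, E) ∞ G).toContMDiffMul.toIsManifold

theorem mdifferentiable_mul_left (g : G) : MDifferentiable 𝓘(ℝ, E) 𝓘(ℝ, E) fun h : G => g * h :=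
  (contMDiff_mul_left (I := 𝓘(ℝ, E)) (n := ∞)).mdifferentiable (by simp)

theorem mdifferentiable_mul_right (g : G) : MDifferentiable 𝓘(ℝ, E) 𝓘(ℝ, E) fun h : G => h * g :=
  (contMDiff_mul_right (I := 𝓘(ℝ, E)) (n := ∞)).mdifferentiable (by simp)

theorem dM_mulInvariantVectorField {f : G → F} (g : G)
    (hf : MDifferentiableAt 𝓘(ℝ, E) 𝓘(ℝ, F) f g) (X : GroupLieAlgebra 𝓘(ℝ, E) G) :
    dM E F f g (mulInvariantVectorField X g) = dM E F (fun h => f (g * h)) 1 X := by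
  have h1 : MDifferentiableAt 𝓘(ℝ, E) 𝓘(ℝ, F) f (g * 1) := by rwa [mul_one]
  refine Eq.trans ?_ (dM_comp (1 : G) h1 (mdifferentiable_mul_left g 1) X).symm
  rw [mul_one]
  rfl

/-- The differentiability of the first derivative is part of the conclusion because
`lie_eq_of_hasDerivAt_Ad` differentiates such functions once more. -/
theorem dM_mulInvariantVectorField_lie [CompleteSpace E] {f : G → F} {g : G}
    (hf : ContMDiffAt 𝓘(ℝ, E) 𝓘(ℝ, F) 2 f g) (X Y : GroupLieAlgebra 𝓘(ℝ, E) G) :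
    MDifferentiableAt 𝓘(ℝ, E) 𝓘(ℝ, F)
      (fun y => dM E F f y (mulInvariantVectorField X y)) g ∧
    dM E F f g (mulInvariantVectorField ⁅X, Y⁆ g) =
      dM E F (fun y => dM E F f y (mulInvariantVectorField Y y)) g (mulInvariantVectorField X g) -
      dM E F (fun y => dM E F f y (mulInvariantVectorField X y)) g
        (mulInvariantVectorField Y g) := by
  haveI : IsManifold 𝓘(ℝ, E) ∞ G := isManifold_infty E G
  haveI : IsManifold 𝓘(ℝ, E) 2 G := IsManifold.of_le (n := ∞) (by simpa using ENat.LEInfty.out)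
  have h := mfderiv_mlieBracket (X := mulInvariantVectorField X) (Y := mulInvariantVectorField Y)
    hf (mdifferentiableAt_mulInvariantVectorField X) (mdifferentiableAt_mulInvariantVectorField Y)
  refine ⟨h.1, Eq.trans ?_ h.2⟩
  exact congrArg (dM E F f g) (congrFun (mulInvariantVector_mlieBracket X Y) g)

theorem mulInvariantVectorField_one (X : GroupLieAlgebra 𝓘(ℝ, E) G) :
    mulInvariantVectorField X (1 : G) = X := by
  have h : (fun h : G => 1 * h) = id := funext one_mul
  have h1 : dM E E (fun h : G => 1 * h) 1 X = X := by
    rw [h]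
    exact congrArg (fun A : E →L[ℝ] E => A X) mfderiv_id
  exact h1

theorem dM_sum_smul {ι : Type*} [Fintype ι] (f : G → F) (g : G) (a : ι → ℝ) (Y : ι → E) :
    dM E F f g (∑ i, a i • Y i) = ∑ i, a i • dM E F f g (Y i) := by
  simp

/-- The derivative of the adjoint representation is the Lie bracket. -/
theorem lie_eq_of_hasDerivAt_Ad [CompleteSpace E] {ι : Type*} [Fintype ι] {κ : ℝ → G}
    (hκ0 : κ 0 = 1) (hκ : ContMDiffAt 𝓘(ℝ, ℝ) 𝓘(ℝ, E) ∞ κ 0) {W : GroupLieAlgebra 𝓘(ℝ, E) G}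
    (hW : dM ℝ E κ 0 1 = W) (X : GroupLieAlgebra 𝓘(ℝ, E) G) (Y : ι → GroupLieAlgebra 𝓘(ℝ, E) G)
    (a : ι → ℝ → ℝ) (a' : ι → ℝ) (ha : ∀ i, HasDerivAt (a i) (a' i) 0)
    (hAd : ∀ t, Ad E (κ t) X = ∑ i, a i t • Y i) : ⁅W, X⁆ = ∑ i, a' i • Y i := by
  haveI : IsManifold 𝓘(ℝ, E) ∞ G := isManifold_infty E G
  haveI : IsManifold 𝓘(ℝ, E) 1 G := isManifold_one
  set ψ : G → E := ⇑(extChartAt 𝓘(ℝ, E) (1 : G))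
  have hψ : ∀ᶠ g in 𝓝 (1 : G), ContMDiffAt 𝓘(ℝ, E) 𝓘(ℝ, E) ∞ ψ g := by
    filter_upwards [(chartAt E (1 : G)).open_source.mem_nhds (mem_chart_source E 1)] with g hg
    exact contMDiffAt_extChartAt' hg
  have hψ1 : ContMDiffAt 𝓘(ℝ, E) 𝓘(ℝ, E) ∞ ψ 1 := hψ.self_of_nhds
  have hψ2 : ContMDiffAt 𝓘(ℝ, E) 𝓘(ℝ, E) 2 ψ 1 :=
    hψ1.of_le (by simpa using ENat.LEInfty.out)
  have hκt : ∀ᶠ t in 𝓝 (0 : ℝ), MDifferentiableAt 𝓘(ℝ, E) 𝓘(ℝ, E) ψ (κ t) := by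
    have h1 : Tendsto κ (𝓝 0) (𝓝 1) := by
      have := hκ.continuousAt.tendsto
      rwa [hκ0] at this
    filter_upwards [h1.eventually hψ] with t ht
    exact ht.mdifferentiableAt (by simp)
  have hκd : ∀ᶠ t in 𝓝 (0 : ℝ), MDifferentiableAt 𝓘(ℝ, ℝ) 𝓘(ℝ, E) κ t := by
    have h2 := hκ.of_le (m := 2) (by simpa using ENat.LEInfty.out)
    filter_upwards [(contMDiffAt_iff_contMDiffAt_nhds (by simp)).1 h2] with t ht
    exact ht.mdifferentiableAt (by simp)
  -- Here `D Z t` is the derivative of the chart `ψ` at `κ t` along the right-invariant field of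
  -- `Z`, while `wf` and `xf` are derivatives of `ψ` along left-invariant fields.
  set D : E → ℝ → E := fun Z t => dM E E (fun y : G => ψ (y * κ t)) 1 Z with hD
  set wf : G → E := fun y => dM E E ψ y (mulInvariantVectorField W y) with hwf
  set xf : G → E := fun y => dM E E ψ y (mulInvariantVectorField X y) with hxf
  have hwfd : MDifferentiableAt 𝓘(ℝ, E) 𝓘(ℝ, E) wf 1 := (dM_mulInvariantVectorField_lie hψ2 W X).1
  have hxfd : MDifferentiableAt 𝓘(ℝ, E) 𝓘(ℝ, E) xf 1 := (dM_mulInvariantVectorField_lie hψ2 X W).1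
  -- Left and right translations commute: for a curve `c` with velocity `Z`, both orders of
  -- differentiating `ψ (c s * κ t)` agree, and one of them is the derivative of `wf` along `Z`.
  have hDd : ∀ Z : E, HasDerivAt (D Z) (dM E E wf 1 Z) 0 := by
    intro Z
    obtain ⟨c, hc0, hc, hcZ⟩ := exists_curve (E := E) (1 : G) Z
    have hΨ : ContDiffAt ℝ 2 (fun p : ℝ × ℝ => ψ (c p.1 * κ p.2)) (0, 0) := by
      have h1 : ContMDiffAt 𝓘(ℝ, ℝ × ℝ) 𝓘(ℝ, E) ∞ (fun p : ℝ × ℝ => c p.1) (0, 0) :=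
        ContMDiffAt.comp (0, 0) (g := c) (f := fun p : ℝ × ℝ => p.1) hc contDiff_fst.contMDiff.contMDiffAt
      have h2 : ContMDiffAt 𝓘(ℝ, ℝ × ℝ) 𝓘(ℝ, E) ∞ (fun p : ℝ × ℝ => κ p.2) (0, 0) :=
        ContMDiffAt.comp (0, 0) (g := κ) (f := fun p : ℝ × ℝ => p.2) hκ contDiff_snd.contMDiff.contMDiffAt
      have h3 : ContMDiffAt 𝓘(ℝ, ℝ × ℝ) 𝓘(ℝ, E) ∞ (fun p : ℝ × ℝ => c p.1 * κ p.2) (0, 0) := h1.mul h2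
      have h4 : ContMDiffAt 𝓘(ℝ, E) 𝓘(ℝ, E) ∞ ψ (c (0, 0).1 * κ (0, 0).2) := by
        simpa [hc0, hκ0] using hψ1
      exact ((ContMDiffAt.comp (0, 0) (g := ψ) h4 h3).of_le
        (by simpa using ENat.LEInfty.out)).contDiffAt
    have hcd : ∀ᶠ t in 𝓝 (0 : ℝ), MDifferentiableAt 𝓘(ℝ, ℝ) 𝓘(ℝ, E) c t := by
      have h2 := hc.of_le (m := 2) (by simpa using ENat.LEInfty.out)
      filter_upwards [(contMDiffAt_iff_contMDiffAt_nhds (by simp)).1 h2] with t ht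
      exact ht.mdifferentiableAt (by simp)
    have hcψ : ∀ᶠ s in 𝓝 (0 : ℝ), MDifferentiableAt 𝓘(ℝ, E) 𝓘(ℝ, E) ψ (c s) := by
      have h1 : Tendsto c (𝓝 0) (𝓝 1) := by
        have := hc.continuousAt.tendsto
        rwa [hc0] at this
      filter_upwards [h1.eventually hψ] with t ht
      exact ht.mdifferentiableAt (by simp)
    refine hasDerivAt_deriv_swap hΨ (w := fun s => wf (c s)) ?_ ?_ ?_
    · filter_upwards [hκt] with t ht
      have h1 : MDifferentiableAt 𝓘(ℝ, E) 𝓘(ℝ, E) (fun y : G => ψ (y * κ t)) (c 0) := by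
        have h2 : MDifferentiableAt 𝓘(ℝ, E) 𝓘(ℝ, E) ψ (c 0 * κ t) := by rwa [hc0, one_mul]
        exact h2.comp (c 0) (mdifferentiable_mul_right (κ t) (c 0))
      have h2 := hasDerivAt_comp_curve h1 hcd.self_of_nhds
      rwa [hcZ, hc0] at h2
    · filter_upwards [hcψ] with s hs
      have h1 : MDifferentiableAt 𝓘(ℝ, E) 𝓘(ℝ, E) (fun y : G => ψ (c s * y)) (κ 0) := by
        have h2 : MDifferentiableAt 𝓘(ℝ, E) 𝓘(ℝ, E) ψ (c s * κ 0) := by rwa [hκ0, mul_one]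
        exact h2.comp (κ 0) (mdifferentiable_mul_left (c s) (κ 0))
      have h2 := hasDerivAt_comp_curve h1 hκd.self_of_nhds
      rw [hW, hκ0] at h2
      rw [hwf]
      simp only
      rwa [dM_mulInvariantVectorField _ hs]
    · have h1 : MDifferentiableAt 𝓘(ℝ, E) 𝓘(ℝ, E) wf (c 0) := by rwa [hc0]
      have h2 := hasDerivAt_comp_curve h1 hcd.self_of_nhds
      rwa [hcZ, hc0] at h2
  -- Since `κ h = (κ h κ⁻¹) κ`, a left-invariant derivative at `κ t` is a right-invariant one along
  -- `Ad (κ t) X`. The product rule at `t = 0` then gives `W X ψ = X W ψ + ∑ a' i • Y i ψ`.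
  have hx : (fun t => xf (κ t)) =ᶠ[𝓝 0] fun t => ∑ i, a i t • D (Y i) t := by
    filter_upwards [hκt] with t ht
    have h1 : (fun h : G => ψ (κ t * h)) = (fun y : G => ψ (y * κ t)) ∘ MulAut.conj (κ t) := by
      ext h
      simp
    have h2 : MDifferentiableAt 𝓘(ℝ, E) 𝓘(ℝ, E) (fun y : G => ψ (y * κ t))
        (MulAut.conj (κ t) (1 : G)) := by
      have h2 : MDifferentiableAt 𝓘(ℝ, E) 𝓘(ℝ, E) ψ (MulAut.conj (κ t) (1 : G) * κ t) := by
        rwa [map_one, one_mul]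
      exact h2.comp (MulAut.conj (κ t) (1 : G)) (mdifferentiable_mul_right (κ t) _)
    have h3 := dM_comp (1 : G) h2 ((contMDiff_conj (κ t)).mdifferentiable (by simp) 1) X
    rw [← h1, map_one] at h3
    rw [hxf]
    simp only
    rw [dM_mulInvariantVectorField _ ht, h3]
    exact (congrArg (dM E E (fun y : G => ψ (y * κ t)) 1) (hAd t)).trans (dM_sum_smul _ _ _ _)
  have hder1 : HasDerivAt (fun t => xf (κ t)) (dM E E xf 1 W) 0 := by
    have h1 : MDifferentiableAt 𝓘(ℝ, E) 𝓘(ℝ, E) xf (κ 0) := by rwa [hκ0]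
    have h2 := hasDerivAt_comp_curve h1 hκd.self_of_nhds
    rwa [hW, hκ0] at h2
  have hder2 : HasDerivAt (fun t => ∑ i, a i t • D (Y i) t)
      (∑ i, (a i 0 • dM E E wf 1 (Y i) + a' i • D (Y i) 0)) 0 :=
    HasDerivAt.fun_sum fun i _ => (ha i).smul (hDd (Y i))
  have hX0 : X = ∑ i, a i 0 • Y i := by
    rw [← hAd, hκ0]
    have : (MulAut.conj (1 : G)).toMonoidHom = MonoidHom.id G := by ext; simp
    rw [Ad, this, differential_id]
  have hkey := hder1.unique (hder2.congr_of_eventuallyEq hx)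
  have hD0 : ∀ Z : E, D Z 0 = dM E E ψ 1 Z := by
    intro Z
    simp [hD, hκ0]
  have hl := (dM_mulInvariantVectorField_lie hψ2 W X).2
  simp only [mulInvariantVectorField_one] at hl
  have h5 : dM E E ψ 1 (∑ i, a' i • Y i) = ∑ i, a' i • D (Y i) 0 := by
    exact (dM_sum_smul _ _ _ _).trans (Finset.sum_congr rfl fun i _ => congrArg (a' i • ·) (hD0 (Y i)).symm)
  have h6 : dM E E wf 1 X = ∑ i, a i 0 • dM E E wf 1 (Y i) := by
    exact (congrArg (dM E E wf 1) hX0).trans (dM_sum_smul _ _ _ _)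
  have h7 : dM E E ψ 1 (⁅W, X⁆ : GroupLieAlgebra 𝓘(ℝ, E) G) = dM E E ψ 1 (∑ i, a' i • Y i) := by
    refine hl.trans ?_
    change dM E E xf 1 W - dM E E wf 1 X = _
    rw [hkey, h5, h6, Finset.sum_add_distrib]
    abel
  -- The chart has identity differential at its centre, so the identity between derivatives of `ψ`
  -- is one between tangent vectors.
  have h8 : dM E E ψ 1 = ContinuousLinearMap.id ℝ E := mfderiv_extChartAt_self
  rw [h8] at h7
  exact h7

variable {V : Type*} [NormedAddCommGroup V] [NormedSpace ℝ V] [FiniteDimensional ℝ V]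

theorem leftDeriv_lie [CompleteSpace E] (S : FockModel V) (X Y : GroupLieAlgebra 𝓘(ℝ, E) G) :
    leftDeriv S ⁅X, Y⁆ = leftDeriv S X * leftDeriv S Y - leftDeriv S Y * leftDeriv S X := by
  refine LinearMap.ext fun φ => Subtype.ext (funext fun g => Subtype.ext ?_)
  exact (dM_mulInvariantVectorField_lie (((SmoothFun.contMDiff φ.2) g).of_le
    (by simpa using ENat.LEInfty.out)) X Y).2

theorem leftDeriv_add (S : FockModel V) (X Y : GroupLieAlgebra 𝓘(ℝ, E) G) :
    leftDeriv S (X + Y) = leftDeriv S X + leftDeriv S Y := by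
  refine LinearMap.ext fun φ => Subtype.ext (funext fun g => Subtype.ext ?_)
  change leftDerivFun S (X + Y) φ.1 g = leftDerivFun S X φ.1 g + leftDerivFun S Y φ.1 g
  simp only [leftDerivFun, mulInvariantVectorField_add]
  exact map_add (dM E S.Fock (fun g => (φ.1 g : S.Fock)) g) _ _

theorem leftDeriv_smul (S : FockModel V) (r : ℝ) (X : GroupLieAlgebra 𝓘(ℝ, E) G) :
    leftDeriv S (r • X) = (r : ℂ) • leftDeriv S X := by
  refine LinearMap.ext fun φ => Subtype.ext (funext fun g => Subtype.ext ?_)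
  change leftDerivFun S (r • X) φ.1 g = (r : ℂ) • leftDerivFun S X φ.1 g
  simp only [leftDerivFun, mulInvariantVectorField_smul]
  exact map_smul (dM E S.Fock (fun g => (φ.1 g : S.Fock)) g) _ _

end LieCalculusGroup
end MpcDirac

/-! ### The infinitesimal isotropy representation. -/

namespace MpcDirac
noncomputable section Infinitesimal
open VectorField Filter Topology

variable {E EK V : Type*} [NormedAddCommGroup E] [NormedSpace ℝ E] [NormedAddCommGroup EK]
  [NormedSpace ℝ EK] [NormedAddCommGroup V] [NormedSpace ℝ V] [FiniteDimensional ℝ V]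
  {G : Type*} [TopologicalSpace G] [ChartedSpace E G] [Group G] [LieGroup 𝓘(ℝ, E) ∞ G]
  {S : FockModel V} {K : Subgroup G} [ChartedSpace EK K] [LieGroup 𝓘(ℝ, EK) ∞ K] [CompleteSpace E]

namespace SymplecticSymmetricSpace

variable (M : SymplecticSymmetricSpace E EK S K)

theorem vec_injective : Function.Injective M.vec :=
  fun _ _ h => M.θ.injective (Subtype.ext h)

/-- The inclusion `V = 𝔭 → 𝔤` as a linear map. -/
def vecL : V →ₗ[ℝ] GroupLieAlgebra 𝓘(ℝ, E) G := M.p.subtype ∘ₗ M.θ.toLinearMap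

theorem vec_eq_sum {ι : Type*} [Fintype ι] (b : Module.Basis ι ℝ V) (v : V) :
    M.vec v = ∑ i, b.coord i v • M.vec (b i) := by
  have h : M.vecL (∑ i, b.repr v i • b i) = ∑ i, b.repr v i • M.vecL (b i) := by
    simp only [map_sum, map_smul]
  rw [b.sum_repr] at h
  exact h

/-- Differentiability of `τ` along the curve comes from the smoothness of the lift. The derivative
is then identified with the bracket by expanding `Ad (c t)` in a basis of `V` and applying
`lie_eq_of_hasDerivAt_Ad`. -/
theorem hasDerivAt_curve_τ (T : M.Lift) {c : ℝ → K} (hc0 : c 0 = 1)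
    (hc : ContMDiffAt 𝓘(ℝ, ℝ) 𝓘(ℝ, EK) ∞ c 0) {W : GroupLieAlgebra 𝓘(ℝ, EK) K}
    (hW : dM ℝ EK c 0 1 = W) (v : V) : HasDerivAt (fun t => M.τ (c t) v) (M.adp W v) 0 := by
  have hd : MDifferentiableAt 𝓘(ℝ, EK) 𝓘(ℝ, V) (fun k => M.τ k v) (c 0) := by
    have h := (T.smooth_σ v).mdifferentiable (by simp) (c 0)
    simpa only [T.σ_hom] using h
  have h1 := hasDerivAt_comp_curve hd (hc.mdifferentiableAt (by simp))
  set v' := dM EK V (fun k => M.τ k v) (c 0) (dM ℝ EK c 0 1)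
  set b := Module.finBasis ℝ V
  have ha : ∀ i, HasDerivAt (fun t => b.coord i (M.τ (c t) v)) (b.coord i v') 0 := fun i =>
    ((LinearMap.toContinuousLinearMap (b.coord i)).hasFDerivAt.comp_hasDerivAt (0 : ℝ) h1)
  have hκ : ContMDiffAt 𝓘(ℝ, ℝ) 𝓘(ℝ, E) ∞ (fun t => (c t : G)) 0 :=
    ContMDiffAt.comp 0 (g := K.subtype) (f := c) (M.contMDiff_incl _) hc
  have hκW : dM ℝ E (fun t => (c t : G)) 0 1 = M.incl W := by
    have h2 := dM_comp (E₃ := E) (g := K.subtype) (0 : ℝ) (M.contMDiff_incl.mdifferentiable (by simp) (c 0))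
      (hc.mdifferentiableAt (by simp)) 1
    rw [hW, hc0] at h2
    exact h2
  have h3 := lie_eq_of_hasDerivAt_Ad (κ := fun t => (c t : G)) (by simp [hc0]) hκ hκW (M.vec v)
    (fun i => M.vec (b i)) _ _ ha (fun t => by
      rw [← M.vec_τ, ← M.vec_eq_sum b])
  have h4 : M.adp W v = v' := by
    refine M.vec_injective ?_
    rw [M.vec_adp, h3, ← M.vec_eq_sum b]
  rw [h4]
  exact h1

theorem exists_curve_K (W : GroupLieAlgebra 𝓘(ℝ, EK) K) : ∃ c : ℝ → K, c 0 = 1 ∧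
    ContMDiffAt 𝓘(ℝ, ℝ) 𝓘(ℝ, EK) ∞ c 0 ∧ dM ℝ EK c 0 1 = W :=
  haveI := isManifold_infty EK K
  exists_curve (E := EK) (1 : K) W

theorem τ_one (v : V) : M.τ 1 v = v := by
  refine M.vec_injective ?_
  have : (MulAut.conj (1 : G)).toMonoidHom = MonoidHom.id G := by ext; simp
  rw [M.vec_τ, OneMemClass.coe_one, Ad, this, differential_id]

theorem Ω_τ (k : K) (v w : V) : S.Ω (M.τ k v) (M.τ k w) = S.Ω v w :=
  M.Ω_Ad k v _ w _ (M.vec_τ k v) (M.vec_τ k w)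

/-- The pairing of `τ (c t) v` with `τ (c t) w` is constant along a curve `c` tangent to `W`. This
places `ad W` in `sp(V, Ω)`, the domain of the quantization `ν`. -/
theorem Ω_adp (T : M.Lift) (W : GroupLieAlgebra 𝓘(ℝ, EK) K) (v w : V) :
    S.Ω (M.adp W v) w + S.Ω v (M.adp W w) = 0 := by
  obtain ⟨c, hc0, hc, hW⟩ := exists_curve_K W
  have hv := M.hasDerivAt_curve_τ T hc0 hc hW v
  have hw := M.hasDerivAt_curve_τ T hc0 hc hW w
  have h1 : HasDerivAt (fun t => LinearMap.toContinuousBilinearMap S.Ω (M.τ (c t) v) (M.τ (c t) w))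
      _ 0 := ((LinearMap.toContinuousBilinearMap S.Ω).hasFDerivAt.comp_hasDerivAt (0 : ℝ) hv).clm_apply hw
  have h2 : (fun t => LinearMap.toContinuousBilinearMap S.Ω (M.τ (c t) v) (M.τ (c t) w)) =
      fun _ => S.Ω v w := funext fun t => M.Ω_τ (c t) v w
  rw [h2] at h1
  have h3 := h1.unique (hasDerivAt_const (0 : ℝ) _)
  simpa [hc0, τ_one] using h3

theorem adp_comm (T : M.Lift) {A : V →ₗ[ℝ] V} (hAK : ∀ (k : K) (v : V), A (M.τ k v) = M.τ k (A v))
    (W : GroupLieAlgebra 𝓘(ℝ, EK) K) (v : V) : A (M.adp W v) = M.adp W (A v) := by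
  obtain ⟨c, hc0, hc, hW⟩ := exists_curve_K W
  have h1 : HasDerivAt (fun t => A (M.τ (c t) v)) (A (M.adp W v)) 0 :=
    (LinearMap.toContinuousLinearMap A).hasFDerivAt.comp_hasDerivAt (0 : ℝ)
      (M.hasDerivAt_curve_τ T hc0 hc hW v)
  simp only [hAK] at h1
  exact h1.unique (M.hasDerivAt_curve_τ T hc0 hc hW (A v))

end SymplecticSymmetricSpace
end Infinitesimal
end MpcDirac

/-! ### The invariant form on 𝔤: existence and uniqueness. -/

namespace MpcDirac
noncomputable section InvariantForm

/-- The formula prescribes the form on pairs `(x, t)`, so the question is whether it depends only on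
`κ x t`. It does because `B₀ x (ρ (κ y z) t)` is skew in `x, t` and in `y, z` and satisfies the
Bianchi identity, hence is symmetric under exchange of the two pairs, like a Riemann tensor. -/
theorem exists_curvature_form {𝔨 V : Type*} [AddCommGroup 𝔨] [Module ℝ 𝔨] [AddCommGroup V]
    [Module ℝ V] (ρ : 𝔨 →ₗ[ℝ] Module.End ℝ V) (κ : V →ₗ[ℝ] V →ₗ[ℝ] 𝔨)
    (B₀ : LinearMap.BilinForm ℝ V) (hB : ∀ x y, B₀ x y = B₀ y x)
    (hρ : ∀ W x y, B₀ (ρ W x) y + B₀ x (ρ W y) = 0) (hκ : ∀ x y, κ x y = -κ y x)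
    (hJ : ∀ x y z, ρ (κ x y) z + ρ (κ y z) x + ρ (κ z x) y = 0)
    (hs : ∀ W, W ∈ Submodule.span ℝ {Z | ∃ x y, Z = κ x y}) :
    ∃ β : LinearMap.BilinForm ℝ 𝔨, (∀ x t U, β (κ x t) U = -B₀ x (ρ U t)) ∧
      ∀ U W, β U W = β W U := by
  have hanti : ∀ x t y z, B₀ x (ρ (κ y z) t) = -B₀ x (ρ (κ z y) t) := fun x t y z => by
    rw [hκ y z, map_neg, LinearMap.neg_apply, map_neg]
  have hskew : ∀ x t W, B₀ x (ρ W t) = -B₀ t (ρ W x) := fun x t W => by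
    rw [hB t]; linarith [hρ W x t]
  have hpair : ∀ x t y z, B₀ x (ρ (κ y z) t) = B₀ y (ρ (κ x t) z) := by
    intro x t y z
    have J : ∀ a x y z, B₀ a (ρ (κ x y) z) + B₀ a (ρ (κ y z) x) + B₀ a (ρ (κ z x) y) = 0 :=
      fun a x y z => by rw [← map_add, ← map_add, hJ, map_zero]
    -- The classical octahedron argument: a signed combination of four Bianchi identities, with the
    -- skew symmetries in both pairs, leaves the exchange of pairs.
    linarith [J x t y z, J t x y z, J y z x t, J z y x t, hskew x t (κ y z), hskew x y (κ z t),
      hskew x z (κ t y), hskew t y (κ z x), hskew t z (κ x y), hskew y z (κ x t), hanti x t y z,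
      hanti x y z t, hanti x z t y, hanti t y z x, hanti t z x y, hanti y z x t, hanti t x y z,
      hanti y x z t, hanti z x t y, hanti y t z x, hanti z t x y, hanti z y x t]
  set c : TensorProduct ℝ V V →ₗ[ℝ] 𝔨 := TensorProduct.lift κ with hc
  have hcs : LinearMap.range c = ⊤ := by
    refine top_unique fun W _ => ?_
    refine Submodule.span_le.2 ?_ (hs W)
    rintro _ ⟨x, y, rfl⟩
    exact ⟨TensorProduct.tmul ℝ x y, by simp [hc]⟩
  obtain ⟨s, hsec⟩ := c.exists_rightInverse_of_surjective hcs
  set b : TensorProduct ℝ V V →ₗ[ℝ] 𝔨 →ₗ[ℝ] ℝ := TensorProduct.lift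
    (LinearMap.mk₂ ℝ (fun x t => -((B₀ x) ∘ₗ (ρ.flip t)))
      (fun x y t => by ext U; simp [add_comm]) (fun r x t => by ext U; simp)
      (fun x t u => by ext U; simp [add_comm]) (fun r x t => by ext U; simp)) with hb
  have hbt : ∀ x t U, b (TensorProduct.tmul ℝ x t) U = -B₀ x (ρ U t) := fun x t U => by simp [hb]
  -- Pair symmetry on `V ⊗ V`. If `c p = 0`, the right side vanishes for every `q`; as `c` is onto,
  -- `b p = 0`, so `b` descends to 𝔨.
  have hsym : ∀ p q, b p (c q) = b q (c p) := by
    intro p q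
    induction p using TensorProduct.induction_on with
    | zero => simp
    | add p p' h h' => simp only [map_add, LinearMap.add_apply, h, h']
    | tmul x t =>
      induction q using TensorProduct.induction_on with
      | zero => simp
      | add q q' h h' => simp only [map_add, LinearMap.add_apply, h, h']
      | tmul y z =>
        rw [hbt, hbt]
        simp only [hc, TensorProduct.lift.tmul]
        rw [hpair]
  have hsurj : ∀ U, ∃ q, c q = U := fun U => by
    have : U ∈ LinearMap.range c := by rw [hcs]; trivial
    exact this
  have hcc : ∀ W, c (s W) = W := fun W => congrArg (fun f : 𝔨 →ₗ[ℝ] 𝔨 => f W) hsec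
  -- The section `s` only selects preimages under `c`; by `hsym` the value does not depend on the
  -- selection.
  refine ⟨b ∘ₗ s, fun x t U => ?_, fun U W => ?_⟩
  · obtain ⟨q, rfl⟩ := hsurj U
    rw [← hbt, LinearMap.comp_apply, hsym, hsym _ q, hcc]
    simp [hc]
  · have h := hsym (s U) (s W)
    rw [hcc, hcc] at h
    exact h

variable {E EK V : Type*} [NormedAddCommGroup E] [NormedSpace ℝ E] [NormedAddCommGroup EK]
  [NormedSpace ℝ EK] [NormedAddCommGroup V] [NormedSpace ℝ V]
  {G : Type*} [TopologicalSpace G] [ChartedSpace E G] [Group G] [LieGroup 𝓘(ℝ, E) ∞ G]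
  {S : FockModel V} {K : Subgroup G} [ChartedSpace EK K] [CompleteSpace E]

namespace SymplecticSymmetricSpace

variable (M : SymplecticSymmetricSpace E EK S K)

theorem sLie_vec (v : V) : M.sLie (M.vec v) = -M.vec v := (M.θ v).2

theorem incl_inj : Function.Injective M.incl := M.incl_injective

theorem sLie_sLie (X : GroupLieAlgebra 𝓘(ℝ, E) G) : M.sLie (M.sLie X) = X := by
  have h1 := differential_comp (f := M.s.toMonoidHom) (f' := M.s.toMonoidHom) M.contMDiff_s
    M.contMDiff_s X
  have h3 : M.s.toMonoidHom.comp M.s.toMonoidHom = MonoidHom.id G := by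
    ext g
    simp [M.s_s]
  rw [h3, differential_id] at h1
  exact h1.symm

theorem exists_incl {X : GroupLieAlgebra 𝓘(ℝ, E) G} (h : M.sLie X = X) : ∃ W, M.incl W = X :=
  M.fixed X h

/-- The sum decomposition `𝔤 = 𝔨 ⊕ 𝔭`. -/
def decomp : (GroupLieAlgebra 𝓘(ℝ, EK) K × V) ≃ₗ[ℝ] GroupLieAlgebra 𝓘(ℝ, E) G :=
  LinearEquiv.ofBijective (M.incl.toLinearMap.coprod (M.p.subtype ∘ₗ M.θ.toLinearMap)) <| by
    have hval : ∀ W v, (M.incl.toLinearMap.coprod (M.p.subtype ∘ₗ M.θ.toLinearMap)) (W, v) =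
      M.incl W + M.vec v := fun W v => rfl
    refine ⟨?_, fun X => ?_⟩
    · rw [← LinearMap.ker_eq_bot, LinearMap.ker_eq_bot']
      rintro ⟨W, v⟩ h
      rw [hval] at h
      have h1 := congrArg M.sLie h
      rw [map_add, M.sLie_incl, M.sLie_vec, map_zero] at h1
      have h2 : (2 : ℝ) • M.incl W = 0 := by
        rw [two_smul]
        calc M.incl W + M.incl W = (M.incl W + M.vec v) + (M.incl W + -M.vec v) := by abel
          _ = 0 := by rw [h, h1, add_zero]
      have h3 : M.incl W = 0 := (smul_eq_zero.1 h2).resolve_left two_ne_zero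
      have h4 : W = 0 := M.incl_inj (by rw [h3, map_zero])
      rw [h3, zero_add] at h
      have h5 : v = 0 := M.θ.injective (Subtype.ext (by simpa [vec] using h))
      rw [h4, h5]
      rfl
    · obtain ⟨W, hW⟩ := M.exists_incl (X := (1 / 2 : ℝ) • (X + M.sLie X)) (by
        rw [map_smul, map_add, M.sLie_sLie, add_comm])
      have hp : (1 / 2 : ℝ) • (X - M.sLie X) ∈ M.p := by
        rw [SymmetricPair.mem_p, map_smul, map_sub, M.sLie_sLie, ← smul_neg, neg_sub]
      refine ⟨(W, M.θ.symm ⟨_, hp⟩), ?_⟩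
      rw [hval, hW, vec, LinearEquiv.apply_symm_apply]
      simp only
      module

theorem decomp_apply (W : GroupLieAlgebra 𝓘(ℝ, EK) K) (v : V) :
    M.decomp (W, v) = M.incl W + M.vec v := rfl

/-- The projection `𝔤 → 𝔨`. -/
def prK : GroupLieAlgebra 𝓘(ℝ, E) G →ₗ[ℝ] GroupLieAlgebra 𝓘(ℝ, EK) K :=
  LinearMap.fst ℝ _ _ ∘ₗ M.decomp.symm.toLinearMap

/-- The projection `𝔤 → 𝔭 = V`. -/
def prP : GroupLieAlgebra 𝓘(ℝ, E) G →ₗ[ℝ] V :=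
  LinearMap.snd ℝ _ _ ∘ₗ M.decomp.symm.toLinearMap

theorem decomp_symm (W : GroupLieAlgebra 𝓘(ℝ, EK) K) (v : V) :
    M.decomp.symm (M.incl W + M.vec v) = (W, v) := by
  rw [← decomp_apply, LinearEquiv.symm_apply_apply]

theorem vec_zero : M.vec 0 = 0 := by simp [vec]

@[simp] theorem prK_incl (W : GroupLieAlgebra 𝓘(ℝ, EK) K) : M.prK (M.incl W) = W := by
  have := M.decomp_symm W 0
  rw [vec_zero, add_zero] at this
  simp [prK, this]

@[simp] theorem prP_incl (W : GroupLieAlgebra 𝓘(ℝ, EK) K) : M.prP (M.incl W) = 0 := by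
  have := M.decomp_symm W 0
  rw [vec_zero, add_zero] at this
  simp [prP, this]

@[simp] theorem prK_vec (v : V) : M.prK (M.vec v) = 0 := by
  have := M.decomp_symm 0 v
  rw [map_zero, zero_add] at this
  simp [prK, this]

@[simp] theorem prP_vec (v : V) : M.prP (M.vec v) = v := by
  have := M.decomp_symm 0 v
  rw [map_zero, zero_add] at this
  simp [prP, this]

theorem eq_incl_add_vec (X : GroupLieAlgebra 𝓘(ℝ, E) G) :
    X = M.incl (M.prK X) + M.vec (M.prP X) := by
  conv_lhs => rw [← M.decomp.apply_symm_apply X]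
  rfl

theorem incl_prK {X : GroupLieAlgebra 𝓘(ℝ, E) G} (h : M.sLie X = X) : M.incl (M.prK X) = X := by
  obtain ⟨W, rfl⟩ := M.exists_incl h
  rw [prK_incl]

/-- The bracket `𝔭 × 𝔭 → 𝔨`. -/
def lieP : V →ₗ[ℝ] V →ₗ[ℝ] GroupLieAlgebra 𝓘(ℝ, EK) K :=
  LinearMap.mk₂ ℝ (fun v w => M.prK ⁅M.vec v, M.vec w⁆)
    (fun u v w => by
      rw [show M.vec (u + v) = M.vec u + M.vec v by simp [vec], add_lie, map_add])
    (fun r v w => by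
      rw [show M.vec (r • v) = r • M.vec v by simp [vec], smul_lie, map_smul])
    (fun u v w => by
      rw [show M.vec (v + w) = M.vec v + M.vec w by simp [vec], lie_add, map_add])
    (fun r v w => by
      rw [show M.vec (r • w) = r • M.vec w by simp [vec], lie_smul, map_smul])

theorem incl_lieP (v w : V) : M.incl (M.lieP v w) = ⁅M.vec v, M.vec w⁆ := by
  refine M.incl_prK ?_
  rw [M.sLie_lie, M.sLie_vec, M.sLie_vec, neg_lie, lie_neg, neg_neg]

/-- The bracket of `𝔨`, computed in `𝔤`. -/
def lieK (U W : GroupLieAlgebra 𝓘(ℝ, EK) K) : GroupLieAlgebra 𝓘(ℝ, EK) K :=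
  M.prK ⁅M.incl U, M.incl W⁆

theorem incl_lieK (U W : GroupLieAlgebra 𝓘(ℝ, EK) K) :
    M.incl (M.lieK U W) = ⁅M.incl U, M.incl W⁆ := by
  refine M.incl_prK ?_
  rw [M.sLie_lie, M.sLie_incl, M.sLie_incl]

theorem vec_inj {v w : V} (h : M.vec v = M.vec w) : v = w := M.θ.injective (Subtype.ext h)

/-- The isotropy representation `W ↦ ad(W)|_𝔭` as a linear map. -/
def adpL : GroupLieAlgebra 𝓘(ℝ, EK) K →ₗ[ℝ] Module.End ℝ V where
  toFun := M.adp
  map_add' U W := LinearMap.ext fun v => M.vec_inj <| by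
    rw [LinearMap.add_apply, show M.vec (M.adp U v + M.adp W v) = M.vec (M.adp U v) +
      M.vec (M.adp W v) by simp [vec], vec_adp, vec_adp, vec_adp, map_add, add_lie]
  map_smul' r W := LinearMap.ext fun v => M.vec_inj <| by
    rw [LinearMap.smul_apply, show M.vec ((RingHom.id ℝ) r • M.adp W v) = r • M.vec (M.adp W v) by
      simp [vec], vec_adp, vec_adp, map_smul, smul_lie]

theorem adpL_apply (W : GroupLieAlgebra 𝓘(ℝ, EK) K) : M.adpL W = M.adp W := rfl

theorem lieP_swap (v w : V) : M.lieP v w = -M.lieP w v := M.incl_inj <| by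
  rw [map_neg, incl_lieP, incl_lieP, lie_skew]

theorem lieP_jacobi (x y z : V) :
    M.adp (M.lieP x y) z + M.adp (M.lieP y z) x + M.adp (M.lieP z x) y = 0 := M.vec_inj <| by
  rw [show ∀ a b c : V, M.vec (a + b + c) = M.vec a + M.vec b + M.vec c by simp [vec]]
  simp only [vec_adp, incl_lieP, vec_zero]
  have h := lie_jacobi (M.vec x) (M.vec y) (M.vec z)
  rw [← lie_skew (M.vec x) ⁅M.vec y, M.vec z⁆, ← lie_skew (M.vec y) ⁅M.vec z, M.vec x⁆,
    ← lie_skew (M.vec z) ⁅M.vec x, M.vec y⁆] at h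
  rw [← neg_eq_zero, ← h]
  abel

theorem mem_span_lieP (W : GroupLieAlgebra 𝓘(ℝ, EK) K) :
    W ∈ Submodule.span ℝ {Z | ∃ v w, Z = M.lieP v w} := by
  have h1 : Submodule.map M.incl.toLinearMap (Submodule.span ℝ {Z | ∃ v w, Z = M.lieP v w}) =
      Submodule.span ℝ {Z | ∃ v w : V, Z = ⁅M.vec v, M.vec w⁆} := by
    rw [Submodule.map_span]
    congr 1
    ext Z
    constructor
    · rintro ⟨_, ⟨v, w, rfl⟩, rfl⟩
      exact ⟨v, w, M.incl_lieP v w⟩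
    · rintro ⟨v, w, rfl⟩
      exact ⟨_, ⟨v, w, rfl⟩, M.incl_lieP v w⟩
  have h2 := M.lie_p_p W
  change M.incl W ∈ Submodule.span ℝ {Z | ∃ v w : V, Z = ⁅M.vec v, M.vec w⁆} at h2
  rw [← h1] at h2
  obtain ⟨W', hW', h⟩ := h2
  rwa [← M.incl_inj h]

theorem adp_lieK (U W : GroupLieAlgebra 𝓘(ℝ, EK) K) (v : V) :
    M.adp (M.lieK U W) v = M.adp U (M.adp W v) - M.adp W (M.adp U v) := M.vec_inj <| by
  rw [show ∀ a b : V, M.vec (a - b) = M.vec a - M.vec b by simp [vec]]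
  simp only [vec_adp, incl_lieK, lie_lie]

theorem lieK_lieP (W : GroupLieAlgebra 𝓘(ℝ, EK) K) (x y : V) :
    M.lieK W (M.lieP x y) = M.lieP (M.adp W x) y + M.lieP x (M.adp W y) := M.incl_inj <| by
  rw [map_add]
  simp only [incl_lieK, incl_lieP, vec_adp]
  exact leibniz_lie _ _ _

/-- This is how `𝔨 = [𝔭, 𝔭]` is used: identities linear in an element of 𝔨 are verified on brackets
of elements of 𝔭. -/
theorem k_induction {P : GroupLieAlgebra 𝓘(ℝ, EK) K → Prop} (h : ∀ x y, P (M.lieP x y))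
    (h0 : P 0) (ha : ∀ U W, P U → P W → P (U + W)) (hs : ∀ (r : ℝ) W, P W → P (r • W))
    (W : GroupLieAlgebra 𝓘(ℝ, EK) K) : P W := by
  refine Submodule.span_induction (p := fun W _ => P W) ?_ h0 (fun U W _ _ => ha U W)
    (fun r W _ => hs r W) (M.mem_span_lieP W)
  rintro _ ⟨x, y, rfl⟩
  exact h x y

theorem sLie_Ad (k : K) (X : GroupLieAlgebra 𝓘(ℝ, E) G) :
    M.sLie (Ad E (k : G) X) = Ad E (k : G) (M.sLie X) := by
  have h1 := differential_comp (f := (MulAut.conj (k : G)).toMonoidHom) (f' := M.s.toMonoidHom)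
    (contMDiff_conj (k : G)) M.contMDiff_s X
  have h2 := differential_comp (f' := (MulAut.conj (k : G)).toMonoidHom) (f := M.s.toMonoidHom)
    M.contMDiff_s (contMDiff_conj (k : G)) X
  have h3 : M.s.toMonoidHom.comp (MulAut.conj (k : G)).toMonoidHom =
      (MulAut.conj (k : G)).toMonoidHom.comp M.s.toMonoidHom := by
    ext g
    simp [M.s_fix k k.2]
  rw [h3] at h1
  exact h1.symm.trans h2

theorem _root_.MpcDirac.Ad_lie (g : G) (X Y : GroupLieAlgebra 𝓘(ℝ, E) G) :
    Ad E g ⁅X, Y⁆ = ⁅Ad E g X, Ad E g Y⁆ := by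
  have h : ⇑(MulAut.conj g).symm = MulAut.conj g⁻¹ := by
    ext x
    simp
  exact differential_lie (MulAut.conj g) (contMDiff_conj g) (by rw [h]; exact contMDiff_conj _) X Y

/-- The adjoint action of `K` on `𝔨`, computed in `𝔤`. -/
def AdK (k : K) : GroupLieAlgebra 𝓘(ℝ, EK) K →ₗ[ℝ] GroupLieAlgebra 𝓘(ℝ, EK) K :=
  M.prK ∘ₗ (Ad E (k : G)).toLinearMap ∘ₗ M.incl.toLinearMap

theorem incl_AdK (k : K) (W : GroupLieAlgebra 𝓘(ℝ, EK) K) :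
    M.incl (M.AdK k W) = Ad E (k : G) (M.incl W) := by
  refine M.incl_prK ?_
  change M.sLie (Ad E (k : G) (M.incl W)) = Ad E (k : G) (M.incl W)
  rw [sLie_Ad, M.sLie_incl]

theorem AdK_lieP (k : K) (x y : V) : M.AdK k (M.lieP x y) = M.lieP (M.τ k x) (M.τ k y) :=
  M.incl_inj <| by rw [incl_AdK, incl_lieP, incl_lieP, Ad_lie, vec_τ, vec_τ]

theorem adp_AdK (k : K) (W : GroupLieAlgebra 𝓘(ℝ, EK) K) (v : V) :
    M.adp (M.AdK k W) (M.τ k v) = M.τ k (M.adp W v) :=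
  M.vec_inj <| by rw [vec_adp, vec_τ, vec_τ, vec_adp, incl_AdK, Ad_lie]

/-- The axioms give the values on 𝔭 × 𝔭, on 𝔭 × [𝔭, 𝔭] and, reduced to 𝔭 × 𝔭, on [𝔭, 𝔭] × [𝔭, 𝔭].
Since 𝔤 is the sum of 𝔨 and 𝔭, nothing else is free. -/
theorem isExtension_unique {A : V ≃ₗ[ℝ] V} {B B' : LinearMap.BilinForm ℝ (GroupLieAlgebra 𝓘(ℝ, E) G)}
    (h : M.IsExtension A B) (h' : M.IsExtension A B') : B' = B := by
  have hm : ∀ (W : GroupLieAlgebra 𝓘(ℝ, EK) K) x, B (M.vec x) (M.incl W) = B' (M.vec x) (M.incl W) := by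
    intro W x
    induction W using M.k_induction with
    | h y z => rw [incl_lieP, h.mixed, h'.mixed]
    | h0 => simp
    | ha U W hU hW => simp only [map_add, hU, hW]
    | hs r W hW => simp only [map_smul, hW]
  have hk : ∀ U W : GroupLieAlgebra 𝓘(ℝ, EK) K,
      B (M.incl U) (M.incl W) = B' (M.incl U) (M.incl W) := by
    intro U W
    induction W using M.k_induction with
    | h y z =>
      induction U using M.k_induction with
      | h x t =>
        rw [incl_lieP, incl_lieP, h.on_k, h'.on_k, ← incl_lieP, ← lie_skew, ← vec_adp, map_neg,
          map_neg, h.on_p, h'.on_p]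
      | h0 => simp
      | ha U W hU hW => simp only [map_add, LinearMap.add_apply, hU, hW]
      | hs r W hW => simp only [map_smul, LinearMap.smul_apply, hW]
    | h0 => simp
    | ha U W hU hW => simp only [map_add, hU, hW]
    | hs r W hW => simp only [map_smul, hW]
  refine LinearMap.ext fun X => LinearMap.ext fun Y => ?_
  rw [M.eq_incl_add_vec X, M.eq_incl_add_vec Y]
  simp only [map_add, LinearMap.add_apply, hm, hk, h.on_p, h'.on_p, h.symm (M.incl _) (M.vec _),
    h'.symm (M.incl _) (M.vec _)]

theorem exists_isExtension {A : V ≃ₗ[ℝ] V} (hA : ∀ v w, S.Ω (A v) w = -S.Ω v (A w))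
    (hAτ : ∀ (k : K) (v : V), A (M.τ k v) = M.τ k (A v))
    (hΩτ : ∀ (k : K) (v w : V), S.Ω (M.τ k v) (M.τ k w) = S.Ω v w)
    (hAad : ∀ W v, A (M.adp W v) = M.adp W (A v))
    (hΩad : ∀ W v w, S.Ω (M.adp W v) w + S.Ω v (M.adp W w) = 0) :
    ∃ B : LinearMap.BilinForm ℝ (GroupLieAlgebra 𝓘(ℝ, E) G), M.IsExtension A B := by
  have hA' : ∀ v w, S.Ω (A.symm v) w = -S.Ω v (A.symm w) := fun v w => by
    have := hA (A.symm v) (A.symm w)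
    rw [A.apply_symm_apply, A.apply_symm_apply] at this
    linarith
  have hAad' : ∀ W v, A.symm (M.adp W v) = M.adp W (A.symm v) := fun W v => by
    rw [A.symm_apply_eq, hAad, A.apply_symm_apply]
  have hAτ' : ∀ (k : K) v, A.symm (M.τ k v) = M.τ k (A.symm v) := fun W v => by
    rw [A.symm_apply_eq, hAτ, A.apply_symm_apply]
  set B₀ : LinearMap.BilinForm ℝ V := -(S.Ω.compl₂ A.symm.toLinearMap) with hB₀
  have hB : ∀ x y, B₀ x y = -S.Ω x (A.symm y) := fun x y => rfl
  have hBs : ∀ x y, B₀ x y = B₀ y x := fun x y => by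
    rw [hB, hB, ← hA', S.skew]
  have hBad : ∀ W x y, B₀ (M.adp W x) y + B₀ x (M.adp W y) = 0 := fun W x y => by
    rw [hB, hB, hAad']; linarith [hΩad W x (A.symm y)]
  obtain ⟨β, hβ, hβs⟩ := exists_curvature_form M.adpL M.lieP B₀ hBs hBad M.lieP_swap M.lieP_jacobi
    M.mem_span_lieP
  simp only [adpL_apply] at hβ
  have hβ' : ∀ U x t, β U (M.lieP x t) = -B₀ x (M.adp U t) := fun U x t => by rw [hβs, hβ]
  -- On a bracket `U = [x, t]` the Leibniz rule and the commutator formula for the action leave only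
  -- the invariance of `B₀` under `W`.
  have hβad : ∀ W U U', β (M.lieK W U) U' + β U (M.lieK W U') = 0 := by
    intro W U U'
    have hl0 : M.lieK W 0 = 0 := by simp [lieK]
    have hla : ∀ U U', M.lieK W (U + U') = M.lieK W U + M.lieK W U' := by simp [lieK]
    have hls : ∀ (r : ℝ) U, M.lieK W (r • U) = r • M.lieK W U := by simp [lieK]
    induction U using M.k_induction with
    | h x t =>
      rw [lieK_lieP, map_add, LinearMap.add_apply, hβ, hβ, hβ, adp_lieK, map_sub]
      linarith [hBad W x (M.adp U' t)]
    | h0 => simp [hl0]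
    | ha U V hU hV =>
      simp only [hla, map_add, LinearMap.add_apply] at *
      linarith
    | hs r U hU =>
      simp only [hls, map_smul, LinearMap.smul_apply, smul_eq_mul] at *
      rw [← mul_add, hU, mul_zero]
  have hβAd : ∀ k U U', β (M.AdK k U) (M.AdK k U') = β U U' := by
    intro k U U'
    induction U using M.k_induction with
    | h x t => rw [AdK_lieP, hβ, adp_AdK, hβ, hB, hB, hAτ', hΩτ]
    | h0 => simp
    | ha U V hU hV => simp only [map_add, LinearMap.add_apply, hU, hV]
    | hs r U hU => simp only [map_smul, LinearMap.smul_apply, hU]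
  -- The extension is the orthogonal sum of `B₀` on 𝔭 and `β` on 𝔨; orthogonality is the condition
  -- `mixed`.
  set B : LinearMap.BilinForm ℝ (GroupLieAlgebra 𝓘(ℝ, E) G) :=
    B₀.compl₁₂ M.prP M.prP + β.compl₁₂ M.prK M.prK with hBdef
  have hBv : ∀ X Y, B X Y = B₀ (M.prP X) (M.prP Y) + β (M.prK X) (M.prK Y) := fun X Y => rfl
  refine ⟨B, ⟨fun X Y => ?_, fun x y => ?_, fun x y z => ?_, fun x y z t => ?_, fun X Y Z => ?_,
    fun k X Y => ?_⟩⟩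
  · rw [hBv, hBv, hBs, hβs]
  · simp [hBv, hB]
  · rw [← incl_lieP]
    simp [hBv]
  · rw [← incl_lieP, ← incl_lieP, ← lie_skew, ← vec_adp, map_neg, hBv, hBv]
    simp [hβ]
  · rw [M.eq_incl_add_vec X, M.eq_incl_add_vec Y, M.eq_incl_add_vec Z]
    set U := M.prK X
    set U' := M.prK Y
    set W := M.prK Z
    set x := M.prP X
    set y := M.prP Y
    set z := M.prP Z
    have e : ∀ (U : GroupLieAlgebra 𝓘(ℝ, EK) K) x, ⁅M.incl W + M.vec z, M.incl U + M.vec x⁆ =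
        M.incl (M.lieK W U + M.lieP z x) + M.vec (M.adp W x - M.adp U z) := by
      intro U x
      rw [show ∀ a b : V, M.vec (a - b) = M.vec a - M.vec b by simp [vec], map_add, incl_lieK,
        incl_lieP, vec_adp, vec_adp, add_lie, lie_add, lie_add, ← lie_skew (M.incl U)]
      abel
    rw [e, e, hBv, hBv]
    simp only [map_add, prK_incl, prK_vec, prP_incl, prP_vec, add_zero, zero_add,
      LinearMap.add_apply, map_sub, LinearMap.sub_apply, hβ, hβ']
    -- Invariance under the 𝔨-part `W` is that of `β` and `B₀`. For the 𝔭-part `z` the mixed terms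
    -- cancel because `β` was defined through `B₀`.
    linarith [hβad W U U', hBad W x y, hBad U' z x, hBad U z y, hBs x (M.adp U' z)]
  · conv_rhs => rw [M.eq_incl_add_vec X, M.eq_incl_add_vec Y]
    conv_lhs => rw [M.eq_incl_add_vec X, M.eq_incl_add_vec Y]
    simp only [map_add (Ad E (k : G)), ← incl_AdK, ← vec_τ]
    rw [hBv, hBv]
    simp [hβAd, hB, hAτ', hΩτ]

end SymplecticSymmetricSpace
end InvariantForm
end MpcDirac

/-! ### Casimir elements, symplectic dual bases, non-degeneracy. -/

namespace MpcDirac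
noncomputable section Casimir

/-- The vector of the `B (b q) y` is the Gram matrix applied to the coordinates of `y`;
non-degeneracy makes this matrix invertible, so its inverse recovers `y`. -/
theorem sum_invGram_apply {L ι : Type*} [AddCommGroup L] [Module ℝ L] [Fintype ι] [DecidableEq ι]
    {B : LinearMap.BilinForm ℝ L} (hB : B.Nondegenerate) (b : Module.Basis ι ℝ L) (y : L) :
    ∑ p, ∑ q, (invGram B b p q * B (b q) y) • b p = y := by
  have hG : (Matrix.of fun r s => B (b r) (b s)) = LinearMap.BilinForm.toMatrix b B := by
    ext r s
    simp [LinearMap.BilinForm.toMatrix_apply]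
  have hdet : IsUnit (Matrix.of fun r s => B (b r) (b s)).det := by
    rw [hG]
    exact ((LinearMap.BilinForm.nondegenerate_iff_det_ne_zero b).1 hB).isUnit
  conv_rhs => rw [← b.sum_repr y]
  refine Finset.sum_congr rfl fun p _ => ?_
  rw [← Finset.sum_smul]
  congr 1
  have h1 : ∀ q, B (b q) y = ((Matrix.of fun r s => B (b r) (b s)).mulVec (b.repr y)) q := by
    intro q
    conv_lhs => rw [← b.sum_repr y]
    simp only [map_sum, map_smul, smul_eq_mul, Matrix.mulVec, dotProduct, Matrix.of_apply]
    exact Finset.sum_congr rfl fun _ _ => mul_comm _ _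
  simp only [h1]
  change ((Matrix.of fun r s => B (b r) (b s))⁻¹.mulVec
    ((Matrix.of fun r s => B (b r) (b s)).mulVec (b.repr y))) p = _
  rw [Matrix.mulVec_mulVec, Matrix.nonsing_inv_mul _ hdet, Matrix.one_mulVec]

/-- The Casimir element does not depend on the choice of a basis or of a dual system. -/
theorem sum_invGram_eq {L ι κ R : Type*} [AddCommGroup L] [Module ℝ L] [Fintype ι] [DecidableEq ι]
    [Fintype κ] [AddCommGroup R] [Module ℂ R] {B : LinearMap.BilinForm ℝ L} (hB : B.Nondegenerate)
    (b : Module.Basis ι ℝ L) (h : L →ₗ[ℝ] L →ₗ[ℝ] R) (x y : κ → L)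
    (hxy : ∀ X, X = ∑ i, B X (x i) • y i) :
    ∑ p, ∑ q, (invGram B b p q : ℂ) • h (b p) (b q) = ∑ i, h (x i) (y i) := by
  have h1 : ∀ p q, (invGram B b p q : ℂ) • h (b p) (b q) =
      ∑ i, h ((invGram B b p q * B (b q) (x i)) • b p) (y i) := by
    intro p q
    conv_lhs => rw [hxy (b q)]
    simp only [map_sum, map_smul, LinearMap.smul_apply, Finset.smul_sum, Complex.coe_smul, smul_smul]
  simp only [h1]
  calc ∑ p, ∑ q, ∑ i, h ((invGram B b p q * B (b q) (x i)) • b p) (y i)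
      = ∑ i, h (∑ p, ∑ q, (invGram B b p q * B (b q) (x i)) • b p) (y i) := by
        simp only [map_sum, LinearMap.sum_apply]
        exact Finset.sum_comm_cycle
    _ = _ := by simp only [sum_invGram_apply hB]

theorem invGram_symm {L ι : Type*} [AddCommGroup L] [Module ℝ L] [Fintype ι] [DecidableEq ι]
    {B : LinearMap.BilinForm ℝ L} (hB : ∀ x y, B x y = B y x) (b : ι → L) (p q : ι) :
    invGram B b p q = invGram B b q p := by
  have h : (Matrix.of fun r s => B (b r) (b s)).transpose = Matrix.of fun r s => B (b r) (b s) := by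
    ext r s
    exact hB _ _
  have h1 := Matrix.transpose_nonsing_inv (Matrix.of fun r s => B (b r) (b s))
  rw [h] at h1
  exact congrFun (congrFun h1 q) p

section Symplectic

variable {V R ι κ : Type*} [NormedAddCommGroup V] [NormedSpace ℝ V] [FiniteDimensional ℝ V]
  (S : FockModel V) [AddCommGroup R] [Module ℝ R] [Fintype ι] [DecidableEq ι]
  [Fintype κ] [DecidableEq κ] (e : Module.Basis ι ℝ V) (b : Module.Basis κ ℝ V)

theorem sum_Ω_dualBasis (v : V) : ∑ a, S.Ω v (S.dualBasis e a) • e a = v := by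
  have h : ∀ c, e.repr v c = S.Ω v (S.dualBasis e c) := by
    intro c
    conv_rhs => rw [← e.sum_repr v]
    simp only [map_sum, LinearMap.sum_apply, map_smul, LinearMap.smul_apply, smul_eq_mul,
      FockModel.apply_dualBasis, mul_ite, mul_one, mul_zero, Finset.sum_ite_eq', Finset.mem_univ,
      if_true]
  simp only [← h, e.sum_repr]

theorem sum_Ω_basis (v : V) : ∑ a, S.Ω (e a) v • S.dualBasis e a = v := by
  have h : ∀ w, S.Ω w (∑ a, S.Ω (e a) v • S.dualBasis e a - v) = 0 := by
    intro w
    have h1 : S.Ω w v = ∑ a, S.Ω w (S.dualBasis e a) * S.Ω (e a) v := by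
      conv_lhs => rw [← sum_Ω_dualBasis S e w]
      simp
    rw [map_sub, h1]
    simp [mul_comm]
  exact sub_eq_zero.1 (S.nondegenerate.2 _ h)

/-- The tensor `∑ eₐ ⊗ eᵃ` is inverse to `Ω` and so does not depend on the basis. This lets `ν`,
defined with one particular basis, be computed in the basis of the Dirac operators. -/
theorem sum_dual_eq (h : V →ₗ[ℝ] V →ₗ[ℝ] R) :
    ∑ a, h (e a) (S.dualBasis e a) = ∑ a, h (b a) (S.dualBasis b a) := by
  have h1 : ∀ a, h (e a) (S.dualBasis e a) =
      ∑ c, h (S.Ω (b c) (S.dualBasis e a) • e a) (S.dualBasis b c) := by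
    intro a
    conv_lhs => rw [← sum_Ω_basis S b (S.dualBasis e a)]
    simp
  simp only [h1]
  rw [Finset.sum_comm]
  refine Finset.sum_congr rfl fun c _ => ?_
  rw [← LinearMap.sum_apply, ← map_sum, sum_Ω_dualBasis]

/-- Infinitesimal invariance of the tensor `∑ eₐ ⊗ eᵃ` under `sp(V, Ω)`: a symplectic endomorphism
moves to the other factor with a minus sign. It is applied to `ad W` and also to `A`. -/
theorem sum_sp_eq (h : V →ₗ[ℝ] V →ₗ[ℝ] R) {ξ : V → V} (hξ : ∀ v w, S.Ω (ξ v) w = -S.Ω v (ξ w)) :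
    ∑ a, h (ξ (e a)) (S.dualBasis e a) = -∑ a, h (e a) (ξ (S.dualBasis e a)) := by
  have h1 : ∀ a, h (ξ (e a)) (S.dualBasis e a) =
      ∑ c, h (e c) (-(S.Ω (e a) (ξ (S.dualBasis e c)) • S.dualBasis e a)) := by
    intro a
    conv_lhs => rw [← sum_Ω_dualBasis S e (ξ (e a))]
    simp [hξ]
  simp only [h1]
  rw [Finset.sum_comm, ← Finset.sum_neg_distrib]
  refine Finset.sum_congr rfl fun c _ => ?_
  rw [← map_sum, Finset.sum_neg_distrib, sum_Ω_basis, map_neg]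

/-- The tensor `∑ eₐ ⊗ eᵃ` is antisymmetric, because `Ω` is. -/
theorem sum_swap_eq (h : V →ₗ[ℝ] V →ₗ[ℝ] R) :
    ∑ a, h (S.dualBasis e a) (e a) = -∑ a, h (e a) (S.dualBasis e a) := by
  have h1 : ∀ a, h (S.dualBasis e a) (e a) =
      ∑ c, h (S.Ω (e c) (e a) • S.dualBasis e a) (S.dualBasis e c) := by
    intro a
    conv_lhs => rw [← sum_Ω_basis S e (e a)]
    simp
  simp only [h1]
  rw [Finset.sum_comm, ← Finset.sum_neg_distrib]
  refine Finset.sum_congr rfl fun c _ => ?_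
  have h2 : ∑ a, S.Ω (e c) (e a) • S.dualBasis e a = -e c := by
    rw [← sum_Ω_basis S e (-e c)]
    refine Finset.sum_congr rfl fun a _ => ?_
    rw [map_neg, ← S.skew]
  rw [← LinearMap.sum_apply, ← map_sum, h2]
  simp

/-- For `ξ ∈ sp(V, Ω)`, `∑ (eₐ ξ(eᵃ) + ξ(eᵃ) eₐ) = 2 ∑ eₐ ξ(eᵃ)`. -/
theorem sum_symmetrized_eq (h : V →ₗ[ℝ] V →ₗ[ℝ] R) {ξ : Module.End ℝ V}
    (hξ : ∀ v w, S.Ω (ξ v) w = -S.Ω v (ξ w)) :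
    ∑ a, (h (b a) (ξ (S.dualBasis b a)) + h (ξ (S.dualBasis b a)) (b a)) =
      (2 : ℝ) • ∑ a, h (e a) (ξ (S.dualBasis e a)) := by
  have h1 := sum_swap_eq S b (h.comp ξ)
  have h2 := sum_sp_eq S b h hξ
  have h3 := sum_dual_eq S e b (h.compl₂ ξ)
  simp only [LinearMap.comp_apply, LinearMap.compl₂_apply] at h1 h3
  rw [Finset.sum_add_distrib, h1, h2, h3, neg_neg, two_smul]

end Symplectic

variable {E EK V : Type*} [NormedAddCommGroup E] [NormedSpace ℝ E] [NormedAddCommGroup EK]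
  [NormedSpace ℝ EK] [NormedAddCommGroup V] [NormedSpace ℝ V]
  {G : Type*} [TopologicalSpace G] [ChartedSpace E G] [Group G] [LieGroup 𝓘(ℝ, E) ∞ G]
  {S : FockModel V} {K : Subgroup G} [ChartedSpace EK K] [CompleteSpace E]

namespace SymplecticSymmetricSpace

variable (M : SymplecticSymmetricSpace E EK S K)

namespace IsExtension

variable {M} {A : V ≃ₗ[ℝ] V} {B : LinearMap.BilinForm ℝ (GroupLieAlgebra 𝓘(ℝ, E) G)}

theorem vec_incl (h : M.IsExtension A B) (v : V) (W : GroupLieAlgebra 𝓘(ℝ, EK) K) : B (M.vec v) (M.incl W) = 0 := by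
  induction W using M.k_induction with
  | h y z => rw [incl_lieP, h.mixed]
  | h0 => simp
  | ha U W hU hW => simp only [map_add, hU, hW, add_zero]
  | hs r W hW => simp only [map_smul, hW, smul_zero]

/-- The condition `on_k` extended from brackets to all of 𝔨. Non-degeneracy on 𝔨 rests on it, and so
does the expansion of `[x, t]` in a basis of 𝔨. -/
theorem lieP_incl (h : M.IsExtension A B) (x t : V) (W : GroupLieAlgebra 𝓘(ℝ, EK) K) :
    B (M.incl (M.lieP x t)) (M.incl W) = S.Ω x (A.symm (M.adp W t)) := by
  induction W using M.k_induction with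
  | h y z =>
    rw [incl_lieP, incl_lieP, h.on_k, ← incl_lieP, ← lie_skew, ← vec_adp, map_neg, h.on_p, neg_neg]
  | h0 => simp [← adpL_apply]
  | ha U W hU hW => simp only [map_add, hU, hW, ← adpL_apply, LinearMap.add_apply]
  | hs r W hW => simp only [map_smul, hW, ← adpL_apply, LinearMap.smul_apply]

/-- If `W` is orthogonal to all brackets, `lieP_incl` and the non-degeneracy of `Ω` give `[W, 𝔭] =
0`, and then faithfulness gives `W = 0`. -/
theorem nondegenerate_k [FiniteDimensional ℝ V] (h : M.IsExtension A B) :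
    (B.compl₁₂ M.incl.toLinearMap M.incl.toLinearMap).Nondegenerate := by
  have key : ∀ W, (∀ U, B (M.incl U) (M.incl W) = 0) → W = 0 := by
    intro W hW
    refine M.faithful W fun t => ?_
    change ⁅M.incl W, M.vec t⁆ = 0
    rw [← vec_adp]
    have h1 : A.symm (M.adp W t) = 0 :=
      S.nondegenerate.2 _ fun x => by rw [← h.lieP_incl, hW]
    rw [(A.symm.map_eq_zero_iff).1 h1, vec_zero]
  refine ⟨fun W hW => key W fun U => ?_, fun W hW => key W hW⟩
  rw [h.symm]
  exact hW U

theorem nondegenerate [FiniteDimensional ℝ V] (h : M.IsExtension A B) : B.Nondegenerate := by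
  have key : ∀ X, (∀ Y, B X Y = 0) → X = 0 := by
    intro X hX
    have h1 : M.prK X = 0 := by
      refine h.nondegenerate_k.1 _ fun W => ?_
      change B (M.incl (M.prK X)) (M.incl W) = 0
      have h2 := hX (M.incl W)
      rw [M.eq_incl_add_vec X, map_add, LinearMap.add_apply, h.vec_incl, add_zero] at h2
      exact h2
    have h3 : M.prP X = 0 := by
      refine S.nondegenerate.1 _ fun w => ?_
      have h2 := hX (M.vec (A w))
      rw [M.eq_incl_add_vec X, h1, map_zero, zero_add, h.on_p, A.symm_apply_apply] at h2
      exact neg_eq_zero.1 h2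
    rw [M.eq_incl_add_vec X, h1, h3, map_zero, vec_zero, add_zero]
  refine ⟨key, fun Y hY => key Y fun X => ?_⟩
  rw [h.symm]
  exact hY X

theorem symm_k (h : M.IsExtension A B) (U W : GroupLieAlgebra 𝓘(ℝ, EK) K) :
    B.compl₁₂ M.incl.toLinearMap M.incl.toLinearMap U W =
      B.compl₁₂ M.incl.toLinearMap M.incl.toLinearMap W U := h.symm _ _

theorem sum_invGram_k [FiniteDimensional ℝ V] (h : M.IsExtension A B) {ιK : Type*} [Fintype ιK] [DecidableEq ιK]
    (w : Module.Basis ιK ℝ (GroupLieAlgebra 𝓘(ℝ, EK) K)) (U : GroupLieAlgebra 𝓘(ℝ, EK) K) :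
    U = ∑ r, ∑ s, (invGram (B.compl₁₂ M.incl.toLinearMap M.incl.toLinearMap) w r s *
      B (M.incl U) (M.incl (w r))) • w s := by
  conv_lhs => rw [← sum_invGram_apply h.nondegenerate_k w U]
  rw [Finset.sum_comm]
  refine Finset.sum_congr rfl fun r _ => Finset.sum_congr rfl fun s _ => ?_
  rw [invGram_symm h.symm_k]
  congr 2
  exact h.symm _ _

/-- The Casimir element of `𝔤` in terms of bases of `𝔭` and `𝔨`. -/
theorem casimir_g [FiniteDimensional ℝ V] (h : M.IsExtension A B) {R ιV ιK ιG : Type*} [AddCommGroup R] [Module ℂ R]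
    [Fintype ιV] [DecidableEq ιV] [Fintype ιK] [DecidableEq ιK] [Fintype ιG] [DecidableEq ιG]
    (e : Module.Basis ιV ℝ V) (w : Module.Basis ιK ℝ (GroupLieAlgebra 𝓘(ℝ, EK) K))
    (u : Module.Basis ιG ℝ (GroupLieAlgebra 𝓘(ℝ, E) G))
    (f : GroupLieAlgebra 𝓘(ℝ, E) G →ₗ[ℝ] GroupLieAlgebra 𝓘(ℝ, E) G →ₗ[ℝ] R) :
    ∑ p, ∑ q, (invGram B u p q : ℂ) • f (u p) (u q) =
      ∑ a, f (M.vec (A (e a))) (M.vec (S.dualBasis e a)) +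
      ∑ r, ∑ s, (invGram (B.compl₁₂ M.incl.toLinearMap M.incl.toLinearMap) w r s : ℂ) •
        f (M.incl (w r)) (M.incl (w s)) := by
  -- A dual system adapted to `𝔤 = 𝔭 ⊕ 𝔨`. On 𝔭 the vectors `A eₐ` and `eᵃ` are dual because `B(x, A
  -- eₐ) = -Ω(x, eₐ) = Ω(eₐ, x)`; on 𝔨 the dual vectors come from the inverse Gram matrix.
  rw [sum_invGram_eq h.nondegenerate u f
    (Sum.elim (fun a => M.vec (A (e a))) (fun r => M.incl (w r)))
    (Sum.elim (fun a => M.vec (S.dualBasis e a)) (fun r => ∑ s,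
      invGram (B.compl₁₂ M.incl.toLinearMap M.incl.toLinearMap) w r s • M.incl (w s)))]
  · simp only [Fintype.sum_sum_type, Sum.elim_inl, Sum.elim_inr, map_sum, map_smul,
      Complex.coe_smul]
  · intro X
    rw [Fintype.sum_sum_type]
    simp only [Sum.elim_inl, Sum.elim_inr]
    have h1 : ∀ v, B X (M.vec v) = B (M.vec (M.prP X)) (M.vec v) := fun v => by
      conv_lhs => rw [M.eq_incl_add_vec X]
      rw [map_add, LinearMap.add_apply, h.symm (M.incl _), h.vec_incl, zero_add]
    have h2 : ∀ W, B X (M.incl W) = B (M.incl (M.prK X)) (M.incl W) := fun W => by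
      conv_lhs => rw [M.eq_incl_add_vec X]
      rw [map_add, LinearMap.add_apply, h.vec_incl, add_zero]
    simp only [h1, h2, h.on_p, A.symm_apply_apply, ← S.skew]
    conv_lhs => rw [M.eq_incl_add_vec X, add_comm]
    congr 1
    · have h3 : M.vecL (∑ a, S.Ω (e a) (M.prP X) • S.dualBasis e a) =
        ∑ a, S.Ω (e a) (M.prP X) • M.vecL (S.dualBasis e a) := by simp
      rw [sum_Ω_basis] at h3
      exact h3
    · conv_lhs => rw [h.sum_invGram_k w (M.prK X)]
      simp only [map_sum, map_smul, Finset.smul_sum, smul_smul]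
      refine Finset.sum_congr rfl fun r _ => Finset.sum_congr rfl fun s _ => ?_
      rw [mul_comm]

end IsExtension
end SymplecticSymmetricSpace
end Casimir
end MpcDirac

/-! ### The Gaussian measure and the mean value property. -/

namespace MpcDirac
namespace FockModel

noncomputable section

variable {V : Type*} [NormedAddCommGroup V] [NormedSpace ℝ V] (S : FockModel V)

theorem Ω_j_left (v w : V) : S.Ω (S.j v) w = -S.Ω v (S.j w) := by
  rw [S.skew, ← S.metric_symm]

theorem sqNorm_cplxAction [FiniteDimensional ℝ V] (c : ℂ) (v : V) : S.sqNorm (S.cplxAction c v) = ‖c‖ ^ 2 * S.sqNorm v := by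
  have h1 : S.Ω v (S.j v) = S.sqNorm v := rfl
  rw [← Complex.normSq_eq_norm_sq, Complex.normSq_apply, cplxAction_apply]
  simp only [sqNorm, map_add, map_smul, LinearMap.add_apply, LinearMap.smul_apply, smul_eq_mul,
    S.j_symp, S.j_sq, S.alt, S.Ω_j_left, map_neg]
  ring

variable [FiniteDimensional ℝ V]

theorem isFiniteMeasure_gaussian : IsFiniteMeasure S.gaussian := by
  letI : MeasurableSpace V := borel V
  have h : MemLp (fun _ => 1 : V → ℂ) 2 S.gaussian := S.one_mem_fock.2
  rw [memLp_const_iff (by norm_num) (by norm_num)] at h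
  exact ⟨h.resolve_left one_ne_zero⟩

/-- The total mass of the Gaussian measure. -/
def mass : ℝ := S.gaussian.real Set.univ

/-- Only finiteness and positivity of the total mass are ever used. It appears as an unspecified
constant that cancels, so the Gaussian integral need not be computed. -/
theorem mass_pos : 0 < S.mass := by
  letI : MeasurableSpace V := borel V
  haveI : BorelSpace V := ⟨rfl⟩
  haveI := S.isOpenPos_gaussian
  haveI := S.isFiniteMeasure_gaussian
  have h := (isOpen_univ (X := V)).measure_pos S.gaussian Set.univ_nonempty
  exact ENNReal.toReal_pos h.ne' (measure_ne_top _ _)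

/-- The image of Lebesgue measure is a constant multiple of it and the density is invariant, so the
image of the Gaussian measure is a multiple of itself. Comparing the finite non-zero total masses
shows that the constant is 1, without computing the determinant. -/
theorem measurePreserving_gaussian (R : V ≃ₗ[ℝ] V) (hR : ∀ v, S.sqNorm (R v) = S.sqNorm v) :
    letI : MeasurableSpace V := borel V
    MeasurePreserving R S.gaussian S.gaussian := by
  letI : MeasurableSpace V := borel V
  haveI : BorelSpace V := ⟨rfl⟩
  haveI := S.isAddHaar_vol
  haveI := S.isOpenPos_gaussian
  haveI := S.isFiniteMeasure_gaussian
  have hcont := S.continuous_sqNorm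
  have hmeas : Measurable R := R.toContinuousLinearEquiv.continuous.measurable
  have hw : Measurable fun z => ENNReal.ofReal (((2 * Real.pi * S.hbar) ^
      (Module.finrank ℝ V / 2))⁻¹ * Real.exp (-S.sqNorm z / (2 * S.hbar))) :=
    Measurable.ennreal_ofReal (Continuous.measurable (by fun_prop))
  have hdet : LinearMap.det (R : V →ₗ[ℝ] V) ≠ 0 := R.isUnit_det'.ne_zero
  obtain ⟨c, hc⟩ : ∃ c : ENNReal, S.gaussian.map R = c • S.gaussian := by
    refine ⟨ENNReal.ofReal |(LinearMap.det (R : V →ₗ[ℝ] V))⁻¹|, ?_⟩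
    have hmap : S.vol.map R = ENNReal.ofReal |(LinearMap.det (R : V →ₗ[ℝ] V))⁻¹| • S.vol :=
      Measure.map_linearMap_addHaar_eq_smul_addHaar S.vol hdet
    ext s hs
    rw [Measure.map_apply hmeas hs, Measure.smul_apply, gaussian,
      withDensity_apply _ (hmeas hs), withDensity_apply _ hs,
      ← lintegral_smul_measure, ← Measure.restrict_smul, ← hmap,
      setLIntegral_map hs hw hmeas]
    simp only [hR]
  have h1 := congrArg (fun μ => μ Set.univ) hc
  simp only [Measure.map_apply hmeas MeasurableSet.univ, Set.preimage_univ, Measure.smul_apply,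
    smul_eq_mul] at h1
  have h0 : S.gaussian Set.univ ≠ 0 :=
    ((isOpen_univ (X := V)).measure_pos S.gaussian Set.univ_nonempty).ne'
  have hc1 : c = 1 := by
    have := ENNReal.mul_left_inj (a := c) (b := 1) h0 (measure_ne_top S.gaussian _)
    rw [one_mul] at this
    exact this.1 h1.symm
  exact ⟨hmeas, by rw [hc, hc1, one_smul]⟩

variable {S}

theorem IsHolo.fderiv_cplxAction {f : V → ℂ} (hf : S.IsHolo f) (z : V) (c : ℂ) (v : V) :
    fderiv ℝ f z (S.cplxAction c v) = c * fderiv ℝ f z v := by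
  rw [cplxAction_apply, map_add, map_smul, map_smul, hf.2]
  conv_rhs => rw [← Complex.re_add_im c]
  simp only [Complex.real_smul]
  ring

theorem IsHolo.differentiable_line {f : V → ℂ} (hf : S.IsHolo f) (v : V) :
    Differentiable ℂ fun c : ℂ => f (S.cplxAction c v) := by
  intro c
  set L : ℂ →L[ℝ] V := LinearMap.toContinuousLinearMap (S.cplxAction.toLinearMap.flip v)
  have h1 : HasFDerivAt (fun c : ℂ => f (L c)) ((fderiv ℝ f (L c)).comp L) c :=
    (hf.1 (L c)).hasFDerivAt.comp c L.hasFDerivAt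
  have h2 := hasFDerivAt_of_restrictScalars (𝕜 := ℝ) (𝕜' := ℂ) (E := ℂ) (F := ℂ) (f := fun c : ℂ => f (L c)) (x := c) (f' :=
    (ContinuousLinearMap.toSpanSingleton ℂ (fderiv ℝ f (L c) v))) h1 ?_
  · exact h2.differentiableAt
  · ext d
    exact (hf.fderiv_cplxAction (L c) d v).symm

theorem IsHolo.integral_circle {f : V → ℂ} (hf : S.IsHolo f) (v : V) :
    ∫ θ in (0 : ℝ)..2 * Real.pi, f (S.cplxAction (circleMap 0 1 θ) v) = (2 * Real.pi : ℂ) * f 0 := by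
  have h := circleAverage_of_differentiable_on_off_countable (c := 0) (R := 1)
    (f := fun c : ℂ => f (S.cplxAction c v)) Set.countable_empty
    (hf.differentiable_line v).continuous.continuousOn
    fun z _ => hf.differentiable_line v z
  rw [Real.circleAverage_def] at h
  have h2 : f (S.cplxAction 0 v) = f 0 := by simp
  rw [h2] at h
  rw [← h, Complex.real_smul, ← mul_assoc]
  have : (Real.pi : ℂ) ≠ 0 := by exact_mod_cast Real.pi_ne_zero
  push_cast
  field_simp

/-- The measure is invariant under multiplication by unit complex numbers. Averaging over the circle
and exchanging the integrals replaces `f v` by its mean over the circle through `v` in the complex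
line of `v`, which is `f 0`. -/
theorem IsHolo.integral_gaussian {f : V → ℂ} (hf : S.IsHolo f)
    (hint : Integrable f S.gaussian) : ∫ v, f v ∂S.gaussian = S.mass * f 0 := by
  letI : MeasurableSpace V := borel V
  haveI : BorelSpace V := ⟨rfl⟩
  haveI := S.isFiniteMeasure_gaussian
  have hu : ∀ θ : ℝ, S.cplxAction (circleMap 0 1 θ)⁻¹ * S.cplxAction (circleMap 0 1 θ) = 1 := by
    intro θ
    rw [← map_mul, inv_mul_cancel₀ (circleMap_ne_center one_ne_zero), map_one]
  have hu' : ∀ θ : ℝ, S.cplxAction (circleMap 0 1 θ) * S.cplxAction (circleMap 0 1 θ)⁻¹ = 1 := by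
    intro θ
    rw [← map_mul, mul_inv_cancel₀ (circleMap_ne_center one_ne_zero), map_one]
  have hmp : ∀ θ : ℝ, MeasurePreserving (S.cplxAction (circleMap 0 1 θ)) S.gaussian S.gaussian :=
    fun θ => S.measurePreserving_gaussian (LinearEquiv.ofLinear (S.cplxAction (circleMap 0 1 θ))
      (S.cplxAction (circleMap 0 1 θ)⁻¹) (hu' θ) (hu θ)) fun v => by
        simp [sqNorm_cplxAction]
  have hemb : ∀ θ : ℝ, MeasurableEmbedding (S.cplxAction (circleMap 0 1 θ)) := fun θ =>
    (LinearEquiv.ofLinear (S.cplxAction (circleMap 0 1 θ)) (S.cplxAction (circleMap 0 1 θ)⁻¹)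
      (hu' θ) (hu θ)).toContinuousLinearEquiv.toHomeomorph.measurableEmbedding
  have h1 : ∀ θ : ℝ, ∫ v, f (S.cplxAction (circleMap 0 1 θ) v) ∂S.gaussian
      = ∫ v, f v ∂S.gaussian := fun θ => (hmp θ).integral_comp (hemb θ) f
  have h2 : ∀ θ : ℝ, ∫ v, ‖f (S.cplxAction (circleMap 0 1 θ) v)‖ ∂S.gaussian
      = ∫ v, ‖f v‖ ∂S.gaussian := fun θ => (hmp θ).integral_comp (hemb θ) fun v => ‖f v‖
  have hcont : Continuous fun q : ℝ × V => f (S.cplxAction (circleMap 0 1 q.1) q.2) := by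
    refine hf.1.continuous.comp ?_
    simp only [cplxAction_apply]
    have hj : Continuous S.j := S.j.continuous_of_finiteDimensional
    have := continuous_circleMap 0 1
    fun_prop
  have hprod : Integrable (fun q : ℝ × V => f (S.cplxAction (circleMap 0 1 q.1) q.2))
      ((volume.restrict (Set.uIoc 0 (2 * Real.pi))).prod S.gaussian) := by
    refine (integrable_prod_iff hcont.aestronglyMeasurable).2
      ⟨Filter.Eventually.of_forall fun θ => (hmp θ).integrable_comp_of_integrable hint, ?_⟩
    simp only [h2]
    rw [Set.uIoc_of_le (by positivity)]
    exact integrable_const _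
  have h3 := intervalIntegral_integral_swap (a := 0) (b := 2 * Real.pi) (μ := S.gaussian)
    (f := fun (θ : ℝ) (v : V) => f (S.cplxAction (circleMap 0 1 θ) v)) hprod
  simp only [h1, hf.integral_circle, intervalIntegral.integral_const, integral_const] at h3
  have hpi : (Real.pi : ℂ) ≠ 0 := by exact_mod_cast Real.pi_ne_zero
  simp only [sub_zero, Complex.real_smul] at h3
  push_cast at h3
  have h4 : (2 * Real.pi : ℂ) * ∫ v, f v ∂S.gaussian = (2 * Real.pi : ℂ) * (S.mass * f 0) := by
    rw [h3, mass]; ring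
  exact mul_left_cancel₀ (mul_ne_zero two_ne_zero hpi) h4

end

end FockModel
end MpcDirac

/-! ### Coherent states, the reproducing property, weak convergence. -/

namespace MpcDirac
namespace FockModel

noncomputable section

open Filter Topology

variable {V : Type*} [NormedAddCommGroup V] [NormedSpace ℝ V] [FiniteDimensional ℝ V]
  (S : FockModel V)

instance : InnerProductSpace ℂ S.Fock :=
  letI : MeasurableSpace V := borel V
  { (inferInstance : NormedSpace ℂ S.Fock) with
    inner := fun f g => inner ℂ (S.toL2 f) (S.toL2 g)
    norm_sq_eq_re_inner := fun f => norm_sq_eq_re_inner (𝕜 := ℂ) (S.toL2 f)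
    conj_inner_symm := fun f g => inner_conj_symm _ _
    add_left := fun f g h => by rw [map_add, inner_add_left]
    smul_left := fun f g r => by rw [map_smul, inner_smul_left] }

theorem inner_toL2 (f g : S.Fock) : inner ℂ f g = inner ℂ (S.toL2 f) (S.toL2 g) := rfl

theorem norm_toL2 (f : S.Fock) : ‖S.toL2 f‖ = ‖f‖ := rfl

theorem isometry_toL2 : Isometry S.toL2 :=
  AddMonoidHomClass.isometry_of_norm S.toL2 S.norm_toL2

/-- The vacuum is the constant function 1, so this scalar product is the Gaussian mean of `f`. All
reproducing formulas below follow from this one by translation. -/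
theorem inner_vac (f : S.Fock) : inner ℂ S.vac f = S.mass * f 0 := by
  letI : MeasurableSpace V := borel V
  haveI := S.isFiniteMeasure_gaussian
  rw [← (Fock.isHolo f).integral_gaussian ((Fock.memLp f).integrable one_le_two), inner_toL2,
    L2.inner_def]
  refine integral_congr_ae ?_
  filter_upwards [(Fock.memLp f).coeFn_toLp, (Fock.memLp S.vac).coeFn_toLp] with z h1 h2
  have h3 : S.toL2 f z = f z := h1
  have h4 : S.toL2 S.vac z = 1 := h2
  rw [h3, h4]
  simp

theorem heis_heis_neg (z : V) (f : S.Fock) : S.heis (z, 0) (S.heis (-z, 0) f) = f := by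
  rw [heis_heis]
  have : S.heisMul (z, 0) (-z, 0) = 0 := by simp [heisMul, S.alt]
  rw [this, heis_zero]

/-- The coherent states, translates of the vacuum. -/
def coh (z : V) : S.Fock := S.heis (z, 0) S.vac

theorem coh_apply (z q : V) : S.coh z q =
    Complex.exp (S.herm q z / (2 * S.hbar) - (S.sqNorm z : ℂ) / (4 * S.hbar)) := by
  rw [coh, heis_apply, heisFun]
  simp [show ∀ x, S.vac x = 1 from fun _ => rfl]

theorem heis_neg_apply_zero (z : V) (f : S.Fock) : S.heis (-z, 0) f 0 =
    Complex.exp (-((S.sqNorm z : ℂ) / (4 * S.hbar))) * f z := by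
  rw [heis_apply, heisFun]
  simp [herm, sqNorm]

theorem inner_coh (z : V) (f : S.Fock) : inner ℂ (S.coh z) f =
    S.mass * Complex.exp (-((S.sqNorm z : ℂ) / (4 * S.hbar))) * f z := by
  conv_lhs => rw [← S.heis_heis_neg z f, coh, LinearIsometry.inner_map_map]
  rw [inner_vac, heis_neg_apply_zero, mul_assoc]

theorem mass_ne_zero : (S.mass : ℂ) ≠ 0 := by exact_mod_cast S.mass_pos.ne'

/-- Evaluation at a point is continuous on the Fock space. -/
def evalL (z : V) : S.Fock →L[ℂ] ℂ :=
  ((S.mass : ℂ) * Complex.exp (-((S.sqNorm z : ℂ) / (4 * S.hbar))))⁻¹ • innerSL ℂ (S.coh z)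

theorem evalL_apply (z : V) (f : S.Fock) : S.evalL z f = f z := by
  rw [evalL, smul_apply, innerSL_apply_apply, inner_coh, smul_eq_mul,
    inv_mul_cancel_left₀ (mul_ne_zero S.mass_ne_zero (Complex.exp_ne_zero _))]

/-- The closure is taken in `L²`, so completeness of the Fock space is not needed. If holomorphic
functions converge to `x` in `L²`, their scalar products with coherent states force pointwise
convergence to 0 everywhere, while a subsequence converges to `x` almost everywhere. -/
theorem eq_zero_of_mem_closure (x : Lp ℂ 2 S.gaussian)
    (hx : x ∈ closure (Set.range S.toL2)) (h0 : ∀ z, inner ℂ (S.toL2 (S.coh z)) x = 0) :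
    x = 0 := by
  letI : MeasurableSpace V := borel V
  obtain ⟨y, hy, hyx⟩ := mem_closure_iff_seq_limit.1 hx
  choose f hf using hy
  obtain ⟨ns, hns, hae⟩ := (tendstoInMeasure_of_tendsto_Lp hyx).exists_seq_tendsto_ae
  have hp : ∀ z, Tendsto (fun n => f n z) atTop (𝓝 0) := by
    intro z
    have h1 : Tendsto (fun n => inner ℂ (S.toL2 (S.coh z)) (y n)) atTop (𝓝 0) := by
      rw [← h0 z]
      exact tendsto_const_nhds.inner hyx
    have h2 := h1.const_mul
      ((S.mass : ℂ) * Complex.exp (-((S.sqNorm z : ℂ) / (4 * S.hbar))))⁻¹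
    rw [mul_zero] at h2
    refine h2.congr fun n => ?_
    rw [← S.evalL_apply, ← hf n]
    rfl
  have hall : ∀ᵐ z ∂S.gaussian, ∀ n, y n z = f n z :=
    ae_all_iff.2 fun n => by
      rw [← hf n]
      exact (Fock.memLp (f n)).coeFn_toLp
  refine Lp.ext ?_
  filter_upwards [hae, hall, Lp.coeFn_zero ℂ 2 S.gaussian] with z h1 h2 h3
  rw [h3]
  refine tendsto_nhds_unique h1 ?_
  simp only [h2]
  exact (hp z).comp hns.tendsto_atTop

/-- The orthogonal projection is made in `L²` onto the closed span of the coherent states. The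
remainder lies in the closure of the Fock space and is orthogonal to every coherent state, hence
zero. -/
theorem dense_span_coh : Dense (Submodule.span ℂ (Set.range S.coh) : Set S.Fock) := by
  letI : MeasurableSpace V := borel V
  intro f
  set W : Submodule ℂ (Lp ℂ 2 S.gaussian) := (Submodule.span ℂ (Set.range S.coh)).map S.toL2
  haveI : CompleteSpace W.topologicalClosure :=
    W.isClosed_topologicalClosure.completeSpace_coe
  have hW : (W : Set (Lp ℂ 2 S.gaussian)) ⊆ Set.range S.toL2 := by
    rintro _ ⟨g, -, rfl⟩
    exact ⟨g, rfl⟩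
  set y := W.topologicalClosure.starProjection (S.toL2 f)
  have hy : y ∈ W.topologicalClosure := Submodule.starProjection_apply_mem _ _
  have horth : S.toL2 f - y ∈ W.topologicalClosureᗮ := Submodule.sub_starProjection_mem_orthogonal _
  have hcl : S.toL2 f - y ∈ (LinearMap.range S.toL2).topologicalClosure := by
    refine Submodule.sub_mem _ (subset_closure ⟨f, rfl⟩) ?_
    exact closure_mono hW hy
  have h0 := S.eq_zero_of_mem_closure (S.toL2 f - y) hcl fun z =>
    horth _ (subset_closure ⟨S.coh z, Submodule.subset_span ⟨z, rfl⟩, rfl⟩)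
  rw [(Isometry.isUniformInducing S.isometry_toL2).isInducing.closure_eq_preimage_closure_image, Set.mem_preimage,
    sub_eq_zero.1 h0]
  exact hy

/-- Pointwise convergence is convergence against coherent states. Their span is dense, so a norm
bound upgrades it to weak convergence. Difference quotients whose norm convergence is not known are
treated in this way. -/
theorem tendsto_inner_of_bounded {ι : Type*} {l : Filter ι} (u : ι → S.Fock) (w : S.Fock) (C : ℝ)
    (hb : ∀ᶠ t in l, ‖u t‖ ≤ C) (hp : ∀ z, Tendsto (fun t => u t z) l (𝓝 (w z))) (f : S.Fock) :
    Tendsto (fun t => inner ℂ (u t) f) l (𝓝 (inner ℂ w f)) := by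
  have hspan : ∀ g ∈ Submodule.span ℂ (Set.range S.coh),
      Tendsto (fun t => inner ℂ (u t) g) l (𝓝 (inner ℂ w g)) := by
    intro g hg
    induction hg using Submodule.span_induction with
    | mem x hx =>
      obtain ⟨z, rfl⟩ := hx
      have h1 : Tendsto (fun t => inner ℂ (S.coh z) (u t)) l (𝓝 (inner ℂ (S.coh z) w)) := by
        simp only [inner_coh]
        exact (hp z).const_mul _
      have h2 := (Complex.continuous_conj.tendsto _).comp h1
      simpa only [Function.comp_def, inner_conj_symm] using h2
    | zero => simpa only [inner_zero_right] using tendsto_const_nhds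
    | add x y _ _ hx hy => simpa only [inner_add_right] using hx.add hy
    | smul c x _ hx => simpa only [inner_smul_right] using hx.const_mul c
  rw [Metric.tendsto_nhds]
  intro ε hε
  set M : ℝ := |C| + ‖w‖ + 1 with hM
  have hMpos : 0 < M := by positivity
  obtain ⟨g, hg, hgf⟩ := (Metric.dense_iff.1 S.dense_span_coh) f (ε / (2 * M)) (by positivity)
  rw [Metric.mem_ball, dist_eq_norm] at hg
  filter_upwards [hb, (Metric.tendsto_nhds.1 (hspan g hgf)) (ε / 2) (half_pos hε)] with t h1 h2
  have e : inner ℂ (u t) f - inner ℂ w f =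
      (inner ℂ (u t) g - inner ℂ w g) - inner ℂ (u t - w) (g - f) := by
    simp only [inner_sub_left, inner_sub_right]
    ring
  rw [dist_eq_norm] at h2 ⊢
  have h3 : ‖inner ℂ (u t - w) (g - f)‖ ≤ M * (ε / (2 * M)) := by
    refine (norm_inner_le_norm _ _).trans (mul_le_mul ?_ hg.le (norm_nonneg _) hMpos.le)
    refine (norm_sub_le _ _).trans ?_
    have := le_abs_self C
    linarith
  have h4 : M * (ε / (2 * M)) = ε / 2 := by field_simp
  rw [e]
  refine (norm_sub_le _ _).trans_lt ?_
  linarith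

end

end FockModel
end MpcDirac

/-! ### Representing vectors for first derivatives at the origin. -/

namespace MpcDirac
namespace FockModel

noncomputable section

open Filter Topology

variable {V : Type*} [NormedAddCommGroup V] [NormedSpace ℝ V]
  (S : FockModel V)

theorem hbar_ne_zero : (S.hbar : ℂ) ≠ 0 := by exact_mod_cast S.hbar_pos.ne'

theorem herm_self (x : V) : S.herm x x = S.sqNorm x := by simp [herm, S.alt, sqNorm]

theorem herm_smul_left (r : ℝ) (v w : V) : S.herm (r • v) w = r * S.herm v w := by
  simp [herm]; ring

theorem herm_smul_right (r : ℝ) (v w : V) : S.herm v (r • w) = r * S.herm v w := by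
  simp [herm]; ring

theorem herm_j_right (v w : V) : S.herm v (S.j w) = -Complex.I * S.herm v w := by
  simp only [herm, S.j_sq, map_neg]
  push_cast
  linear_combination (-(S.Ω v w : ℂ)) * Complex.I_sq

theorem sqNorm_smul (r : ℝ) (v : V) : S.sqNorm (r • v) = r ^ 2 * S.sqNorm v := by
  simp only [sqNorm, map_smul, LinearMap.smul_apply, smul_eq_mul]; ring

theorem herm_neg_right (v w : V) : S.herm v (-w) = -S.herm v w := by
  simp [herm]; ring

theorem sqNorm_nonneg (v : V) : 0 ≤ S.sqNorm v := by
  rcases eq_or_ne v 0 with rfl | h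
  · simp [sqNorm]
  · exact (S.j_pos v h).le

variable [FiniteDimensional ℝ V]

/-- Linear and quadratic functions are dominated by exponentials, and the exponentials of `±a` and
`±ia` are multiples of coherent states, hence square integrable. No Gaussian moments are computed.
-/
theorem mem_fock_of_le {P : V → ℂ} (hP : S.IsHolo P) (x : V)
    (hle : ∀ q, ‖P q‖ ≤ ‖S.herm q x / (2 * S.hbar)‖ ∨
      ‖P q‖ ≤ ‖(S.herm q x / (2 * S.hbar)) ^ 2‖) : P ∈ S.fockSubmodule := by
  letI : MeasurableSpace V := borel V
  haveI : BorelSpace V := ⟨rfl⟩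
  refine ⟨hP, ?_⟩
  have hm : ∀ y : V, MemLp (fun q => ‖Complex.exp (S.herm q y / (2 * S.hbar))‖) 2 S.gaussian := by
    intro y
    have h := (Fock.memLp (Complex.exp ((S.sqNorm y : ℂ) / (4 * S.hbar)) • S.coh y)).norm
    refine h.congr_norm ?_ (Eventually.of_forall fun q => ?_)
    · have h1 : Continuous fun q => S.herm q y := (S.hermL y).continuous
      exact Continuous.aestronglyMeasurable (by fun_prop)
    · rw [Fock.smul_apply, coh_apply, ← Complex.exp_add]
      congr 3
      ring
  refine MemLp.mono' (((((hm x).add (hm (-x))).add (hm (S.j x))).add (hm (-S.j x))).const_mul 2)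
    hP.1.continuous.aestronglyMeasurable (Eventually.of_forall fun q => ?_)
  set a : ℂ := S.herm q x / (2 * S.hbar) with ha
  have e1 : S.herm q (-x) / (2 * S.hbar) = -a := by rw [herm_neg_right, ha]; ring
  have e2 : S.herm q (S.j x) / (2 * S.hbar) = -Complex.I * a := by rw [herm_j_right, ha]; ring
  have e3 : S.herm q (-S.j x) / (2 * S.hbar) = Complex.I * a := by
    rw [herm_neg_right, herm_j_right, ha]; ring
  simp only [Pi.add_apply, e1, e2, e3, ← ha, Complex.norm_exp]
  simp only [Complex.neg_re, Complex.mul_re, Complex.neg_im, Complex.I_re, Complex.I_im, neg_zero,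
    zero_mul, one_mul, zero_sub, neg_mul, neg_neg]
  -- Applied to the real and imaginary parts of `a`. The factor 2 in the majorant compensates the
  -- `1/2` in front of the square, as `|a²|` is the sum of the two squares.
  have hr : ∀ r : ℝ, 1 + |r| + |r| ^ 2 / 2 ≤ Real.exp r + Real.exp (-r) := by
    intro r
    have h1 := Real.quadratic_le_exp_of_nonneg (abs_nonneg r)
    rcases abs_cases r with ⟨h, -⟩ | ⟨h, -⟩ <;> rw [h] at h1 ⊢
    · linarith [Real.exp_pos (-r)]
    · linarith [Real.exp_pos r]
  have hr1 := hr a.re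
  have hr2 := hr a.im
  have h4 : ‖a‖ ≤ |a.re| + |a.im| := Complex.norm_le_abs_re_add_abs_im a
  have h5 : ‖a ^ 2‖ = |a.re| ^ 2 + |a.im| ^ 2 := by
    rw [norm_pow, ← Complex.normSq_eq_norm_sq, Complex.normSq_apply, sq_abs, sq_abs]; ring
  have := abs_nonneg a.re
  have := abs_nonneg a.im
  have := sq_nonneg |a.re|
  have := sq_nonneg |a.im|
  rcases hle q with h | h <;> rw [← ha] at h
  · linarith
  · linarith

theorem isHolo_herm (x : V) : S.IsHolo fun q => S.herm q x / (2 * S.hbar) := by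
  have hd : ∀ q, HasFDerivAt (fun q => S.herm q x / (2 * S.hbar))
      ((2 * S.hbar : ℂ)⁻¹ • S.hermL x) q := by
    intro q
    simp only [div_eq_mul_inv]
    exact (S.hermL x).hasFDerivAt.mul_const _
  refine ⟨fun q => (hd q).differentiableAt, fun q v => ?_⟩
  rw [(hd q).fderiv]
  simp only [smul_apply, hermL_apply, herm_j_left, smul_eq_mul]
  ring

variable {S} in
theorem IsHolo.mul {f g : V → ℂ} (hf : S.IsHolo f) (hg : S.IsHolo g) :
    S.IsHolo fun q => f q * g q := by
  refine ⟨hf.1.mul hg.1, fun q v => ?_⟩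
  rw [fderiv_fun_mul (hf.1 q) (hg.1 q)]
  simp only [add_apply, smul_apply, hf.2, hg.2, smul_eq_mul]
  ring

/-- The linear function `⟨·, x⟩ / 2ħ`, as an element of the Fock space. -/
def ell (x : V) : S.Fock := ⟨fun q => S.herm q x / (2 * S.hbar),
  S.mem_fock_of_le (S.isHolo_herm x) x fun _ => Or.inl le_rfl⟩

/-- The square of `⟨·, x⟩ / 2ħ`, as an element of the Fock space. -/
def ellSq (x : V) : S.Fock :=
  ⟨fun q => S.herm q x / (2 * S.hbar) * (S.herm q x / (2 * S.hbar)),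
  S.mem_fock_of_le ((S.isHolo_herm x).mul (S.isHolo_herm x)) x fun _ => Or.inr (by rw [sq])⟩

theorem ell_apply (x q : V) : S.ell x q = S.herm q x / (2 * S.hbar) := rfl

theorem ellSq_apply (x q : V) :
    S.ellSq x q = S.herm q x / (2 * S.hbar) * (S.herm q x / (2 * S.hbar)) := rfl

/-- The reproducing kernel `exp(⟨·, y⟩ / 2ħ)`. -/
def expv (y : V) : S.Fock := Complex.exp ((S.sqNorm y : ℂ) / (4 * S.hbar)) • S.coh y

theorem expv_apply (y q : V) : S.expv y q = Complex.exp (S.herm q y / (2 * S.hbar)) := by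
  rw [expv, Fock.smul_apply, coh_apply, ← Complex.exp_add]
  congr 1
  ring

theorem inner_expv (y : V) (f : S.Fock) : inner ℂ (S.expv y) f = S.mass * f y := by
  rw [expv, inner_smul_left, inner_coh, ← Complex.exp_conj]
  have : (starRingEnd ℂ) ((S.sqNorm y : ℂ) / (4 * S.hbar)) = (S.sqNorm y : ℂ) / (4 * S.hbar) := by
    have h : (S.sqNorm y : ℂ) / (4 * S.hbar) = ((S.sqNorm y / (4 * S.hbar) : ℝ) : ℂ) := by
      push_cast; rfl
    rw [h, Complex.conj_ofReal]
  rw [this]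
  calc _ = S.mass * (Complex.exp ((S.sqNorm y : ℂ) / (4 * S.hbar)) *
        Complex.exp (-((S.sqNorm y : ℂ) / (4 * S.hbar)))) * f y := by ring
    _ = _ := by rw [← Complex.exp_add]; simp

theorem inner_expv_smul (x : V) (s r : ℝ) : inner ℂ (S.expv (s • x)) (S.expv (r • x)) =
    ((S.mass * Real.exp (s * r * (S.sqNorm x / (2 * S.hbar))) : ℝ) : ℂ) := by
  rw [inner_expv, expv_apply, herm_smul_left, herm_smul_right, herm_self]
  push_cast
  congr 2
  ring

theorem hasDerivAt_cexp_smul (a : ℂ) :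
    HasDerivAt (fun s : ℝ => Complex.exp (s * a)) a 0 := by
  have h1 : HasDerivAt (fun s : ℝ => (s : ℂ) * a) (1 * a) 0 :=
    (Complex.ofRealCLM.hasDerivAt (x := 0)).mul_const a
  simpa using h1.cexp

variable {S} in
theorem IsHolo.hasDerivAt_line {f : V → ℂ} (hf : S.IsHolo f) (z x : V) (t : ℝ) :
    HasDerivAt (fun s : ℝ => f (z + s • x)) (fderiv ℝ f (z + t • x) x) t := by
  have h1 : HasDerivAt (fun s : ℝ => z + s • x) x t := by
    simpa using ((hasDerivAt_id t).smul_const x).const_add z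
  exact (hf.1 (z + t • x)).hasFDerivAt.comp_hasDerivAt t h1

/-- `ell x` is the derivative at `s = 0` of the reproducing kernels `expv (s • x)`, whose scalar
product with `f` is proportional to `f (s x)`. The difference quotients converge pointwise and are
bounded, so the limit may be taken weakly. -/
theorem inner_ell (x : V) (f : S.Fock) : inner ℂ (S.ell x) f = S.mass * fderiv ℝ f 0 x := by
  set β : ℝ := S.sqNorm x / (2 * S.hbar) with hβ
  have hβ0 : 0 ≤ β := div_nonneg (S.sqNorm_nonneg x) (by linarith [S.hbar_pos])
  have hnorm : ∀ s : ℝ, ‖S.expv (s • x) - S.expv ((0 : ℝ) • x)‖ ^ 2 =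
      S.mass * (Real.exp (s * s * β) - 1) := by
    intro s
    have h := inner_self_eq_norm_sq_to_K (𝕜 := ℂ) (S.expv (s • x) - S.expv ((0 : ℝ) • x))
    simp only [inner_sub_left, inner_sub_right, inner_expv_smul, ← hβ] at h
    have h2 : ((‖S.expv (s • x) - S.expv ((0 : ℝ) • x)‖ : ℂ)) ^ 2 =
      ((S.mass * (Real.exp (s * s * β) - 1) : ℝ) : ℂ) := by
      refine h.symm.trans ?_
      simp only [mul_zero, zero_mul, Real.exp_zero]
      push_cast
      ring
    exact_mod_cast h2
  have hlim := S.tendsto_inner_of_bounded (l := 𝓝[≠] (0 : ℝ))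
    (fun s : ℝ => (s : ℂ)⁻¹ • (S.expv (s • x) - S.expv ((0 : ℝ) • x))) (S.ell x)
    (Real.sqrt (S.mass * (β * Real.exp β))) ?_ ?_ f
  · have h1 := ((Fock.isHolo f).hasDerivAt_line 0 x 0).tendsto_slope.const_mul (S.mass : ℂ)
    rw [zero_smul, add_zero] at h1
    refine tendsto_nhds_unique hlim (h1.congr fun s => ?_)
    rw [inner_smul_left, inner_sub_left, inner_expv, inner_expv, slope_def_module]
    simp only [zero_add, zero_smul, sub_zero, map_inv₀, Complex.conj_ofReal, Complex.real_smul]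
    push_cast
    ring
  · have h1 : ∀ᶠ s : ℝ in 𝓝[≠] 0, s ∈ Set.Ioo (-1 : ℝ) 1 :=
      mem_nhdsWithin_of_mem_nhds (Ioo_mem_nhds (by norm_num) (by norm_num))
    filter_upwards [h1, self_mem_nhdsWithin] with s hs hs0
    refine Real.le_sqrt_of_sq_le ?_
    rw [norm_smul, mul_pow, hnorm, norm_inv, Complex.norm_real, inv_pow, Real.norm_eq_abs, sq_abs]
    have hs2 : s ^ 2 ≠ 0 := pow_ne_zero _ hs0
    have hs3 : 0 < s ^ 2 := by positivity
    have hs4 : s ^ 2 ≤ 1 := by nlinarith [hs.1, hs.2]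
    -- From `e^A - 1 ≤ A e^A` with `A = s²β ≤ β`; this is where the bound `mass * (β e^β)` comes
    -- from.
    have h3 : Real.exp (s * s * β) - 1 ≤ s ^ 2 * (β * Real.exp β) := by
      have h4 := Real.add_one_le_exp (-(s * s * β))
      have h5 : Real.exp (-(s * s * β)) * Real.exp (s * s * β) = 1 := by
        rw [← Real.exp_add]; simp
      have h6 : Real.exp (s * s * β) ≤ Real.exp β := Real.exp_le_exp.2 (by nlinarith)
      have h7 := mul_le_mul_of_nonneg_right h4 (Real.exp_pos (s * s * β)).le
      rw [h5] at h7
      have h8 : 0 ≤ s ^ 2 * β := by positivity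
      nlinarith [mul_le_mul_of_nonneg_left h6 h8]
    rw [inv_mul_le_iff₀ hs3]
    have := mul_le_mul_of_nonneg_left h3 S.mass_pos.le
    linarith
  · intro z
    have h1 := (hasDerivAt_cexp_smul (S.herm z x / (2 * S.hbar))).tendsto_slope
    refine h1.congr fun s => ?_
    have h2 : (((s : ℂ)⁻¹ • (S.expv (s • x) - S.expv ((0 : ℝ) • x)) : S.Fock)) z =
      (s : ℂ)⁻¹ * (S.expv (s • x) z - S.expv ((0 : ℝ) • x) z) := rfl
    rw [h2, slope_def_module, expv_apply, expv_apply]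
    simp only [herm_smul_right, sub_zero, Complex.real_smul]
    push_cast
    congr 3 <;> ring_nf

end

end FockModel
end MpcDirac

/-! ### Second derivatives at the origin and commutation with the Heisenberg group. -/

namespace MpcDirac

open Filter Topology

/-- The first derivative need only be differentiable at 0 itself. The lemma is used for the
second-order reproducing vector and for the parameter `λ`. -/
theorem tendsto_second_difference {F : Type*} [NormedAddCommGroup F] [NormedSpace ℝ F]
    {φ φ' : ℝ → F} {d : F} (h : ∀ᶠ s in 𝓝 0, HasDerivAt φ (φ' s) s) (h' : HasDerivAt φ' d 0) :
    Tendsto (fun s : ℝ => (s ^ 2)⁻¹ • (φ s + φ (-s) - (2 : ℝ) • φ 0)) (𝓝[≠] 0) (𝓝 d) := by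
  have hneg : Tendsto (fun s : ℝ => -s) (𝓝 0) (𝓝 0) := by
    simpa using (continuous_neg.tendsto (0 : ℝ))
  have ho := (hasDerivAt_iff_isLittleO.1 h')
  rw [Metric.tendsto_nhds]
  intro ε hε
  have h1 := ho.def (show 0 < ε / 4 by positivity)
  have h2 := hneg.eventually h1
  have h3 := hneg.eventually h
  obtain ⟨δ, hδ, hball⟩ := Metric.eventually_nhds_iff.1 ((h1.and h2).and (h.and h3))
  have hmem : ∀ᶠ s : ℝ in 𝓝[≠] 0, dist s 0 < δ :=
    eventually_nhdsWithin_of_eventually_nhds (Metric.ball_mem_nhds 0 hδ)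
  filter_upwards [hmem, self_mem_nhdsWithin] with s hs hs0
  have hs0 : s ≠ 0 := hs0
  -- The error function. On `|r| ≤ |s|` its derivative is at most `ε/2 · |s|`, so the mean value
  -- inequality gives `‖ψ s‖ ≤ ε/2 · s²`.
  set ψ : ℝ → F := fun r => φ r + φ (-r) - (2 : ℝ) • φ 0 - r ^ 2 • d
  have hψ : ∀ r ∈ Metric.closedBall (0 : ℝ) |s|, HasDerivWithinAt ψ
      (φ' r + -φ' (-r) - (2 * r) • d) (Metric.closedBall (0 : ℝ) |s|) r := by
    intro r hr
    have hr' : dist r 0 < δ := lt_of_le_of_lt (by simpa using hr) hs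
    have k := hball hr'
    have k1 : HasDerivAt (fun r => φ (-r)) (-φ' (-r)) r := by
      simpa [Function.comp_def] using k.2.2.scomp r (hasDerivAt_neg r)
    have k2 : HasDerivAt (fun r : ℝ => r ^ 2 • d) ((2 * r) • d) r := by
      simpa using (hasDerivAt_pow 2 r).smul_const d
    exact (((k.2.1.add k1).sub_const _).sub k2).hasDerivWithinAt
  have hb : ∀ r ∈ Metric.closedBall (0 : ℝ) |s|,
      ‖φ' r + -φ' (-r) - (2 * r) • d‖ ≤ ε / 2 * |s| := by
    intro r hr
    have hrs : |r| ≤ |s| := by simpa using hr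
    have hr' : dist r 0 < δ := lt_of_le_of_lt (by simpa using hr) hs
    have k := (hball hr').1
    simp only [sub_zero, Real.norm_eq_abs, abs_neg] at k
    have e : φ' r + -φ' (-r) - (2 * r) • d =
        (φ' r - φ' 0 - r • d) - (φ' (-r) - φ' 0 - (-r) • d) := by module
    rw [e]
    refine (norm_sub_le _ _).trans ?_
    have := mul_le_mul_of_nonneg_left hrs hε.le
    linarith [k.1, k.2]
  have key := (convex_closedBall (0 : ℝ) |s|).norm_image_sub_le_of_norm_hasDerivWithin_le hψ hb
    (x := 0) (y := s) (by simp) (by simp)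
  have hψ0 : ψ 0 = 0 := by simp only [ψ]; simp [two_smul]
  rw [hψ0, sub_zero, sub_zero, Real.norm_eq_abs] at key
  have hs2 : 0 < s ^ 2 := by positivity
  have e : (s ^ 2)⁻¹ • (φ s + φ (-s) - (2 : ℝ) • φ 0) - d = (s ^ 2)⁻¹ • ψ s := by
    simp only [ψ]
    rw [smul_sub _ _ (s ^ 2 • d), smul_smul, inv_mul_cancel₀ hs2.ne', one_smul]
  rw [dist_eq_norm, e, norm_smul, norm_inv, Real.norm_eq_abs, abs_of_pos hs2, inv_mul_lt_iff₀ hs2]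
  have h5 : |s| * |s| = s ^ 2 := by rw [← sq, sq_abs]
  nlinarith

namespace FockModel

noncomputable section

variable {V : Type*} [NormedAddCommGroup V] [NormedSpace ℝ V] [FiniteDimensional ℝ V]
  (S : FockModel V)

variable {S} in
theorem IsHolo.hasDerivAt_heisFun {f : V → ℂ} (hf : S.IsHolo f) (x z : V) :
    HasDerivAt (fun t : ℝ => S.heisFun (t • x, 0) f z)
      (S.herm z x / (2 * S.hbar) * f z - fderiv ℝ f z x) 0 := by
  have h1 : HasDerivAt (fun t : ℝ => (t : ℂ) * (S.herm z x / (2 * S.hbar)) -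
      (t : ℂ) ^ 2 * ((S.sqNorm x : ℂ) / (4 * S.hbar))) (S.herm z x / (2 * S.hbar)) 0 := by
    have a1 : HasDerivAt (fun t : ℝ => (t : ℂ)) 1 0 := Complex.ofRealCLM.hasDerivAt (x := 0)
    have a2 := (a1.mul_const (S.herm z x / (2 * S.hbar))).sub
      ((a1.pow 2).mul_const ((S.sqNorm x : ℂ) / (4 * S.hbar)))
    exact a2.congr_deriv (by simp)
  have h2 := hf.hasDerivAt_line z (-x) 0
  have h3 := h1.cexp.mul h2
  simp only [Complex.ofReal_zero, zero_mul, zero_smul, add_zero, ne_eq, OfNat.ofNat_ne_zero,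
    not_false_eq_true, zero_pow, sub_zero, Complex.exp_zero, one_mul, map_neg, mul_one] at h3
  rw [sub_eq_add_neg]
  refine h3.congr_of_eventuallyEq (Eventually.of_forall fun t => ?_)
  simp only [FockModel.heisFun, herm_smul_right, sqNorm_smul, smul_neg, ← sub_eq_add_neg, Pi.mul_apply]
  congr 2
  push_cast
  ring

theorem hasDerivAt_heis_line (x : V) (f : S.Smooth) :
    HasDerivAt (fun t : ℝ => S.heis (t • x, 0) (f : S.Fock)) (S.cl x f : S.Fock) 0 := by
  have h := hasDerivAt_heis_cl S x f 0
  rw [heis_zero] at h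
  refine h.congr_of_eventuallyEq (Eventually.of_forall fun t => ?_)
  simp

theorem hasDerivAt_eval {u : ℝ → S.Fock} {u' : S.Fock} {t : ℝ} (h : HasDerivAt u u' t) (z : V) :
    HasDerivAt (fun s => u s z) (u' z) t := by
  have h1 := ((S.evalL z).restrictScalars ℝ).hasFDerivAt.comp_hasDerivAt t h
  simpa [Function.comp_def, evalL_apply] using h1

/-- Evaluation is continuous on the Fock space, so the derivative in norm can be computed pointwise
from the explicit formula: a creation term minus an annihilation term. -/
theorem cl_apply (x : V) (f : S.Smooth) (z : V) : (S.cl x f : S.Fock) z =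
    S.herm z x / (2 * S.hbar) * (f : S.Fock) z - fderiv ℝ (f : S.Fock) z x :=
  (S.hasDerivAt_eval (S.hasDerivAt_heis_line x f) z).unique
    ((Fock.isHolo (f : S.Fock)).hasDerivAt_heisFun x z)

theorem cl_apply_zero (x : V) (f : S.Smooth) : (S.cl x f : S.Fock) 0 =
    -fderiv ℝ (f : S.Fock) 0 x := by
  rw [cl_apply]; simp [herm]

/-- `ellSq x` is the second derivative of the reproducing kernels along `x`, so it represents the
second derivative of `f` at 0. The extra multiple of `f 0` comes from rewriting that derivative
through `cl x` twice. -/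
theorem inner_ellSq (x : V) (f : S.Smooth) : inner ℂ (S.ellSq x) (f : S.Fock) =
    S.mass * ((S.cl x (S.cl x f) : S.Fock) 0 + (S.sqNorm x : ℂ) / (2 * S.hbar) * (f : S.Fock) 0) := by
  set β : ℝ := S.sqNorm x / (2 * S.hbar) with hβ
  have hβ0 : 0 ≤ β := div_nonneg (S.sqNorm_nonneg x) (by linarith [S.hbar_pos])
  have hβc : (S.sqNorm x : ℂ) / (2 * S.hbar) = (β : ℂ) := by rw [hβ]; push_cast; rfl
  set φ : ℝ → ℂ := fun s => (f : S.Fock) (s • x) with hφ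
  -- The derivative of `φ`, written through `cl_apply`. In this form it can be differentiated again,
  -- because `cl x f` is again holomorphic.
  set φ' : ℝ → ℂ := fun s => s * β * φ s - (S.cl x f : S.Fock) (s • x) with hφ'
  have hd : ∀ s, HasDerivAt φ (φ' s) s := by
    intro s
    have h := (Fock.isHolo (f : S.Fock)).hasDerivAt_line 0 x s
    simp only [zero_add] at h
    have e := S.cl_apply x f (s • x)
    rw [herm_smul_left, herm_self, mul_div_assoc, hβc] at e
    have e2 : φ' s = fderiv ℝ (f : S.Fock) (s • x) x := by
      rw [hφ']
      simp only [e, hφ]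
      ring
    rw [e2]
    exact h
  have hd' : HasDerivAt φ' ((S.cl x (S.cl x f) : S.Fock) 0 + β * (f : S.Fock) 0) 0 := by
    have h := (Fock.isHolo (S.cl x f : S.Fock)).hasDerivAt_line 0 x 0
    simp only [zero_add, zero_smul] at h
    have a1 : HasDerivAt (fun t : ℝ => (t : ℂ)) 1 0 := Complex.ofRealCLM.hasDerivAt (x := 0)
    have h2 := ((a1.mul_const (β : ℂ)).mul (hd 0)).sub h
    have e := S.cl_apply_zero x (S.cl x f)
    refine h2.congr_deriv ?_
    rw [e]
    simp only [hφ, zero_smul, Complex.ofReal_zero]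
    ring
  have hnorm : ∀ s : ℝ, ‖S.expv (s • x) + S.expv ((-s) • x) - (2 : ℂ) • S.expv ((0 : ℝ) • x)‖ ^ 2 =
      S.mass * (2 * Real.exp (s * s * β) + 2 * Real.exp (-(s * s * β)) - 4) := by
    intro s
    have h := inner_self_eq_norm_sq_to_K (𝕜 := ℂ)
      (S.expv (s • x) + S.expv ((-s) • x) - (2 : ℂ) • S.expv ((0 : ℝ) • x))
    simp only [inner_sub_left, inner_sub_right, inner_add_left, inner_add_right, inner_smul_left,
      inner_smul_right, inner_expv_smul, ← hβ] at h
    have h2 : ((‖S.expv (s • x) + S.expv ((-s) • x) - (2 : ℂ) • S.expv ((0 : ℝ) • x)‖ : ℂ)) ^ 2 =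
      ((S.mass * (2 * Real.exp (s * s * β) + 2 * Real.exp (-(s * s * β)) - 4) : ℝ) : ℂ) := by
      refine h.symm.trans ?_
      have c2 : (starRingEnd ℂ) 2 = 2 := Complex.conj_ofNat 2
      rw [c2]
      simp only [mul_zero, zero_mul, neg_mul, mul_neg, neg_neg, neg_zero, Real.exp_zero]
      push_cast
      ring
    exact_mod_cast h2
  have hlim := S.tendsto_inner_of_bounded (l := 𝓝[≠] (0 : ℝ))
    (fun s : ℝ => ((s ^ 2 : ℝ) : ℂ)⁻¹ •
      (S.expv (s • x) + S.expv ((-s) • x) - (2 : ℂ) • S.expv ((0 : ℝ) • x))) (S.ellSq x)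
    (Real.sqrt (S.mass * (2 * (β * β * Real.exp β)))) ?_ ?_ f
  · have h1 := (tendsto_second_difference (Eventually.of_forall hd) hd').const_mul (S.mass : ℂ)
    rw [hβc]
    refine tendsto_nhds_unique hlim (h1.congr fun s => ?_)
    have c2 : (starRingEnd ℂ) 2 = 2 := Complex.conj_ofNat 2
    simp only [inner_smul_left, inner_sub_left, inner_add_left, inner_expv, map_inv₀,
      Complex.conj_ofReal, Complex.real_smul, hφ, c2, zero_smul]
    push_cast
    ring
  · have h1 : ∀ᶠ s : ℝ in 𝓝[≠] 0, s ∈ Set.Ioo (-1 : ℝ) 1 :=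
      mem_nhdsWithin_of_mem_nhds (Ioo_mem_nhds (by norm_num) (by norm_num))
    filter_upwards [h1, self_mem_nhdsWithin] with s hs hs0
    have hs0 : s ≠ 0 := hs0
    refine Real.le_sqrt_of_sq_le ?_
    rw [norm_smul, mul_pow, hnorm, norm_inv, Complex.norm_real, Real.norm_eq_abs, inv_pow, sq_abs]
    have hs2 : 0 < s ^ 2 := by positivity
    have hs3 : 0 < (s ^ 2) ^ 2 := by positivity
    have hs4 : s ^ 2 ≤ 1 := by nlinarith [hs.1, hs.2]
    set A : ℝ := s * s * β with hA
    have hA0 : 0 ≤ A := mul_nonneg (mul_self_nonneg s) hβ0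
    have hAβ : A ≤ β := by nlinarith
    -- The left side equals `2 (e^A - 1)(1 - e^(-A))`, with factors at most `A e^A` and `A`. This
    -- makes the squared norm of order `s⁴`.
    have h3 : 2 * Real.exp A + 2 * Real.exp (-A) - 4 ≤ 2 * (A * A * Real.exp A) := by
      have h5 : Real.exp (-A) * Real.exp A = 1 := by rw [← Real.exp_add]; simp
      have h4 := Real.add_one_le_exp (-A)
      have h6 : Real.exp A - 1 ≤ A * Real.exp A := by
        nlinarith [mul_le_mul_of_nonneg_right h4 (Real.exp_pos A).le]
      have h7 : 2 * Real.exp A + 2 * Real.exp (-A) - 4 =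
          2 * ((Real.exp A - 1) * (1 - Real.exp (-A))) := by linear_combination 2 * h5
      have h8 : 1 - Real.exp (-A) ≤ A := by linarith
      have h9 : 0 ≤ 1 - Real.exp (-A) := by
        have := Real.exp_le_one_iff.2 (neg_nonpos.2 hA0)
        linarith
      rw [h7]
      have h10 : (Real.exp A - 1) * (1 - Real.exp (-A)) ≤ (A * Real.exp A) * A :=
        mul_le_mul h6 h8 h9 (by positivity)
      nlinarith
    have h11 : A * A * Real.exp A ≤ (s ^ 2) ^ 2 * (β * β * Real.exp β) := by
      have : A * A = (s ^ 2) ^ 2 * (β * β) := by rw [hA]; ring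
      rw [this, mul_assoc]
      refine mul_le_mul_of_nonneg_left ?_ hs3.le
      exact mul_le_mul_of_nonneg_left (Real.exp_le_exp.2 hAβ) (by positivity)
    rw [inv_mul_le_iff₀ hs3]
    have h12 : 2 * Real.exp A + 2 * Real.exp (-A) - 4 ≤
        (s ^ 2) ^ 2 * (2 * (β * β * Real.exp β)) := by linarith
    have := mul_le_mul_of_nonneg_left h12 S.mass_pos.le
    linarith
  · intro z
    set a : ℂ := S.herm z x / (2 * S.hbar) with ha
    have b1 : ∀ s : ℝ, HasDerivAt (fun s : ℝ => Complex.exp (s * a)) (Complex.exp (s * a) * a) s := by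
      intro s
      have h1 : HasDerivAt (fun s : ℝ => (s : ℂ) * a) (1 * a) s :=
        (Complex.ofRealCLM.hasDerivAt (x := s)).mul_const a
      simpa using h1.cexp
    have b2 : HasDerivAt (fun s : ℝ => Complex.exp (s * a) * a) (a * a) 0 := by
      simpa using (b1 0).mul_const a
    have h1 := tendsto_second_difference (Eventually.of_forall b1) b2
    refine h1.congr fun s => ?_
    have h2 : ((((s ^ 2 : ℝ) : ℂ)⁻¹ • (S.expv (s • x) + S.expv ((-s) • x) -
      (2 : ℂ) • S.expv ((0 : ℝ) • x)) : S.Fock)) z = ((s ^ 2 : ℝ) : ℂ)⁻¹ *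
        (S.expv (s • x) z + S.expv ((-s) • x) z - 2 * S.expv ((0 : ℝ) • x) z) := rfl
    rw [h2]
    simp only [expv_apply, herm_smul_right, Complex.real_smul, mul_div_assoc, ← ha]
    push_cast
    simp

/-- The representation of the Heisenberg group on the smooth vectors. -/
def heisS (p : V × ℝ) (f : S.Smooth) : S.Smooth := ⟨S.heis p (f : S.Fock), by
  have h1 : ContDiff ℝ ∞ fun q : V × ℝ => S.heisMul q p := by
    have h2 : ContDiff ℝ ∞ fun q : V × ℝ => S.Ω q.1 p.1 :=
      ((LinearMap.toContinuousLinearMap (S.Ω.flip p.1)).contDiff).comp contDiff_fst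
    exact (contDiff_fst.add contDiff_const).prodMk
      ((contDiff_snd.add contDiff_const).sub (h2.div_const 2))
  have h := (S.contDiff_heis f).comp h1
  change ContDiff ℝ ∞ fun q => S.heis q (S.heis p (f : S.Fock))
  simpa only [Function.comp_def, heis_heis] using h⟩

theorem fderiv_heis_snd (f : S.Smooth) (p : V × ℝ) (r : ℝ) :
    fderiv ℝ (fun p : V × ℝ => S.heis p (f : S.Fock)) p (0, r) =
      (-(Complex.I * r / S.hbar)) • S.heis p (f : S.Fock) := by
  have h0 : HasFDerivAt (fun p : V × ℝ => S.heis p (f : S.Fock))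
      (fderiv ℝ (fun p : V × ℝ => S.heis p (f : S.Fock)) p) (p + (0 : ℝ) • ((0 : V), r)) := by
    rw [zero_smul, add_zero]
    exact ((S.contDiff_heis f).differentiable (by simp) p).hasFDerivAt
  have h1 : HasDerivAt (fun t : ℝ => p + t • ((0 : V), r)) (0, r) 0 := by
    simpa using ((hasDerivAt_id (0 : ℝ)).smul_const ((0 : V), r)).const_add p
  have h2 := h0.comp_hasDerivAt 0 h1
  refine h2.unique ?_
  have h3 := (hasDerivAt_cexp_smul (-(Complex.I * r / S.hbar))).smul_const (S.heis p (f : S.Fock))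
  refine h3.congr_of_eventuallyEq (Eventually.of_forall fun t => ?_)
  have h4 := S.heis_central p (t * r) (f : S.Fock)
  have h5 : (p + t • ((0 : V), r)) = (p.1, p.2 + t * r) := by ext <;> simp
  simp only [Function.comp_def, h5, h4]
  congr 2
  push_cast
  ring

/-- The tangent vector is split into its left-invariant part, on which `cl` acts, and a central part
acting by a scalar. -/
theorem fderiv_heis (f : S.Smooth) (p : V × ℝ) (v : V) (r : ℝ) :
    fderiv ℝ (fun p : V × ℝ => S.heis p (f : S.Fock)) p (v, r) =
      S.heis p (S.cl v f : S.Fock) -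
        (Complex.I * (r + S.Ω p.1 v / 2 : ℝ) / S.hbar) • S.heis p (f : S.Fock) := by
  have e : ((v, r) : V × ℝ) = (v, -(S.Ω p.1 v) / 2) + (0, r + S.Ω p.1 v / 2) := by
    ext
    · simp
    · simp; ring
  rw [e, map_add, ← heis_cl, fderiv_heis_snd, neg_smul, ← sub_eq_add_neg]

/-- Moving `cl v` past a Heisenberg translation costs only the scalar given by the group commutator.
Statements at a point `z` are thereby reduced to statements at 0. -/
theorem cl_heisS (v : V) (p : V × ℝ) (f : S.Smooth) : S.cl v (S.heisS p f) =
    S.heisS p (S.cl v f + (Complex.I * S.Ω v p.1 / S.hbar) • f) := by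
  refine Subtype.ext ?_
  have h1 := S.hasDerivAt_heis_line v (S.heisS p f)
  have h2 : HasDerivAt (fun t : ℝ => S.heis (S.heisMul (t • v, 0) p) (f : S.Fock))
      (fderiv ℝ (fun p : V × ℝ => S.heis p (f : S.Fock)) p (v, -(S.Ω v p.1) / 2)) 0 := by
    have e : ∀ t : ℝ, S.heisMul (t • v, 0) p = p + t • (v, -(S.Ω v p.1) / 2) := by
      intro t
      ext
      · simp [heisMul, add_comm]
      · simp [heisMul]; ring
    simp only [e]
    have h0 : HasFDerivAt (fun p : V × ℝ => S.heis p (f : S.Fock))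
        (fderiv ℝ (fun p : V × ℝ => S.heis p (f : S.Fock)) p)
        (p + (0 : ℝ) • (v, -(S.Ω v p.1) / 2)) := by
      rw [zero_smul, add_zero]
      exact ((S.contDiff_heis f).differentiable (by simp) p).hasFDerivAt
    have h1 : HasDerivAt (fun t : ℝ => p + t • (v, -(S.Ω v p.1) / 2)) (v, -(S.Ω v p.1) / 2) 0 := by
      simpa using ((hasDerivAt_id (0 : ℝ)).smul_const (v, -(S.Ω v p.1) / 2)).const_add p
    exact h0.comp_hasDerivAt 0 h1
  simp only [← heis_heis] at h2
  rw [h1.unique h2, fderiv_heis]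
  change _ = S.heis p ((S.cl v f : S.Fock) + (Complex.I * S.Ω v p.1 / S.hbar) • (f : S.Fock))
  rw [map_add, map_smul, S.skew p.1 v, sub_eq_add_neg, ← neg_smul]
  congr 2
  push_cast
  ring

end

end FockModel
end MpcDirac

/-! ### Clifford multiplication commutes with derivatives; `Mp^c` on the vacuum. -/

namespace MpcDirac

open Filter Topology

noncomputable section

section

variable {E F F' : Type*} [NormedAddCommGroup E] [NormedSpace ℝ E] [NormedAddCommGroup F]
  [NormedSpace ℝ F] [NormedAddCommGroup F'] [NormedSpace ℝ F'] {N : Type*} [TopologicalSpace N]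
  [ChartedSpace E N]

theorem dM_clm_comp (L : F →L[ℝ] F') {f : N → F} {x : N}
    (hf : MDifferentiableAt 𝓘(ℝ, E) 𝓘(ℝ, F) f x) (v : E) :
    dM E F' (fun y => L (f y)) x v = L (dM E F f x v) := by
  have h := dM_comp (E₂ := F) (E₃ := F') (g := L) x L.differentiableAt.mdifferentiableAt hf v
  rw [dM_fderiv, L.fderiv] at h
  exact h

end

variable {V : Type*} [NormedAddCommGroup V] [NormedSpace ℝ V] [FiniteDimensional ℝ V]

namespace FockModel

variable (S : FockModel V)

/-- Although `cl v` is defined only on smooth vectors, its values at a point extend to a continuous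
functional of `f`. After translating `z` to 0 the value is minus a first derivative at 0,
represented by `ell v`, up to a multiple of evaluation. -/
theorem exists_clm_cl (v z : V) : ∃ L : S.Fock →L[ℂ] ℂ, ∀ f : S.Smooth,
    L (f : S.Fock) = (S.cl v f : S.Fock) z := by
  set κ : ℂ := Complex.I * S.Ω v (-z) / S.hbar
  set a : ℂ := Complex.exp (-((S.sqNorm z : ℂ) / (4 * S.hbar)))
  have ha : a ≠ 0 := Complex.exp_ne_zero _
  refine ⟨a⁻¹ • ((-((S.mass : ℂ)⁻¹) • innerSL ℂ (S.ell v) - κ • S.evalL 0).comp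
    (S.heis (-z, 0)).toContinuousLinearMap), fun f => ?_⟩
  have h1 := congrArg (fun f : S.Smooth => (f : S.Fock) 0) (S.cl_heisS v (-z, 0) f)
  have h2 : (S.heisS (-z, 0) (S.cl v f + κ • f) : S.Fock) 0 =
      a * ((S.cl v f : S.Fock) z + κ * (f : S.Fock) z) := S.heis_neg_apply_zero z _
  have h3 : (S.heis (-z, 0) (f : S.Fock)) 0 = a * (f : S.Fock) z := S.heis_neg_apply_zero z _
  have h4 := S.inner_ell v (S.heis (-z, 0) (f : S.Fock))
  have h5 : -fderiv ℝ (S.heis (-z, 0) (f : S.Fock)) 0 v =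
      a * ((S.cl v f : S.Fock) z + κ * (f : S.Fock) z) :=
    ((S.cl_apply_zero v (S.heisS (-z, 0) f)).symm.trans h1).trans h2
  have h6 : (a⁻¹ • ((-((S.mass : ℂ)⁻¹) • innerSL ℂ (S.ell v) - κ • S.evalL 0).comp
    (S.heis (-z, 0)).toContinuousLinearMap)) (f : S.Fock) = a⁻¹ * (-((S.mass : ℂ)⁻¹) *
      inner ℂ (S.ell v) (S.heis (-z, 0) (f : S.Fock)) - κ * S.evalL 0 (S.heis (-z, 0) f)) := rfl
  rw [h6, evalL_apply, h3, h4]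
  have hm := S.mass_ne_zero
  calc _ = a⁻¹ * (((S.mass : ℂ)⁻¹ * S.mass) * -fderiv ℝ (S.heis (-z, 0) (f : S.Fock)) 0 v
        - κ * (a * (f : S.Fock) z)) := by ring
    _ = a⁻¹ * a * (S.cl v f : S.Fock) z := by rw [inv_mul_cancel₀ hm, h5]; ring
    _ = _ := by rw [inv_mul_cancel₀ ha, one_mul]

end FockModel

/-- Tested at each point `z`, both sides are derivatives of one scalar function: Clifford
multiplication followed by evaluation is a continuous functional and passes through the derivative.
-/
theorem clFun_mul_leftDeriv {E : Type*} [NormedAddCommGroup E] [NormedSpace ℝ E] {G : Type*}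
    [TopologicalSpace G] [ChartedSpace E G] [Group G] [LieGroup 𝓘(ℝ, E) ∞ G] (S : FockModel V)
    (v : V) (X : GroupLieAlgebra 𝓘(ℝ, E) G) :
    clFun S v * leftDeriv S X = leftDeriv S X * clFun S v := by
  refine LinearMap.ext fun φ => Subtype.ext (funext fun g => Subtype.ext ?_)
  refine FockModel.Fock.ext fun z => ?_
  obtain ⟨L, hL⟩ := S.exists_clm_cl v z
  have h1 : ((clFun S v (leftDeriv S X φ)).1 g : S.Fock) z =
      L (dM E S.Fock (fun g => (φ.1 g : S.Fock)) g (mulInvariantVectorField X g)) :=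
    (hL ((leftDeriv S X φ).1 g)).symm
  have h2 : ((leftDeriv S X (clFun S v φ)).1 g : S.Fock) z =
      S.evalL z (dM E S.Fock (fun g => ((clFun S v φ).1 g : S.Fock)) g
        (mulInvariantVectorField X g)) := (S.evalL_apply z _).symm
  refine h1.trans (Eq.trans ?_ h2.symm)
  have h3 := dM_clm_comp (L.restrictScalars ℝ)
    ((SmoothFun.contMDiff φ.2).mdifferentiable (by simp) g) (mulInvariantVectorField X g)
  have h4 := dM_clm_comp ((S.evalL z).restrictScalars ℝ)
    ((SmoothFun.contMDiff (clFun S v φ).2).mdifferentiable (by simp) g)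
    (mulInvariantVectorField X g)
  have h5 : (fun y => (L.restrictScalars ℝ) (φ.1 y : S.Fock)) =
      fun y => ((S.evalL z).restrictScalars ℝ) ((clFun S v φ).1 y : S.Fock) :=
    funext fun y => (hL (φ.1 y)).trans (S.evalL_apply z _).symm
  rw [h5] at h3
  exact h3.symm.trans h4

namespace FockModel

variable (S : FockModel V)

/-- The antilinear part `(g + j g j) / 2` of `g`. -/
def antiPart (g : V →ₗ[ℝ] V) : V →ₗ[ℝ] V := (1 / 2 : ℝ) • (g + S.j ∘ₗ g ∘ₗ S.j)

/-- The annihilation condition characterising the vacuum, written for the derivatives of its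
translates. -/
theorem ell_j (x : V) : S.ell x = Complex.I • S.ell (S.j x) := Fock.ext fun q => by
  rw [Fock.smul_apply, ell_apply, ell_apply, herm_j_right, mul_div_assoc, ← mul_assoc]
  simp

/-- A weak derivative at 0 suffices here, so smoothness of the vacuum vector never has to be
established. -/
theorem hasDerivAt_inner_heis_vac (x : V) (k : S.Fock) :
    HasDerivAt (fun t : ℝ => inner ℂ k (S.heis (t • x, 0) S.vac)) (inner ℂ k (S.ell x)) 0 := by
  have h1 : HasDerivAt (fun t : ℝ => inner ℂ (S.heis (t • x, 0) S.vac) k)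
      (inner ℂ (S.ell x) k) 0 := by
    rw [inner_ell]
    have h2 : HasDerivAt (fun t : ℝ => Complex.exp (-((t : ℂ) ^ 2 * ((S.sqNorm x : ℂ) /
        (4 * S.hbar))))) 0 0 := by
      have a1 : HasDerivAt (fun t : ℝ => (t : ℂ)) 1 0 := Complex.ofRealCLM.hasDerivAt (x := 0)
      have a2 := (((a1.pow 2).mul_const ((S.sqNorm x : ℂ) / (4 * S.hbar))).neg).cexp
      exact a2.congr_deriv (by simp)
    have h3 := (Fock.isHolo k).hasDerivAt_line 0 x 0
    have h4 := (h2.mul h3).const_mul (S.mass : ℂ)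
    simp only [zero_smul, add_zero, zero_mul, zero_add, Complex.ofReal_zero, ne_eq,
      OfNat.ofNat_ne_zero, not_false_eq_true, zero_pow, neg_zero, Complex.exp_zero, one_mul] at h4
    refine h4.congr_of_eventuallyEq (Eventually.of_forall fun t => ?_)
    have := S.inner_coh (t • x) k
    rw [coh] at this
    simp only [this, sqNorm_smul, Pi.mul_apply, zero_add]
    push_cast
    ring_nf
  have h5 := (Complex.conjCLE.toContinuousLinearMap.hasFDerivAt).comp_hasDerivAt (0 : ℝ) h1
  simpa only [Function.comp_def, ContinuousLinearEquiv.coe_coe, Complex.conjCLE_apply,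
    inner_conj_symm] using h5

theorem hasDerivAt_isometry_heis_vac (U : S.Fock ≃ₗᵢ[ℂ] S.Fock) (x z : V) :
    HasDerivAt (fun t : ℝ => U (S.heis (t • x, 0) S.vac) z) (U (S.ell x) z) 0 := by
  have h1 := (S.hasDerivAt_inner_heis_vac x (U.symm (S.expv z))).const_mul ((S.mass : ℂ)⁻¹)
  have h2 : ∀ f, (S.mass : ℂ)⁻¹ * inner ℂ (U.symm (S.expv z)) f = U f z := by
    intro f
    rw [← U.inner_map_map, U.apply_symm_apply, inner_expv, inv_mul_cancel_left₀ S.mass_ne_zero]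
  simpa only [h2] using h1

theorem Mpc.U_heis (m : S.Mpc) (v : V) (f : S.Fock) :
    Mpc.U S m (S.heis (v, 0) f) = S.heis (Mpc.σ S m v, 0) (Mpc.U S m f) := by
  have h := m.2.2 v 0 (Mpc.U S m f)
  rw [show Mpc.σ S m v = m.1.2 v from rfl, h]
  have h2 : m.1.1⁻¹ (Mpc.U S m f) = f := m.1.1.symm_apply_apply f
  rw [h2]
  rfl

/-- The operator `U` transports the annihilation condition: differentiation along `g x` and along `g
j x` acts on `U vac` in the ratio given by `ell_j`. Holomorphy then separates the complex linear
part of `g`, in the derivative, from the antilinear part, in the coefficient. -/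
theorem Mpc.fderiv_U_vac (m : S.Mpc) (x z : V) : fderiv ℝ (Mpc.U S m S.vac) z
      (S.linPart (Mpc.σ S m : V →ₗ[ℝ] V) x) =
    S.herm z (S.antiPart (Mpc.σ S m : V →ₗ[ℝ] V) x) / (2 * S.hbar) * Mpc.U S m S.vac z := by
  set G := Mpc.U S m S.vac
  set g := Mpc.σ S m
  have key : ∀ x, S.herm z (g x) / (2 * S.hbar) * G z - fderiv ℝ G z (g x) =
      Mpc.U S m (S.ell x) z := by
    intro x
    refine ((Fock.isHolo G).hasDerivAt_heisFun (g x) z).unique ?_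
    refine (S.hasDerivAt_isometry_heis_vac (Mpc.U S m) x z).congr_of_eventuallyEq
      (Eventually.of_forall fun t => ?_)
    have h := congrArg (fun F : S.Fock => F z) (Mpc.U_heis S m (t • x) S.vac)
    rw [map_smul] at h
    exact h.symm
  have h1 := key x
  rw [ell_j, map_smul, Fock.smul_apply, ← key (S.j x)] at h1
  have h2 := (Fock.isHolo G).2 z (g (S.j x))
  have h3 : S.herm z (S.j (g (S.j x))) = -Complex.I * S.herm z (g (S.j x)) := S.herm_j_right _ _
  simp only [linPart, antiPart, LinearMap.smul_apply, LinearMap.sub_apply, LinearMap.add_apply,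
    LinearMap.comp_apply, LinearEquiv.coe_coe, map_smul, map_sub, herm_smul_right, herm_add_right,
    h2, h3, Complex.real_smul]
  push_cast
  linear_combination (-1 / 2 : ℂ) * h1

/-- Along the ray through `x` the function `U vac` satisfies the linear equation of
`Mpc.fderiv_U_vac`, whose solution is a Gaussian with initial value `λ`. So `U vac` is known on the
range of the linear part of `g` from `(g, λ)` alone. -/
theorem Mpc.U_vac_linPart (m : S.Mpc) (y : V) :
    Mpc.U S m S.vac (S.linPart (Mpc.σ S m : V →ₗ[ℝ] V) y) = Mpc.lam S m *
      Complex.exp (S.herm (S.linPart (Mpc.σ S m : V →ₗ[ℝ] V) y)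
        (S.antiPart (Mpc.σ S m : V →ₗ[ℝ] V) y) / (4 * S.hbar)) := by
  set G := Mpc.U S m S.vac
  set x := S.linPart (Mpc.σ S m : V →ₗ[ℝ] V) y
  set a := S.herm x (S.antiPart (Mpc.σ S m : V →ₗ[ℝ] V) y) / (4 * S.hbar) with ha
  have h1 : ∀ s : ℝ, HasDerivAt (fun s : ℝ => G (s • x)) (2 * s * a * G (s • x)) s := by
    intro s
    have h := (Fock.isHolo G).hasDerivAt_line 0 x s
    simp only [zero_add] at h
    refine h.congr_deriv ?_
    rw [Mpc.fderiv_U_vac, herm_smul_left, ha]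
    have := S.hbar_ne_zero
    field_simp
    ring
  have h2 : ∀ s : ℝ, HasDerivAt (fun s : ℝ => Complex.exp (-((s : ℂ) ^ 2 * a)))
      (Complex.exp (-((s : ℂ) ^ 2 * a)) * -(2 * s * a)) s := by
    intro s
    have a1 : HasDerivAt (fun t : ℝ => (t : ℂ)) 1 s := Complex.ofRealCLM.hasDerivAt (x := s)
    exact ((((a1.pow 2).mul_const a).neg).cexp).congr_deriv (by simp)
  have h3 : ∀ s : ℝ, HasDerivAt (fun s : ℝ => G (s • x) * Complex.exp (-((s : ℂ) ^ 2 * a))) 0 s := by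
    intro s
    refine ((h1 s).mul (h2 s)).congr_deriv ?_
    ring
  have h4 := is_const_of_deriv_eq_zero (fun s => (h3 s).differentiableAt)
    (fun s => (h3 s).deriv) 1 0
  simp only [Complex.ofReal_one, one_pow, one_mul, one_smul, Complex.ofReal_zero, ne_eq,
    OfNat.ofNat_ne_zero, not_false_eq_true, zero_pow, zero_mul, neg_zero, Complex.exp_zero,
    mul_one, zero_smul] at h4
  change G x = G 0 * Complex.exp a
  rw [← h4, mul_assoc, ← Complex.exp_add]
  simp

end FockModel

end

end MpcDirac

/-! ### Determinants, complex traces, generation of `sp(V, Ω)` by rank-one elements. -/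

namespace MpcDirac

open Filter Topology

noncomputable section

/-- The derivative depends only on the tangent vector, so the curve may be replaced by the line `1 +
s A'`. Along it the determinant is a polynomial with linear coefficient the trace. -/
theorem hasDerivAt_det {n : Type*} [Fintype n] [DecidableEq n] {A : ℝ → Matrix n n ℂ}
    {A' : Matrix n n ℂ} (h : ∀ i k, HasDerivAt (fun t => A t i k) (A' i k) 0) (h0 : A 0 = 1) :
    HasDerivAt (fun t => (A t).det) A'.trace 0 := by
  set D : (n → n → ℂ) → ℂ := fun M => (Matrix.of M).det with hDdef
  have hD : Differentiable ℝ D := by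
    simp only [hDdef, Matrix.det_apply, Matrix.of_apply]
    fun_prop
  have hA : HasDerivAt (fun t => (fun i k => A t i k)) (fun i k => A' i k) 0 :=
    hasDerivAt_pi.2 fun i => hasDerivAt_pi.2 fun k => h i k
  have h1 := (hD _).hasFDerivAt.comp_hasDerivAt (0 : ℝ) hA
  set l : ℝ → n → n → ℂ := fun s i k => ((1 : Matrix n n ℂ) + (s : ℂ) • A') i k
  have hl : HasDerivAt l (fun i k => A' i k) 0 := by
    refine hasDerivAt_pi.2 fun i => hasDerivAt_pi.2 fun k => ?_
    have a1 : HasDerivAt (fun t : ℝ => (t : ℂ)) 1 0 := Complex.ofRealCLM.hasDerivAt (x := 0)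
    simpa [l] using (a1.mul_const (A' i k)).const_add ((1 : Matrix n n ℂ) i k)
  have h2 := (hD _).hasFDerivAt.comp_hasDerivAt (0 : ℝ) hl
  have e0 : l 0 = fun i k => A 0 i k := by
    rw [h0]
    funext i k
    simp [l]
  rw [e0] at h2
  have h3 : HasDerivAt (D ∘ l) A'.trace 0 := by
    have e : D ∘ l = fun s : ℝ => 1 + A'.trace * (s : ℂ) + (Matrix.det (1 + (Polynomial.X :
        Polynomial ℂ) • A'.map Polynomial.C)).divX.divX.eval (s : ℂ) * (s : ℂ) ^ 2 :=
      funext fun s => Matrix.det_one_add_smul (s : ℂ) A'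
    rw [e]
    have a1 : HasDerivAt (fun t : ℝ => (t : ℂ)) 1 0 := Complex.ofRealCLM.hasDerivAt (x := 0)
    have a2 := ((Matrix.det (1 + (Polynomial.X :
      Polynomial ℂ) • A'.map Polynomial.C)).divX.divX.hasDerivAt ((0 : ℝ) : ℂ)).comp_ofReal
    have a3 := ((a1.const_mul A'.trace).const_add 1).add (a2.mul (a1.pow 2))
    exact a3.congr_deriv (by simp)
  rw [h2.unique h3] at h1
  exact h1

variable {V : Type*} [NormedAddCommGroup V] [NormedSpace ℝ V] [FiniteDimensional ℝ V]

theorem hasDerivAt_of_forall_apply {F : Type*} [NormedAddCommGroup F] [NormedSpace ℝ F]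
    {L : ℝ → V →L[ℝ] F} {L' : V →L[ℝ] F} {t : ℝ}
    (h : ∀ v, HasDerivAt (fun s => L s v) (L' v) t) : HasDerivAt L L' t := by
  set b := Module.finBasis ℝ V
  have e : ∀ M : V →L[ℝ] F, M = ∑ i, ContinuousLinearMap.smulRightL ℝ V F
      (LinearMap.toContinuousLinearMap (b.coord i)) (M (b i)) := by
    intro M
    ext v
    have h1 := congrArg M (b.sum_repr v)
    simp only [map_sum, map_smul] at h1
    rw [← h1]
    simp [ContinuousLinearMap.sum_apply]
  have h1 : HasDerivAt (fun s => ∑ i, ContinuousLinearMap.smulRightL ℝ V F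
      (LinearMap.toContinuousLinearMap (b.coord i)) (L s (b i)))
      (∑ i, ContinuousLinearMap.smulRightL ℝ V F
      (LinearMap.toContinuousLinearMap (b.coord i)) (L' (b i))) t := by
    refine HasDerivAt.fun_sum fun i _ => ?_
    exact (ContinuousLinearMap.hasFDerivAt _).comp_hasDerivAt t (h (b i))
  rw [← e L'] at h1
  simpa only [← e] using h1

namespace FockModel

variable (S : FockModel V)

/-- Symplectic endomorphisms correspond to symmetric tensors: `ξ` is the symmetrisation of `∑ Ω(eₐ,
·) ξ(eᵃ)`, and polarisation reduces symmetric tensors to squares. -/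
theorem sp_induction {P : Module.End ℝ V → Prop} (hadd : ∀ ξ η, P ξ → P η → P (ξ + η))
    (hsmul : ∀ (r : ℝ) ξ, P ξ → P (r • ξ)) (hR : ∀ x, P (S.rankOne x x)) (ξ : Module.End ℝ V)
    (hξ : ∀ v w, S.Ω (ξ v) w = -S.Ω v (ξ w)) : P ξ := by
  set b := Module.finBasis ℝ V
  have h0 : P 0 := by simpa using hsmul 0 _ (hR 0)
  have e : ξ = (1 / 2 : ℝ) • ∑ a, (S.rankOne (b a + ξ (S.dualBasis b a))
      (b a + ξ (S.dualBasis b a)) + ((-1 : ℝ) • S.rankOne (b a) (b a) +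
        (-1 : ℝ) • S.rankOne (ξ (S.dualBasis b a)) (ξ (S.dualBasis b a)))) := by
    ext v
    have h1 : ∑ a, S.Ω (b a) v • ξ (S.dualBasis b a) = ξ v := by
      conv_rhs => rw [← sum_Ω_basis S b v, map_sum]
      simp only [map_smul]
    have h2 : ∑ a, S.Ω (ξ (S.dualBasis b a)) v • b a = ξ v := by
      conv_rhs => rw [← sum_Ω_dualBasis S b (ξ v)]
      refine Finset.sum_congr rfl fun a _ => ?_
      rw [hξ, ← S.skew (ξ v)]
    have h3 : ∀ a, (S.rankOne (b a + ξ (S.dualBasis b a))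
      (b a + ξ (S.dualBasis b a)) + ((-1 : ℝ) • S.rankOne (b a) (b a) +
        (-1 : ℝ) • S.rankOne (ξ (S.dualBasis b a)) (ξ (S.dualBasis b a)))) v =
        S.Ω (b a) v • ξ (S.dualBasis b a) + S.Ω (ξ (S.dualBasis b a)) v • b a := by
      intro a
      simp only [rankOne, LinearMap.add_apply, LinearMap.smul_apply, LinearMap.smulRight_apply,
        map_add]
      module
    rw [LinearMap.smul_apply, LinearMap.sum_apply, Finset.sum_congr rfl fun a _ => h3 a,
      Finset.sum_add_distrib, h1, h2]
    module
  rw [e]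
  refine hsmul _ _ (Finset.sum_induction _ P hadd h0 fun a _ => ?_)
  exact hadd _ _ (hR _) (hadd _ _ (hsmul _ _ (hR _)) (hsmul _ _ (hR _)))

theorem nu_add (ξ η : Module.End ℝ V) : S.nu (ξ + η) = S.nu ξ + S.nu η := by
  simp only [nu, LinearMap.add_apply, gen_add, mul_add, add_mul]
  rw [← smul_add, ← Finset.sum_add_distrib]
  congr 1
  refine Finset.sum_congr rfl fun a _ => ?_
  abel

theorem nu_smul (r : ℝ) (ξ : Module.End ℝ V) : S.nu (r • ξ) = (r : ℂ) • S.nu ξ := by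
  simp only [nu, LinearMap.smul_apply, gen_smul, mul_smul_comm, smul_mul_assoc]
  rw [smul_comm (r : ℂ)]
  simp only [smul_add, Finset.smul_sum]

theorem clAlg_nu_rankOne (x : V) : S.clAlg (S.nu (S.rankOne x x)) =
    (-(Complex.I * S.hbar / 2)) • (S.cl x * S.cl x) := by
  have h := congrArg S.clAlg (S.nu_rankOne x x)
  rw [nu_add, map_add, map_smul, map_add, map_mul, clAlg_gen, ← two_smul ℂ (S.clAlg _),
    ← two_smul ℂ (S.cl x * S.cl x), smul_comm] at h
  exact smul_right_injective _ (two_ne_zero (α := ℂ)) h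

instance : Module.Finite ℂ S.Cplx := by
  letI : Module ℝ S.Cplx := inferInstanceAs (Module ℝ V)
  haveI : IsScalarTower ℝ ℂ S.Cplx := ⟨fun r c v => by
    have h : S.cplxAction (r • c) v = r • S.cplxAction c v := by rw [map_smul]; rfl
    exact h⟩
  haveI : Module.Finite ℝ S.Cplx := inferInstanceAs (Module.Finite ℝ V)
  exact Module.Finite.of_restrictScalars_finite ℝ ℂ S.Cplx

theorem linPartC_add (ξ η : V →ₗ[ℝ] V) : S.linPartC (ξ + η) = S.linPartC ξ + S.linPartC η := by
  refine LinearMap.ext fun v => ?_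
  have h : ∀ v : V, S.linPart (ξ + η) v = S.linPart ξ v + S.linPart η v := fun v => by
    simp only [linPart, LinearMap.smul_apply, LinearMap.sub_apply, LinearMap.add_apply,
      LinearMap.comp_apply, map_add]
    module
  exact h v

theorem linPartC_smul (r : ℝ) (ξ : V →ₗ[ℝ] V) :
    S.linPartC (r • ξ) = (r : ℂ) • S.linPartC ξ := by
  refine LinearMap.ext fun v => ?_
  have h : ∀ v : V, S.linPart (r • ξ) v = S.cplxAction r (S.linPart ξ v) := fun v => by
    simp only [linPart, LinearMap.smul_apply, LinearMap.sub_apply, LinearMap.comp_apply, map_smul,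
      cplxAction_apply, Complex.ofReal_re, Complex.ofReal_im]
    module
  exact h v

/-- The complex trace of the complex linear part of `ξ`. -/
def trC (ξ : V →ₗ[ℝ] V) : ℂ := LinearMap.trace ℂ S.Cplx (S.linPartC ξ)

theorem trC_add (ξ η : V →ₗ[ℝ] V) : S.trC (ξ + η) = S.trC ξ + S.trC η := by
  rw [trC, linPartC_add, map_add, trC, trC]

theorem trC_smul (r : ℝ) (ξ : V →ₗ[ℝ] V) : S.trC (r • ξ) = r * S.trC ξ := by
  rw [trC, linPartC_smul, map_smul, smul_eq_mul, trC]

/-- The complex linear part of this endomorphism is the complex rank-one map `q ↦ -(i/2) ⟨q, x⟩ x`,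
whose trace is the functional applied to `x`. -/
theorem trC_rankOne (x : V) : S.trC (S.rankOne x x) = -(Complex.I / 2) * S.sqNorm x := by
  set φ : S.Cplx →ₗ[ℂ] ℂ :=
    { toFun := fun q : V => -(Complex.I / 2) * S.herm q x
      map_add' := fun u v => by rw [← mul_add]; exact congrArg _ (S.herm_add_left u v x)
      map_smul' := fun c v => by
        have h : ∀ v : V, S.herm (S.cplxAction c v) x = c * S.herm v x := fun v => by
          rw [cplxAction_apply, herm_add_left, herm_smul_left, herm_smul_left, herm_j_left]
          conv_rhs => rw [← Complex.re_add_im c]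
          ring
        have h2 : ∀ v : V, -(Complex.I / 2) * S.herm (S.cplxAction c v) x =
            c * (-(Complex.I / 2) * S.herm v x) := fun v => by rw [h]; ring
        exact h2 v }
  have h1 : S.linPartC (S.rankOne x x) = φ.smulRight (show S.Cplx from x) := by
    refine LinearMap.ext fun q => ?_
    have h : ∀ q : V, S.linPart (S.rankOne x x) q =
        S.cplxAction (-(Complex.I / 2) * S.herm q x) x := by
      intro q
      have e1 : (-(Complex.I / 2) * S.herm q x).re = S.Ω x q / 2 := by
        simp [herm]
        rw [S.skew q x]; ring
      have e2 : (-(Complex.I / 2) * S.herm q x).im = -S.Ω x (S.j q) / 2 := by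
        simp [herm]
        rw [S.metric_symm q x]; ring
      rw [cplxAction_apply, e1, e2]
      simp only [linPart, rankOne, LinearMap.smul_apply, LinearMap.sub_apply, LinearMap.comp_apply,
        LinearMap.smulRight_apply, map_smul]
      module
    exact h q
  rw [trC, h1, LinearMap.trace_smulRight]
  change -(Complex.I / 2) * S.herm x x = _
  rw [herm_self]

theorem exists_coord_clm {ι : Type*} (b : Module.Basis ι ℂ S.Cplx) (i : ι) :
    ∃ c : V →L[ℝ] ℂ, ∀ v : V, c v = b.coord i (show S.Cplx from v) := by
  refine ⟨LinearMap.toContinuousLinearMap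
    { toFun := fun v : V => b.coord i (show S.Cplx from v)
      map_add' := fun u v => map_add (b.coord i) (show S.Cplx from u) (show S.Cplx from v)
      map_smul' := fun r v => ?_ }, fun v => rfl⟩
  have h1 : (show S.Cplx from r • v) = (r : ℂ) • (show S.Cplx from v) := by
    have : S.cplxAction r v = r • v := by simp [cplxAction_apply]
    exact this.symm
  rw [h1, map_smul]
  rfl

theorem hasDerivAt_detC {g : ℝ → V →ₗ[ℝ] V} {ξ : V →ₗ[ℝ] V} (h0 : ∀ v, g 0 v = v)
    (h : ∀ v, HasDerivAt (fun t => g t v) (ξ v) 0) :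
    HasDerivAt (fun t => S.detC (g t)) (S.trC ξ) 0 := by
  classical
  set b := Module.finBasis ℂ S.Cplx
  have hlin : ∀ v, HasDerivAt (fun t => S.linPart (g t) v) (S.linPart ξ v) 0 := by
    intro v
    have h1 := (LinearMap.toContinuousLinearMap S.j).hasFDerivAt.comp_hasDerivAt (0 : ℝ) (h (S.j v))
    exact ((h v).sub h1).const_smul (1 / 2 : ℝ)
  have e0 : LinearMap.toMatrix b b (S.linPartC (g 0)) = 1 := by
    have : S.linPartC (g 0) = LinearMap.id := by
      refine LinearMap.ext fun v => ?_
      have h1 : ∀ v : V, S.linPart (g 0) v = v := fun v => by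
        simp only [linPart, LinearMap.smul_apply, LinearMap.sub_apply, LinearMap.comp_apply, h0,
          S.j_sq]
        module
      exact h1 v
    rw [this, LinearMap.toMatrix_id]
  have h1 := hasDerivAt_det (A := fun t => LinearMap.toMatrix b b (S.linPartC (g t)))
    (A' := LinearMap.toMatrix b b (S.linPartC ξ)) (fun i k => ?_) e0
  · rw [← LinearMap.trace_eq_matrix_trace] at h1
    simp only [LinearMap.det_toMatrix] at h1
    exact h1
  · obtain ⟨c, hc⟩ := S.exists_coord_clm b i
    have h2 := c.hasFDerivAt.comp_hasDerivAt (0 : ℝ) (hlin (show V from b k))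
    simp only [Function.comp_def, hc] at h2
    simp only [LinearMap.toMatrix_apply]
    exact h2

end FockModel

end

end MpcDirac

/-! ### Weak differentiation of curves in `Mp^c` on the vacuum. -/

namespace MpcDirac

open Filter Topology

noncomputable section

variable {V : Type*} [NormedAddCommGroup V] [NormedSpace ℝ V] [FiniteDimensional ℝ V]

namespace FockModel

variable (S : FockModel V)

theorem inner_vac_vac : inner ℂ S.vac S.vac = (S.mass : ℂ) := by
  rw [inner_vac, show S.vac 0 = 1 from rfl, mul_one]

theorem norm_sq_vac : ‖S.vac‖ ^ 2 = S.mass := by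
  have h := inner_self_eq_norm_sq_to_K (𝕜 := ℂ) S.vac
  rw [inner_vac_vac] at h
  refine Complex.ofReal_injective (h.trans ?_).symm
  push_cast
  rfl

theorem Mpc.norm_lam_le (m : S.Mpc) : ‖Mpc.lam S m‖ ≤ 1 := by
  have h1 : inner ℂ S.vac (Mpc.U S m S.vac) = S.mass * Mpc.lam S m := S.inner_vac _
  have h2 := norm_inner_le_norm (𝕜 := ℂ) S.vac (Mpc.U S m S.vac)
  rw [h1, LinearIsometryEquiv.norm_map, ← sq, norm_sq_vac, norm_mul, Complex.norm_real,
    Real.norm_eq_abs, abs_of_pos S.mass_pos] at h2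
  exact le_of_mul_le_mul_left (by rwa [mul_one]) S.mass_pos

theorem Mpc.norm_sq_U_vac_sub (m : S.Mpc) :
    ‖Mpc.U S m S.vac - S.vac‖ ^ 2 = 2 * S.mass * (1 - (Mpc.lam S m).re) := by
  have h1 : inner ℂ S.vac (Mpc.U S m S.vac) = S.mass * Mpc.lam S m := S.inner_vac _
  rw [norm_sub_sq (𝕜 := ℂ), LinearIsometryEquiv.norm_map, norm_sq_vac, ← inner_conj_symm, h1]
  simp
  ring

/-- `⟨z, ·⟩_j` as a real linear map. -/
def hermR (z : V) : V →L[ℝ] ℂ := LinearMap.toContinuousLinearMap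
  { toFun := fun w => S.herm z w
    map_add' := fun u v => S.herm_add_right z u v
    map_smul' := fun r v => by rw [herm_smul_right]; simp }

/-- For small `t` the linear part of `g` is invertible, so the Gaussian formula reaches every fixed
`z`. -/
theorem Mpc.hasDerivAt_U_vac {a : ℝ → S.Mpc} (h0 : a 0 = 1) {ξ : V →ₗ[ℝ] V}
    (hg : ∀ v, HasDerivAt (fun t => Mpc.σ S (a t) v) (ξ v) 0) {l' : ℂ}
    (hl : HasDerivAt (fun t => Mpc.lam S (a t)) l' 0) (z : V) :
    HasDerivAt (fun t => Mpc.U S (a t) S.vac z)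
      (l' + S.herm z (S.antiPart ξ z) / (4 * S.hbar)) 0 := by
  haveI : CompleteSpace V := FiniteDimensional.complete ℝ V
  have hσ0 : ∀ v, Mpc.σ S (a 0) v = v := fun v => by rw [h0]; rfl
  have hl0 : Mpc.lam S (a 0) = 1 := by rw [h0]; rfl
  set C : ℝ → V →L[ℝ] V := fun t =>
    LinearMap.toContinuousLinearMap (S.linPart (Mpc.σ S (a t) : V →ₗ[ℝ] V)) with hCdef
  set D : ℝ → V →L[ℝ] V := fun t =>
    LinearMap.toContinuousLinearMap (S.antiPart (Mpc.σ S (a t) : V →ₗ[ℝ] V)) with hDdef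
  have hj : ∀ v, HasDerivAt (fun t => S.j (Mpc.σ S (a t) (S.j v))) (S.j (ξ (S.j v))) 0 := fun v =>
    (LinearMap.toContinuousLinearMap S.j).hasFDerivAt.comp_hasDerivAt (0 : ℝ) (hg (S.j v))
  have hC : HasDerivAt C (LinearMap.toContinuousLinearMap (S.linPart ξ)) 0 :=
    hasDerivAt_of_forall_apply fun v => ((hg v).sub (hj v)).const_smul (1 / 2 : ℝ)
  have hD : HasDerivAt D (LinearMap.toContinuousLinearMap (S.antiPart ξ)) 0 :=
    hasDerivAt_of_forall_apply fun v => ((hg v).add (hj v)).const_smul (1 / 2 : ℝ)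
  have hC0 : C 0 = 1 := by
    ext v
    simp only [hCdef, LinearMap.coe_toContinuousLinearMap', linPart, LinearMap.smul_apply,
      LinearMap.sub_apply, LinearMap.comp_apply, LinearEquiv.coe_coe, hσ0, S.j_sq]
    change _ = v
    module
  have hD0 : D 0 = 0 := by
    ext v
    simp only [hDdef, LinearMap.coe_toContinuousLinearMap', antiPart, LinearMap.smul_apply,
      LinearMap.add_apply, LinearMap.comp_apply, LinearEquiv.coe_coe, hσ0, S.j_sq]
    simp
  -- Only the existence of this derivative matters: it is multiplied by the antilinear part, which
  -- vanishes at `t = 0`.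
  have hy : ∃ y', HasDerivAt (fun t => Ring.inverse (C t) z) y' 0 := by
    have h1 : ∃ L, HasFDerivAt (𝕜 := ℝ) (Ring.inverse : (V →L[ℝ] V) → (V →L[ℝ] V)) L (C 0) := by
      rw [hC0]
      exact ⟨_, hasFDerivAt_ringInverse (1 : (V →L[ℝ] V)ˣ)⟩
    obtain ⟨L, h1⟩ := h1
    exact ⟨_, (h1.comp_hasDerivAt 0 hC).clm_apply (hasDerivAt_const 0 z)⟩
  obtain ⟨y', hy⟩ := hy
  have hDy := hD.clm_apply hy
  rw [hD0, hC0, Ring.inverse_one] at hDy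
  have hexp := ((((S.hermR z).hasFDerivAt.comp_hasDerivAt (0 : ℝ) hDy).div_const
    ((4 * S.hbar : ℂ))).cexp)
  have hfin := hl.mul hexp
  have e : ∀ᶠ t in 𝓝 0, Mpc.U S (a t) S.vac z = Mpc.lam S (a t) *
      Complex.exp (S.hermR z (D t (Ring.inverse (C t) z)) / (4 * S.hbar)) := by
    have hu : ∀ᶠ t in 𝓝 0, IsUnit (C t) := by
      refine hC.continuousAt.eventually (Units.isOpen.mem_nhds ?_)
      rw [hC0]
      exact isUnit_one
    filter_upwards [hu] with t ht
    have h1 : C t (Ring.inverse (C t) z) = z :=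
      congrArg (fun L : V →L[ℝ] V => L z) (Ring.mul_inverse_cancel _ ht)
    have h2 := Mpc.U_vac_linPart S (a t) (Ring.inverse (C t) z)
    have h3 : S.linPart (Mpc.σ S (a t) : V →ₗ[ℝ] V) (Ring.inverse (C t) z) = z := h1
    rw [h3] at h2
    exact h2
  refine (hfin.congr_of_eventuallyEq e).congr_deriv ?_
  simp only [Function.comp_def, hD0, hl0, zero_apply, map_zero, zero_div, Complex.exp_zero,
    mul_one, one_mul, add_zero]
  rfl

/-- The squared distance is proportional to `1 - Re λ`, which is non-negative and vanishes at `t =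
0`, hence of second order in `t`. This is the bound required by `tendsto_inner_of_bounded`. -/
theorem Mpc.eventually_norm_U_vac_sub_le {a : ℝ → S.Mpc} (h0 : a 0 = 1) {l : ℝ → ℂ} {d : ℂ}
    (hl : ∀ᶠ t in 𝓝 0, HasDerivAt (fun t => Mpc.lam S (a t)) (l t) t) (hd : HasDerivAt l d 0) :
    ∃ c : ℝ, ∀ᶠ t in 𝓝[≠] (0 : ℝ), ‖Mpc.U S (a t) S.vac - S.vac‖ ≤ c * |t| := by
  have hl0 : Mpc.lam S (a 0) = 1 := by rw [h0]; rfl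
  have h1 := (tendsto_second_difference hl hd).norm.eventually
    (gt_mem_nhds (lt_add_one ‖d‖))
  refine ⟨Real.sqrt (2 * S.mass * (‖d‖ + 1)), ?_⟩
  filter_upwards [h1, self_mem_nhdsWithin] with t ht ht0
  have ht0 : t ≠ 0 := ht0
  have ht2 : 0 < t ^ 2 := by positivity
  rw [norm_smul, norm_inv, Real.norm_eq_abs, abs_of_pos ht2, inv_mul_lt_iff₀ ht2, hl0] at ht
  have h2 := (Complex.abs_re_le_norm _).trans ht.le
  have h3 := (abs_le.1 h2).1
  have h4 := (Complex.re_le_norm _).trans (Mpc.norm_lam_le S (a (-t)))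
  -- The second difference controls `λ(t) + λ(-t) - 2`, and `Re λ(-t) ≤ 1` removes the term at `-t`.
  have h5 : 1 - (Mpc.lam S (a t)).re ≤ t ^ 2 * (‖d‖ + 1) := by
    simp at h3
    linarith
  refine abs_le_of_sq_le_sq' ?_ (by positivity) |>.2
  rw [Mpc.norm_sq_U_vac_sub, mul_pow, Real.sq_sqrt, sq_abs]
  · have := mul_le_mul_of_nonneg_left h5 (mul_nonneg zero_le_two S.mass_pos.le)
    linarith
  · have := S.mass_pos
    positivity

/-- `Re λ ≤ 1` with equality at the identity, so `t = 0` is a maximum. -/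
theorem Mpc.re_deriv_lam_eq_zero {a : ℝ → S.Mpc} (h0 : a 0 = 1) {l' : ℂ}
    (hl : HasDerivAt (fun t => Mpc.lam S (a t)) l' 0) : l'.re = 0 := by
  have hl0 : Mpc.lam S (a 0) = 1 := by rw [h0]; rfl
  have h1 : HasDerivAt (fun t => (Mpc.lam S (a t)).re) l'.re 0 :=
    Complex.reCLM.hasFDerivAt.comp_hasDerivAt (0 : ℝ) hl
  refine IsLocalMax.hasDerivAt_eq_zero (Eventually.of_forall fun t => ?_) h1
  rw [hl0]
  exact (Complex.re_le_norm _).trans (Mpc.norm_lam_le S (a t))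

/-- A product rule with one weakly differentiable factor. It holds because the other factor is
differentiable in norm and `U vac` still tends to the vacuum in norm. -/
theorem Mpc.hasDerivAt_inner_U_vac {a : ℝ → S.Mpc} (h0 : a 0 = 1) {ξ : V →ₗ[ℝ] V}
    (hg : ∀ v, HasDerivAt (fun t => Mpc.σ S (a t) v) (ξ v) 0) {l : ℝ → ℂ} {d : ℂ}
    (hl : ∀ᶠ t in 𝓝 0, HasDerivAt (fun t => Mpc.lam S (a t)) (l t) t) (hd : HasDerivAt l d 0)
    {w : S.Fock} (hw : ∀ q, w q = l 0 + S.herm q (S.antiPart ξ q) / (4 * S.hbar))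
    {F : ℝ → S.Fock} {F' : S.Fock} (hF : HasDerivAt F F' 0) :
    HasDerivAt (fun t => inner ℂ (Mpc.U S (a t) S.vac) (F t))
      (inner ℂ w (F 0) + inner ℂ S.vac F') 0 := by
  obtain ⟨c, hc⟩ := Mpc.eventually_norm_U_vac_sub_le S h0 hl hd
  have hU0 : Mpc.U S (a 0) S.vac = S.vac := by rw [h0]; rfl
  have h1 := S.tendsto_inner_of_bounded (l := 𝓝[≠] (0 : ℝ))
    (fun t : ℝ => (t : ℂ)⁻¹ • (Mpc.U S (a t) S.vac - S.vac)) w c ?_ ?_ (F 0)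
  · have h2 : Tendsto (fun t => Mpc.U S (a t) S.vac) (𝓝[≠] 0) (𝓝 S.vac) := by
      rw [tendsto_iff_norm_sub_tendsto_zero]
      refine squeeze_zero' (Eventually.of_forall fun _ => norm_nonneg _) hc ?_
      have : Tendsto (fun t : ℝ => c * |t|) (𝓝 0) (𝓝 (c * |0|)) :=
        (continuous_const.mul continuous_abs).tendsto _
      rw [abs_zero, mul_zero] at this
      exact this.mono_left nhdsWithin_le_nhds
    rw [hasDerivAt_iff_tendsto_slope]
    refine (h1.add (h2.inner (𝕜 := ℂ) hF.tendsto_slope)).congr fun t => ?_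
    simp only [slope_def_module, hU0, sub_zero]
    have e : ((t⁻¹ : ℝ) • (F t - F 0) : S.Fock) = ((t⁻¹ : ℝ) : ℂ) • (F t - F 0) := rfl
    rw [e, inner_smul_left, inner_smul_right, inner_sub_left, inner_sub_right, Complex.real_smul,
      map_inv₀, Complex.conj_ofReal]
    push_cast
    ring
  · filter_upwards [hc, self_mem_nhdsWithin] with t ht ht0
    have ht0 : t ≠ 0 := ht0
    rw [norm_smul, norm_inv, Complex.norm_real, Real.norm_eq_abs, inv_mul_le_iff₀ (abs_pos.2 ht0)]
    linarith
  · intro z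
    have h3 := (Mpc.hasDerivAt_U_vac S h0 hg hl.self_of_nhds z).tendsto_slope
    rw [hw]
    refine h3.congr fun t => ?_
    have e : ((t : ℂ)⁻¹ • (Mpc.U S (a t) S.vac - S.vac) : S.Fock) z =
      (t : ℂ)⁻¹ * (Mpc.U S (a t) S.vac z - S.vac z) := rfl
    rw [e, slope_def_module, hU0, sub_zero, Complex.real_smul]
    push_cast
    rfl

/-- The quadratic function is the derivative of the Gaussian exponent. Both requirements are linear
in `ξ`, so rank-one elements suffice; there `w` is a multiple of `ellSq x`, and the correction term
of `inner_ellSq` is half the complex trace. -/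
theorem exists_quadratic (ξ : Module.End ℝ V) (hξ : ∀ v w, S.Ω (ξ v) w = -S.Ω v (ξ w)) :
    ∃ w : S.Fock, (∀ q, w q = S.herm q (S.antiPart ξ q) / (4 * S.hbar)) ∧ ∀ f : S.Smooth,
      inner ℂ w (f : S.Fock) =
        S.mass * (-(S.clAlg (S.nu ξ) f : S.Fock) 0 - S.trC ξ / 2 * (f : S.Fock) 0) := by
  refine S.sp_induction (P := fun ξ => ∃ w : S.Fock, (∀ q, w q =
    S.herm q (S.antiPart ξ q) / (4 * S.hbar)) ∧ ∀ f : S.Smooth, inner ℂ w (f : S.Fock) =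
        S.mass * (-(S.clAlg (S.nu ξ) f : S.Fock) 0 - S.trC ξ / 2 * (f : S.Fock) 0))
    ?_ ?_ ?_ ξ hξ
  · rintro ξ η ⟨w, hw, hw'⟩ ⟨u, hu, hu'⟩
    refine ⟨w + u, fun q => ?_, fun f => ?_⟩
    · have e : S.antiPart (ξ + η) q = S.antiPart ξ q + S.antiPart η q := by
        simp only [antiPart, LinearMap.smul_apply, LinearMap.add_apply, LinearMap.comp_apply,
          map_add]
        module
      rw [Fock.add_apply, hw, hu, e, herm_add_right, add_div]
    · have e : (S.clAlg (S.nu (ξ + η)) f : S.Fock) 0 =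
          (S.clAlg (S.nu ξ) f : S.Fock) 0 + (S.clAlg (S.nu η) f : S.Fock) 0 := by
        rw [nu_add, map_add]; rfl
      rw [inner_add_left, hw', hu', e, trC_add]
      ring
  · rintro r ξ ⟨w, hw, hw'⟩
    refine ⟨(r : ℂ) • w, fun q => ?_, fun f => ?_⟩
    · have e : S.antiPart (r • ξ) q = r • S.antiPart ξ q := by
        simp only [antiPart, LinearMap.smul_apply, LinearMap.add_apply, LinearMap.comp_apply,
          map_smul]
        module
      rw [Fock.smul_apply, hw, e, herm_smul_right, mul_div_assoc]
    · have e : (S.clAlg (S.nu (r • ξ)) f : S.Fock) 0 = r * (S.clAlg (S.nu ξ) f : S.Fock) 0 := by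
        rw [nu_smul, map_smul]; rfl
      rw [inner_smul_left, hw', e, trC_smul, Complex.conj_ofReal]
      ring
  · intro x
    have hh := S.hbar_ne_zero
    refine ⟨(-(Complex.I * S.hbar / 2)) • S.ellSq x, fun q => ?_, fun f => ?_⟩
    · have e : S.herm q x = S.Ω x (S.j q) + Complex.I * S.Ω x q := by
        rw [herm, S.metric_symm q x, S.skew q x]; push_cast; ring
      have e2 : S.herm q (S.antiPart (S.rankOne x x) q) =
          -(Complex.I / 2) * S.herm q x * S.herm q x := by
        simp only [antiPart, rankOne, LinearMap.smul_apply, LinearMap.add_apply,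
          LinearMap.comp_apply, LinearMap.smulRight_apply, map_smul, herm_smul_right,
          herm_add_right, herm_j_right]
        have e3 : -(Complex.I / 2) * S.herm q x =
            (1 / 2) * (S.Ω x q + S.Ω x (S.j q) * -Complex.I) := by
          rw [e]
          linear_combination (-(S.Ω x q : ℂ) / 2) * Complex.I_sq
        rw [e3]
        push_cast
        ring
      rw [Fock.smul_apply, ellSq_apply, e2]
      field_simp
      ring
    · have e : (S.clAlg (S.nu (S.rankOne x x)) f : S.Fock) 0 =
          (-(Complex.I * S.hbar / 2)) * (S.cl x (S.cl x f) : S.Fock) 0 := by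
        rw [clAlg_nu_rankOne]; rfl
      have ec : (starRingEnd ℂ) (-(Complex.I * S.hbar / 2)) = Complex.I * S.hbar / 2 := by
        simp [Complex.conj_ofNat]
        ring
      rw [inner_smul_left, inner_ellSq, e, trC_rankOne, ec]
      field_simp
      ring

/-- Translation changes the quadratic operator `ν(ξ)` by a linear and a constant term. In
`Lift.leftDeriv_incl` these cancel the terms arising from the motion of the base point `z`. -/
theorem clAlg_nu_heisS (ξ : Module.End ℝ V) (hξ : ∀ v w, S.Ω (ξ v) w = -S.Ω v (ξ w)) (z : V)
    (f : S.Smooth) : S.clAlg (S.nu ξ) (S.heisS (-z, 0) f) = S.heisS (-z, 0)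
      (S.clAlg (S.nu ξ) f - S.cl (ξ z) f -
        (Complex.I * S.Ω z (ξ z) / (2 * S.hbar)) • f) := by
  have hadd : ∀ f g : S.Smooth, S.heisS (-z, 0) (f + g) = S.heisS (-z, 0) f + S.heisS (-z, 0) g :=
    fun f g => Subtype.ext (map_add (S.heis (-z, 0)) (f : S.Fock) (g : S.Fock))
  have hsmul : ∀ (c : ℂ) (f : S.Smooth), S.heisS (-z, 0) (c • f) = c • S.heisS (-z, 0) f :=
    fun c f => Subtype.ext (map_smul (S.heis (-z, 0)) c (f : S.Fock))
  refine S.sp_induction (P := fun ξ => S.clAlg (S.nu ξ) (S.heisS (-z, 0) f) = S.heisS (-z, 0)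
      (S.clAlg (S.nu ξ) f - S.cl (ξ z) f -
        (Complex.I * S.Ω z (ξ z) / (2 * S.hbar)) • f)) ?_ ?_ ?_ ξ hξ
  · intro ξ η h1 h2
    rw [nu_add, map_add, LinearMap.add_apply, h1, h2, ← hadd]
    congr 1
    simp only [LinearMap.add_apply, cl_add, map_add]
    push_cast
    module
  · intro r ξ h1
    rw [nu_smul, map_smul, LinearMap.smul_apply, h1, ← hsmul]
    congr 1
    simp only [LinearMap.smul_apply, cl_smul, map_smul, smul_eq_mul]
    push_cast
    module
  · intro x
    have hh := S.hbar_ne_zero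
    have e1 : ∀ f : S.Smooth, S.cl x (S.heisS (-z, 0) f) =
        S.heisS (-z, 0) (S.cl x f - (Complex.I * S.Ω x z / S.hbar) • f) := by
      intro f
      rw [cl_heisS]
      congr 1
      simp only [map_neg]
      push_cast
      module
    rw [clAlg_nu_rankOne]
    simp only [LinearMap.smul_apply, Module.End.mul_apply, e1]
    rw [← hsmul]
    congr 1
    simp only [rankOne, LinearMap.smulRight_apply, map_sub, map_smul, cl_smul,
      LinearMap.smul_apply, smul_eq_mul, S.skew z x]
    match_scalars <;> field_simp <;> push_cast <;> ring_nf <;> simp <;> ring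

end FockModel

end

end MpcDirac

/-! ### Infinitesimal equivariance of spinor fields. -/

namespace MpcDirac

open Filter Topology

noncomputable section

variable {E EK V : Type*} [NormedAddCommGroup E] [NormedSpace ℝ E] [NormedAddCommGroup EK]
  [NormedSpace ℝ EK] [NormedAddCommGroup V] [NormedSpace ℝ V] [FiniteDimensional ℝ V]
  {G : Type*} [TopologicalSpace G] [ChartedSpace E G] [Group G] [LieGroup 𝓘(ℝ, E) ∞ G]
  {S : FockModel V} {K : Subgroup G} [ChartedSpace EK K] [LieGroup 𝓘(ℝ, EK) ∞ K] [CompleteSpace E]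

theorem contMDiff_detC {N : Type*} [TopologicalSpace N] [ChartedSpace EK N]
    {g : N → V →ₗ[ℝ] V} (h : ∀ v, ContMDiff 𝓘(ℝ, EK) 𝓘(ℝ, V) ∞ fun x => g x v) :
    ContMDiff 𝓘(ℝ, EK) 𝓘(ℝ, ℂ) ∞ fun x => S.detC (g x) := by
  classical
  set b := Module.finBasis ℂ S.Cplx
  have hent : ContMDiff 𝓘(ℝ, EK) 𝓘(ℝ, Fin (Module.finrank ℂ S.Cplx) →
      Fin (Module.finrank ℂ S.Cplx) → ℂ) ∞
      fun x i k => LinearMap.toMatrix b b (S.linPartC (g x)) i k := by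
    refine contMDiff_pi_space.2 fun i => contMDiff_pi_space.2 fun k => ?_
    obtain ⟨c, hc⟩ := S.exists_coord_clm b i
    set v : V := (show V from b k)
    have hlin : ContDiff ℝ ∞ fun p : V × V => c ((1 / 2 : ℝ) • (p.1 - S.j p.2)) :=
      c.contDiff.comp ((contDiff_fst.sub
        ((LinearMap.toContinuousLinearMap S.j).contDiff.comp contDiff_snd)).const_smul (1 / 2 : ℝ))
    have h1 := hlin.contMDiff.comp ((h v).prodMk_space (h (S.j v)))
    refine h1.congr fun x => ?_
    rw [LinearMap.toMatrix_apply]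
    exact (hc _).symm
  have hD : ContDiff ℝ ∞ fun M : Fin (Module.finrank ℂ S.Cplx) →
      Fin (Module.finrank ℂ S.Cplx) → ℂ => (Matrix.of M).det := by
    simp only [Matrix.det_apply, Matrix.of_apply]
    fun_prop
  refine (hD.contMDiff.comp hent).congr fun x => ?_
  exact (LinearMap.det_toMatrix b (S.linPartC (g x))).symm

namespace SymplecticSymmetricSpace

variable {M : SymplecticSymmetricSpace E EK S K}

theorem Lift.U_twist (T : M.Lift) (χ : K →* Circle) (k : K) (f : S.Fock) :
    FockModel.Mpc.U S (T.twist χ k) f = (χ k : ℂ) • FockModel.Mpc.U S (T.hom k) f := rfl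

theorem Lift.σ_twist (T : M.Lift) (χ : K →* Circle) (k : K) (v : V) :
    FockModel.Mpc.σ S (T.twist χ k) v = M.τ k v := T.σ_hom k v

theorem Lift.U_twist_inv (T : M.Lift) (χ : K →* Circle) (k : K) (f : S.Fock) :
    FockModel.Mpc.U S (T.twist χ k) (FockModel.Mpc.U S (T.twist χ k⁻¹) f) = f := by
  have h1 : FockModel.Mpc.U S (T.hom k) (FockModel.Mpc.U S (T.hom k⁻¹) f) =
      FockModel.Mpc.U S (T.hom k * T.hom k⁻¹) f := rfl
  rw [U_twist, U_twist, map_smul, smul_smul, h1, ← map_mul, mul_inv_cancel, map_one, ← Circle.coe_mul,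
    ← map_mul, mul_inv_cancel, map_one, Circle.coe_one, one_smul]
  rfl

theorem Lift.twist_one (T : M.Lift) (χ : K →* Circle) : T.twist χ 1 = 1 := by
  have h : FockModel.Mpc.ofCircle S 1 = 1 := by
    refine Subtype.ext (Prod.ext (LinearIsometryEquiv.ext fun f => ?_) rfl)
    exact (congrArg (fun c : ℂ => c • f) Circle.coe_one).trans (one_smul ℂ f)
  rw [twist, map_one, map_one, h, one_mul]

theorem Lift.contMDiff_lam_twist (T : M.Lift) {χ : K →* Circle}
    (hχ : ContMDiff 𝓘(ℝ, EK) 𝓘(ℝ, ℂ) ∞ fun k => (χ k : ℂ)) :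
    ContMDiff 𝓘(ℝ, EK) 𝓘(ℝ, ℂ) ∞ fun k => FockModel.Mpc.lam S (T.twist χ k) := by
  have h1 : ContDiff ℝ ∞ fun p : ℂ × ℂ => p.1 * p.2 := contDiff_fst.mul contDiff_snd
  exact h1.contMDiff.comp (hχ.prodMk_space T.smooth_lam)

theorem Lift.contMDiff_canChar (T : M.Lift) {χ : K →* Circle}
    (hχ : ContMDiff 𝓘(ℝ, EK) 𝓘(ℝ, ℂ) ∞ fun k => (χ k : ℂ)) :
    ContMDiff 𝓘(ℝ, EK) 𝓘(ℝ, ℂ) ∞ (T.canChar χ) := by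
  have h1 : ContDiff ℝ ∞ fun p : ℂ × ℂ => p.1 ^ 2 * p.2 := (contDiff_fst.pow 2).mul contDiff_snd
  have h2 : ContMDiff 𝓘(ℝ, EK) 𝓘(ℝ, ℂ) ∞
      fun k => S.detC (FockModel.Mpc.σ S (T.twist χ k) : V →ₗ[ℝ] V) :=
    contMDiff_detC fun v => T.smooth_σ v
  have h3 := h1.contMDiff.comp ((T.contMDiff_lam_twist hχ).prodMk_space h2)
  exact h3.congr fun k => rfl

theorem dM_coe_curve (M : SymplecticSymmetricSpace E EK S K) {c : ℝ → K} (hc0 : c 0 = 1)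
    (hc : ContMDiffAt 𝓘(ℝ, ℝ) 𝓘(ℝ, EK) ∞ c 0) {W : GroupLieAlgebra 𝓘(ℝ, EK) K}
    (hW : dM ℝ EK c 0 1 = W) : dM ℝ E (fun t => (c t : G)) 0 1 = M.incl W := by
  have h2 := dM_comp (E₃ := E) (g := K.subtype) (0 : ℝ)
    (M.contMDiff_incl.mdifferentiable (by simp) (c 0)) (hc.mdifferentiableAt (by simp)) 1
  rw [hW, hc0] at h2
  exact h2

theorem hasDerivAt_mul_curve (M : SymplecticSymmetricSpace E EK S K) {c : ℝ → K} (hc0 : c 0 = 1)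
    (hc : ContMDiffAt 𝓘(ℝ, ℝ) 𝓘(ℝ, EK) ∞ c 0) {W : GroupLieAlgebra 𝓘(ℝ, EK) K}
    (hW : dM ℝ EK c 0 1 = W) (φ : SmoothFun E G S) (g : G) :
    HasDerivAt (fun t => (φ.1 (g * c t) : S.Fock))
      ((leftDeriv S (M.incl W) φ).1 g : S.Fock) 0 := by
  have hφ : MDifferentiable 𝓘(ℝ, E) 𝓘(ℝ, S.Fock) fun h => (φ.1 h : S.Fock) :=
    (SmoothFun.contMDiff φ.2).mdifferentiable (by simp)
  have hκ : ContMDiffAt 𝓘(ℝ, ℝ) 𝓘(ℝ, E) ∞ (fun t => (c t : G)) 0 :=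
    ContMDiffAt.comp 0 (g := K.subtype) (f := c) (M.contMDiff_incl _) hc
  have h1 := hasDerivAt_comp_curve (f := fun h => (φ.1 (g * h) : S.Fock))
    (c := fun t => (c t : G)) (t := 0)
    ((hφ (g * c 0)).comp _ (mdifferentiable_mul_left g _)) (hκ.mdifferentiableAt (by simp))
  rw [M.dM_coe_curve hc0 hc hW, hc0] at h1
  refine h1.congr_deriv ?_
  exact (dM_mulInvariantVectorField g (hφ g) (M.incl W)).symm

/-- Equivariance makes `U(a t) φ(g c(t))` constant. Evaluating at `z` is pairing with a translated
vacuum, and unitarity moves the operator onto the vacuum, where its derivative is known. The field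
is therefore differentiated without differentiating the operators themselves. -/
theorem Lift.leftDeriv_incl (T : M.Lift) {χ : K →* Circle}
    (hχ : ContMDiff 𝓘(ℝ, EK) 𝓘(ℝ, ℂ) ∞ fun k => (χ k : ℂ)) {φ : SmoothFun E G S}
    (hφ : T.IsSpinorField χ φ) (W : GroupLieAlgebra 𝓘(ℝ, EK) K) (g : G) :
    (leftDeriv S (M.incl W) φ).1 g =
      -(M.clNuAd W (φ.1 g) + (T.canCharLie χ W / 2) • φ.1 g) := by
  obtain ⟨c, hc0, hc, hW⟩ := exists_curve_K W
  set a : ℝ → S.Mpc := fun t => T.twist χ (c t) with ha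
  have ha0 : a 0 = 1 := by rw [ha]; simp only [hc0, twist_one]
  have hg : ∀ v, HasDerivAt (fun t => FockModel.Mpc.σ S (a t) v) (M.adp W v) 0 := fun v =>
    M.hasDerivAt_curve_τ T hc0 hc hW v |>.congr_of_eventuallyEq
      (Eventually.of_forall fun t => T.σ_twist χ (c t) v)
  have hlam : ContDiffAt ℝ 2 (fun t => FockModel.Mpc.lam S (a t)) 0 :=
    ((ContMDiffAt.comp 0 (g := fun k => FockModel.Mpc.lam S (T.twist χ k)) (f := c)
      (T.contMDiff_lam_twist hχ _) hc).contDiffAt).of_le (by simpa using ENat.LEInfty.out)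
  set l : ℝ → ℂ := deriv fun t => FockModel.Mpc.lam S (a t) with hl
  have hl1 : ∀ᶠ t in 𝓝 0, HasDerivAt (fun t => FockModel.Mpc.lam S (a t)) (l t) t := by
    filter_upwards [hlam.eventually (by simp)] with t ht
    exact (ht.differentiableAt (by simp)).hasDerivAt
  have hl2 : DifferentiableAt ℝ l 0 := by
    have h := ((hlam.fderiv_right (m := 1) (by norm_num)).differentiableAt (by simp)).clm_apply
      (differentiableAt_const (1 : ℝ))
    exact h
  have hre := FockModel.Mpc.re_deriv_lam_eq_zero S ha0 hl1.self_of_nhds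
  have hξ : ∀ v w, S.Ω (M.adp W v) w = -S.Ω v (M.adp W w) := fun v w =>
    eq_neg_of_add_eq_zero_left (M.Ω_adp T W v w)
  -- The differential of `η = λ² det` at the identity, where `λ` and the determinant both equal 1.
  have hchar : T.canCharLie χ W = 2 * l 0 + S.trC (M.adp W) := by
    have h1 := hasDerivAt_comp_curve (f := T.canChar χ) (c := c) (t := 0)
      ((T.contMDiff_canChar hχ).mdifferentiable (by simp) _) (hc.mdifferentiableAt (by simp))
    rw [hW, hc0] at h1
    have h2 := S.hasDerivAt_detC (g := fun t => (FockModel.Mpc.σ S (a t) : V →ₗ[ℝ] V))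
      (fun v => by rw [ha0]; rfl) hg
    have h3 := (hl1.self_of_nhds.pow 2).mul h2
    have h4 : S.detC (FockModel.Mpc.σ S (a 0) : V →ₗ[ℝ] V) = 1 := by
      have : S.linPartC (FockModel.Mpc.σ S (a 0) : V →ₗ[ℝ] V) = LinearMap.id := by
        refine LinearMap.ext fun v => ?_
        have h5 : ∀ v : V, S.linPart (FockModel.Mpc.σ S (a 0) : V →ₗ[ℝ] V) v = v := fun v => by
          rw [ha0]
          simp only [FockModel.linPart, LinearMap.smul_apply, LinearMap.sub_apply,
            LinearMap.comp_apply]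
          change (1 / 2 : ℝ) • (v - S.j (S.j v)) = v
          rw [S.j_sq]
          module
        exact h5 v
      rw [FockModel.detC, this, LinearMap.det_id]
    have h5 : FockModel.Mpc.lam S (a 0) = 1 := by rw [ha0]; rfl
    refine (h1.unique h3).trans ?_
    rw [h4, Pi.pow_apply, h5]
    push_cast
    ring
  obtain ⟨w, hw, hw'⟩ := S.exists_quadratic (M.adp W) hξ
  refine Subtype.ext (FockModel.Fock.ext fun z => ?_)
  set f := φ.1 g with hf
  -- The operator `U(a t)` turns translation by `-z` into translation by `-τ(c t) z`, so `F` is an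
  -- orbit curve of the fixed smooth vector `f` and is differentiable in norm.
  set F : ℝ → S.Fock := fun t => S.heis (-(M.τ (c t) z), 0) (f : S.Fock) with hFdef
  have hF : HasDerivAt F (S.heis (-z, 0) (S.cl (-(M.adp W z)) f : S.Fock) -
      (Complex.I * (0 + S.Ω (-z) (-(M.adp W z)) / 2 : ℝ) / S.hbar) •
        S.heis (-z, 0) (f : S.Fock)) 0 := by
    have h1 : HasDerivAt (fun t => ((-(M.τ (c t) z), 0) : V × ℝ)) (-(M.adp W z), 0) 0 :=
      (M.hasDerivAt_curve_τ T hc0 hc hW z).neg.prodMk (hasDerivAt_const _ _)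
    have h0 := ((S.contDiff_heis f).differentiable (by simp)
      ((-(M.τ (c 0) z), 0) : V × ℝ)).hasFDerivAt
    have h2 := h0.comp_hasDerivAt (f := fun t => ((-(M.τ (c t) z), 0) : V × ℝ)) (0 : ℝ) h1
    refine h2.congr_deriv ?_
    rw [hc0, M.τ_one, S.fderiv_heis]
  have hF0 : F 0 = S.heis (-z, 0) (f : S.Fock) := by rw [hFdef]; simp only [hc0, M.τ_one]
  have key := FockModel.Mpc.hasDerivAt_inner_U_vac S ha0 hg hl1 hl2.hasDerivAt
    (w := l 0 • S.vac + w) (fun q => by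
      rw [FockModel.Fock.add_apply, FockModel.Fock.smul_apply, hw, show S.vac q = 1 from rfl,
        mul_one]) hF
  have hL : ∀ h : S.Fock, inner ℂ S.vac (S.heis (-z, 0) h) =
      S.mass * (Complex.exp (-((S.sqNorm z : ℂ) / (4 * S.hbar))) * h z) := fun h => by
    rw [S.inner_vac, S.heis_neg_apply_zero]
  have hleft : HasDerivAt (fun t => inner ℂ (FockModel.Mpc.U S (a t) S.vac) (F t))
      (inner ℂ S.vac (S.heis (-z, 0) ((leftDeriv S (M.incl W) φ).1 g : S.Fock))) 0 := by
    have h1 := ((innerSL ℂ S.vac).comp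
      (S.heis (-z, 0)).toContinuousLinearMap).restrictScalars ℝ |>.hasFDerivAt.comp_hasDerivAt
      (0 : ℝ) (M.hasDerivAt_mul_curve hc0 hc hW φ g)
    refine h1.congr_of_eventuallyEq (Eventually.of_forall fun t => ?_)
    have h2 : FockModel.Mpc.U S (a t) (φ.1 (g * c t) : S.Fock) = f := by
      rw [hφ g (c t)]
      exact T.U_twist_inv χ (c t) f
    have h3 : F t = FockModel.Mpc.U S (a t) (S.heis (-z, 0) (φ.1 (g * c t) : S.Fock)) := by
      rw [FockModel.Mpc.U_heis, h2, map_neg]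
      rw [hFdef]
      simp only [ha, T.σ_twist]
    change inner ℂ (FockModel.Mpc.U S (a t) S.vac) (F t) =
      inner ℂ S.vac (S.heis (-z, 0) (φ.1 (g * c t) : S.Fock))
    rw [h3, LinearIsometryEquiv.inner_map_map]
  have heq := hleft.unique key
  -- The derivative of `λ` is purely imaginary. It sits in the antilinear slot of the scalar product
  -- and therefore comes out with the sign required by `hchar`.
  have hconj : (starRingEnd ℂ) (l 0) = -l 0 := by
    refine Complex.ext ?_ ?_
    · simp [hre]
    · simp
  have hN := congrArg (fun f : S.Smooth => (f : S.Fock) 0) (S.clAlg_nu_heisS (M.adp W) hξ z f)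
  have hN' : (S.clAlg (S.nu (M.adp W)) (S.heisS (-z, 0) f) : S.Fock) 0 =
      Complex.exp (-((S.sqNorm z : ℂ) / (4 * S.hbar))) *
        ((S.clAlg (S.nu (M.adp W)) f : S.Fock) z - (S.cl (M.adp W z) f : S.Fock) z -
          (Complex.I * S.Ω z (M.adp W z) / (2 * S.hbar)) * (f : S.Fock) z) :=
    hN.trans (S.heis_neg_apply_zero z _)
  have hneg : (S.cl (-(M.adp W z)) f : S.Fock) z = -(S.cl (M.adp W z) f : S.Fock) z := by
    have h1 : S.cl (-(M.adp W z)) = (-1 : ℂ) • S.cl (M.adp W z) := by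
      have := S.cl_smul (-1) (M.adp W z)
      rw [neg_one_smul] at this
      rw [this]
      push_cast
      rfl
    rw [h1]
    change (-1 : ℂ) * (S.cl (M.adp W z) f : S.Fock) z = _
    ring
  have hw2 : inner ℂ w (S.heis (-z, 0) (f : S.Fock)) = _ := hw' (S.heisS (-z, 0) f)
  rw [hF0, inner_add_left, inner_smul_left, hw2, inner_sub_right,
    inner_smul_right, hN'] at heq
  change inner ℂ S.vac (S.heis (-z, 0) _) = (starRingEnd ℂ) (l 0) * inner ℂ S.vac
    (S.heis (-z, 0) (f : S.Fock)) + S.mass * (-_ - _ * (S.heis (-z, 0) (f : S.Fock)) 0) + _ at heq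
  rw [hL, hL, hL, hneg, S.heis_neg_apply_zero, hconj] at heq
  have hm := S.mass_ne_zero
  have hh := S.hbar_ne_zero
  have he := Complex.exp_ne_zero (-((S.sqNorm z : ℂ) / (4 * S.hbar)))
  have hgoal : ((-(M.clNuAd W f + (T.canCharLie χ W / 2) • f) : S.Smooth) : S.Fock) z =
      -((S.clAlg (S.nu (M.adp W)) f : S.Fock) z + T.canCharLie χ W / 2 * (f : S.Fock) z) := by
    rw [← neg_one_smul ℂ]
    change (-1 : ℂ) * ((S.clAlg (S.nu (M.adp W)) f : S.Fock) z +
      T.canCharLie χ W / 2 * (f : S.Fock) z) = _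
    ring
  rw [hgoal, hchar]
  refine mul_left_cancel₀ hm (mul_left_cancel₀ he ?_)
  simp only [map_neg, LinearMap.neg_apply, neg_neg, zero_add] at heq
  push_cast at heq
  linear_combination heq

end SymplecticSymmetricSpace

end

end MpcDirac

/-! ### The commutator of the Dirac operators. -/

namespace MpcDirac

noncomputable section

section Algebra

variable {V R ι : Type*} [NormedAddCommGroup V] [NormedSpace ℝ V] [FiniteDimensional ℝ V]
  (S : FockModel V) [Ring R] [Algebra ℂ R] [Fintype ι] [DecidableEq ι] (e : Module.Basis ι ℝ V)

/-- A real linear map to a complex vector space, from its complex homogeneity. -/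
def linearOfCast {L Q : Type*} [AddCommGroup L] [Module ℝ L] [AddCommGroup Q] [Module ℂ Q]
    (c : L → Q) (hadd : ∀ v w, c (v + w) = c v + c w)
    (hsmul : ∀ (r : ℝ) v, c (r • v) = (r : ℂ) • c v) : L →ₗ[ℝ] Q where
  toFun := c
  map_add' := hadd
  map_smul' := hsmul

/-- The product of two real linear maps to a complex algebra. -/
def mulBilin {L L' : Type*} [AddCommGroup L] [Module ℝ L] [AddCommGroup L'] [Module ℝ L']
    (c : L →ₗ[ℝ] R) (d : L' →ₗ[ℝ] R) : L →ₗ[ℝ] L' →ₗ[ℝ] R :=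
  (LinearMap.mul ℝ R).compl₁₂ c d

theorem mulBilin_apply {L L' : Type*} [AddCommGroup L] [Module ℝ L] [AddCommGroup L'] [Module ℝ L']
    (c : L →ₗ[ℝ] R) (d : L' →ₗ[ℝ] R) (x : L) (y : L') : mulBilin c d x y = c x * d y := rfl

/-- Pure algebra: each pair of summands contributes a commutator of Clifford factors, contracted by
`Ω` through the dual basis, and a commutator of derivatives. -/
theorem clifford_sum_commutator {c p : V →ₗ[ℝ] R} (hcp : ∀ v w, c v * p w = p w * c v)
    (hcc : ∀ v w, c v * c w - c w * c v = ((Complex.I / S.hbar) * (S.Ω v w : ℂ)) • (1 : R))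
    (A : V → V) :
    (∑ a, c (e a) * p (S.dualBasis e a)) * (∑ b, c (A (e b)) * p (S.dualBasis e b)) -
      (∑ b, c (A (e b)) * p (S.dualBasis e b)) * (∑ a, c (e a) * p (S.dualBasis e a)) =
    (Complex.I / S.hbar) • ∑ b, p (A (e b)) * p (S.dualBasis e b) +
      ∑ b, ∑ a, c (A (e b)) * c (e a) * (p (S.dualBasis e a) * p (S.dualBasis e b) -
        p (S.dualBasis e b) * p (S.dualBasis e a)) := by
  have h1 : ∀ b, p (A (e b)) = ∑ a, (S.Ω (e a) (A (e b)) : ℂ) • p (S.dualBasis e a) := fun b => by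
    conv_lhs => rw [← sum_Ω_basis S e (A (e b)), map_sum]
    exact Finset.sum_congr rfl fun a _ => map_smul p _ _
  have h2 : ∀ v w x y : V, c v * p x * (c w * p y) - c w * p y * (c v * p x) =
      ((Complex.I / S.hbar) * (S.Ω v w : ℂ)) • (p x * p y) +
        c w * c v * (p x * p y - p y * p x) := fun v w x y => by
    have h3 : c v * p x * (c w * p y) = c v * c w * (p x * p y) := by
      rw [mul_assoc, ← mul_assoc (p x), ← hcp w x, mul_assoc (c w), ← mul_assoc]
    have h4 : c w * p y * (c v * p x) = c w * c v * (p y * p x) := by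
      rw [mul_assoc, ← mul_assoc (p y), ← hcp v y, mul_assoc (c v), ← mul_assoc]
    have h5 := congrArg (fun q => q * (p x * p y)) (hcc v w)
    simp only [smul_mul_assoc, one_mul, sub_mul] at h5
    rw [h3, h4, ← h5, mul_sub]
    abel
  rw [Finset.sum_mul_sum, Finset.sum_mul_sum, Finset.sum_comm, ← Finset.sum_sub_distrib,
    Finset.smul_sum, ← Finset.sum_add_distrib]
  refine Finset.sum_congr rfl fun b _ => ?_
  rw [← Finset.sum_sub_distrib, h1, Finset.sum_mul, Finset.smul_sum, ← Finset.sum_add_distrib]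
  refine Finset.sum_congr rfl fun a _ => ?_
  rw [h2, smul_mul_assoc, smul_smul]

end Algebra

variable {E EK V : Type*} [NormedAddCommGroup E] [NormedSpace ℝ E] [NormedAddCommGroup EK]
  [NormedSpace ℝ EK] [NormedAddCommGroup V] [NormedSpace ℝ V] [FiniteDimensional ℝ V]
  {G : Type*} [TopologicalSpace G] [ChartedSpace E G] [Group G] [LieGroup 𝓘(ℝ, E) ∞ G]
  {S : FockModel V} {K : Subgroup G} [ChartedSpace EK K] [CompleteSpace E]

section Quantization

variable (E G S)

theorem clFun_add (v w : V) : clFun (E := E) (G := G) S (v + w) = clFun S v + clFun S w :=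
  LinearMap.ext fun φ => Subtype.ext (funext fun g =>
    congrArg (fun T : Module.End ℂ S.Smooth => T (φ.1 g)) (S.cl_add v w))

theorem clFun_smul (r : ℝ) (v : V) : clFun (E := E) (G := G) S (r • v) = (r : ℂ) • clFun S v :=
  LinearMap.ext fun φ => Subtype.ext (funext fun g =>
    congrArg (fun T : Module.End ℂ S.Smooth => T (φ.1 g)) (S.cl_smul r v))

theorem clFun_commutator (v w : V) :
    clFun (E := E) (G := G) S v * clFun S w - clFun S w * clFun S v =
      ((Complex.I / S.hbar) * (S.Ω v w : ℂ)) • 1 :=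
  LinearMap.ext fun φ => Subtype.ext (funext fun g =>
    congrArg (fun T : Module.End ℂ S.Smooth => T (φ.1 g)) (S.cl_commutator v w))

variable {E G}

/-- The quantization of `ξ ∈ sp(V, Ω)` acting pointwise on the smooth functions `G → H^∞`. -/
def nuFun {ι : Type*} [Fintype ι] [DecidableEq ι] (e : Module.Basis ι ℝ V) (ξ : Module.End ℝ V) :
    Module.End ℂ (SmoothFun E G S) :=
  (-(Complex.I * S.hbar / 2)) • ∑ a, clFun S (e a) * clFun S (ξ (S.dualBasis e a))

theorem clAlg_nu_eq {ι : Type*} [Fintype ι] [DecidableEq ι] (e : Module.Basis ι ℝ V)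
    {ξ : Module.End ℝ V} (hξ : ∀ v w, S.Ω (ξ v) w = -S.Ω v (ξ w)) :
    S.clAlg (S.nu ξ) =
      (-(Complex.I * S.hbar / 2)) • ∑ a, S.cl (e a) * S.cl (ξ (S.dualBasis e a)) := by
  have h := sum_symmetrized_eq S e (Module.finBasis ℝ V)
    (mulBilin (linearOfCast S.cl S.cl_add S.cl_smul) (linearOfCast S.cl S.cl_add S.cl_smul)) hξ
  have h2 : ∑ a, (S.cl (Module.finBasis ℝ V a) *
      S.cl (ξ (S.dualBasis (Module.finBasis ℝ V) a)) +
      S.cl (ξ (S.dualBasis (Module.finBasis ℝ V) a)) * S.cl (Module.finBasis ℝ V a)) =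
      ((2 : ℝ) : ℂ) • (∑ a, S.cl (e a) * S.cl (ξ (S.dualBasis e a)) : Module.End ℂ S.Smooth) := h
  rw [FockModel.nu, map_smul, map_sum]
  simp only [map_add, map_mul, FockModel.clAlg_gen]
  rw [h2, smul_smul]
  congr 1
  push_cast
  ring

/-- It identifies the pointwise quantization with a polynomial in Clifford multiplications on
fields, which therefore commutes with left-invariant derivatives. -/
theorem nuFun_apply {ι : Type*} [Fintype ι] [DecidableEq ι] (e : Module.Basis ι ℝ V)
    {ξ : Module.End ℝ V} (hξ : ∀ v w, S.Ω (ξ v) w = -S.Ω v (ξ w)) (φ : SmoothFun E G S) (g : G) :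
    (nuFun S e ξ φ).1 g = S.clAlg (S.nu ξ) (φ.1 g) := by
  rw [clAlg_nu_eq S e hξ, nuFun, LinearMap.smul_apply, LinearMap.smul_apply, LinearMap.sum_apply,
    LinearMap.sum_apply]
  change (-(Complex.I * S.hbar / 2)) • (_ : S.Smooth) = _
  congr 1
  have h : ∀ s : Finset ι, (∑ a ∈ s, (clFun S (e a) * clFun S (ξ (S.dualBasis e a)) :
      Module.End ℂ (SmoothFun E G S)) φ).1 g =
      ∑ a ∈ s, (S.cl (e a) * S.cl (ξ (S.dualBasis e a))) (φ.1 g) := fun s => by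
    induction s using Finset.cons_induction with
    | empty => rfl
    | cons a s ha ih =>
      rw [Finset.sum_cons, Finset.sum_cons, ← ih]
      rfl
  exact h _

theorem nuFun_mul_leftDeriv {ι : Type*} [Fintype ι] [DecidableEq ι] (e : Module.Basis ι ℝ V)
    (ξ : Module.End ℝ V) (X : GroupLieAlgebra 𝓘(ℝ, E) G) :
    nuFun S e ξ * leftDeriv S X = leftDeriv S X * nuFun S e ξ := by
  rw [nuFun, smul_mul_assoc, mul_smul_comm, Finset.sum_mul, Finset.mul_sum]
  congr 1
  refine Finset.sum_congr rfl fun a _ => ?_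
  rw [mul_assoc, clFun_mul_leftDeriv, ← mul_assoc, clFun_mul_leftDeriv, mul_assoc]

end Quantization

namespace SymplecticSymmetricSpace

variable {M : SymplecticSymmetricSpace E EK S K}

/-- In the expansion of the bracket in a basis of 𝔨 the coefficients are `Ω(x, A⁻¹ ad(W) y)`. The
sum over the bases then carries `A` on one factor and `A⁻¹` on the other; as `A` is symplectic and
commutes with `ad W`, the two disappear. -/
theorem IsExtension.sum_clifford_lieP {R : Type*} [Ring R] [Algebra ℂ R] {A : V ≃ₗ[ℝ] V}
    {B : LinearMap.BilinForm ℝ (GroupLieAlgebra 𝓘(ℝ, E) G)} (h : M.IsExtension A B)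
    (hA : ∀ v w, S.Ω (A v) w = -S.Ω v (A w))
    (hAad : ∀ W v, A (M.adp W v) = M.adp W (A v))
    {ιV ιK : Type*} [Fintype ιV] [DecidableEq ιV] [Fintype ιK] [DecidableEq ιK]
    (e : Module.Basis ιV ℝ V) (w : Module.Basis ιK ℝ (GroupLieAlgebra 𝓘(ℝ, EK) K))
    (c : V →ₗ[ℝ] R) (f : GroupLieAlgebra 𝓘(ℝ, E) G →ₗ[ℝ] R) :
    ∑ b, ∑ a, c (A (e b)) * c (e a) *
      f (M.incl (M.lieP (S.dualBasis e a) (S.dualBasis e b))) =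
    ∑ r, ∑ s, (invGram (B.compl₁₂ M.incl.toLinearMap M.incl.toLinearMap) w r s : ℂ) •
      ((∑ a, c (e a) * c (M.adp (w r) (S.dualBasis e a))) * f (M.incl (w s))) := by
  set β := invGram (B.compl₁₂ M.incl.toLinearMap M.incl.toLinearMap) w
  have h1 : ∀ x y, f (M.incl (M.lieP x y)) = ∑ r, ∑ s,
      β r s • S.Ω x (A.symm (M.adp (w r) y)) • f (M.incl (w s)) := by
    intro x y
    have h2 := congrArg (fun U => f (M.incl U)) (h.sum_invGram_k w (M.lieP x y))
    simpa only [map_sum, map_smul, h.lieP_incl, mul_smul] using h2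
  have h3 : ∀ r, ∑ b, ∑ a, S.Ω (S.dualBasis e a) (A.symm (M.adp (w r) (S.dualBasis e b))) •
      (c (A (e b)) * c (e a)) = ∑ a, c (e a) * c (M.adp (w r) (S.dualBasis e a)) := by
    intro r
    have h4 : ∀ v, ∑ a, S.Ω (S.dualBasis e a) v • c (e a) = -c v := by
      intro v
      have h5 := congrArg c (sum_Ω_dualBasis S e v)
      simp only [map_sum, map_smul] at h5
      rw [← h5, ← Finset.sum_neg_distrib]
      refine Finset.sum_congr rfl fun a _ => ?_
      rw [S.skew, neg_smul]
    -- The sign from moving `A` across the dual pair cancels the sign in `h4`.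
    have h6 := sum_sp_eq S e (mulBilin c (c.comp (A.symm.toLinearMap ∘ₗ M.adp (w r)))) hA
    simp only [mulBilin_apply, LinearMap.comp_apply, LinearEquiv.coe_coe, ← hAad,
      A.symm_apply_apply] at h6
    simp only [← mul_smul_comm, ← Finset.mul_sum, h4, mul_neg]
    rw [Finset.sum_neg_distrib, h6, neg_neg]
  simp only [h1, Finset.mul_sum, ← h3, Finset.sum_mul, Finset.smul_sum, Complex.coe_smul]
  rw [Finset.sum_congr rfl fun b _ => Finset.sum_comm, Finset.sum_comm]
  refine Finset.sum_congr rfl fun r _ => ?_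
  rw [Finset.sum_congr rfl fun b _ => Finset.sum_comm, Finset.sum_comm]
  refine Finset.sum_congr rfl fun s _ => Finset.sum_congr rfl fun b _ =>
    Finset.sum_congr rfl fun a _ => ?_
  rw [mul_smul_comm, mul_smul_comm, smul_mul_assoc]

theorem IsExtension.casimir_g_mul {R : Type*} [Ring R] [Algebra ℂ R] {A : V ≃ₗ[ℝ] V}
    {B : LinearMap.BilinForm ℝ (GroupLieAlgebra 𝓘(ℝ, E) G)} (h : M.IsExtension A B)
    {ιV ιK ιG : Type*} [Fintype ιV] [DecidableEq ιV] [Fintype ιK] [DecidableEq ιK]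
    [Fintype ιG] [DecidableEq ιG] (e : Module.Basis ιV ℝ V)
    (w : Module.Basis ιK ℝ (GroupLieAlgebra 𝓘(ℝ, EK) K))
    (u : Module.Basis ιG ℝ (GroupLieAlgebra 𝓘(ℝ, E) G))
    (f : GroupLieAlgebra 𝓘(ℝ, E) G →ₗ[ℝ] R) :
    casimirImage B u f -
      ∑ r, ∑ s, (invGram (B.compl₁₂ M.incl.toLinearMap M.incl.toLinearMap) w r s : ℂ) •
        (f (M.incl (w r)) * f (M.incl (w s))) =
      ∑ a, f (M.vec (A (e a))) * f (M.vec (S.dualBasis e a)) :=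
  sub_eq_of_eq_add (h.casimir_g e w u (mulBilin f f))

/-- Equivariance is not involved yet. The identity must be available on all smooth functions, where
the derivatives along 𝔨 are still independent of the Clifford action. -/
theorem IsExtension.dirac_commutator {A : V ≃ₗ[ℝ] V}
    {B : LinearMap.BilinForm ℝ (GroupLieAlgebra 𝓘(ℝ, E) G)} (h : M.IsExtension A B)
    (hA : ∀ v w, S.Ω (A v) w = -S.Ω v (A w))
    (hAad : ∀ W v, A (M.adp W v) = M.adp W (A v))
    {ιV ιK ιG : Type*} [Fintype ιV] [DecidableEq ιV] [Fintype ιK] [DecidableEq ιK]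
    [Fintype ιG] [DecidableEq ιG] (e : Module.Basis ιV ℝ V)
    (w : Module.Basis ιK ℝ (GroupLieAlgebra 𝓘(ℝ, EK) K))
    (u : Module.Basis ιG ℝ (GroupLieAlgebra 𝓘(ℝ, E) G)) :
    M.dirac e * M.twistedDirac A.toLinearMap e - M.twistedDirac A.toLinearMap e * M.dirac e =
      (Complex.I / S.hbar) • (casimirImage B u (leftDeriv S) -
        ∑ r, ∑ s, (invGram (B.compl₁₂ M.incl.toLinearMap M.incl.toLinearMap) w r s : ℂ) •
          (leftDeriv S (M.incl (w r)) * leftDeriv S (M.incl (w s)))) +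
      (2 * Complex.I / S.hbar) • ∑ r, ∑ s,
        (invGram (B.compl₁₂ M.incl.toLinearMap M.incl.toLinearMap) w r s : ℂ) •
          (nuFun S e (M.adp (w r)) * leftDeriv S (M.incl (w s))) := by
  let c := linearOfCast (clFun (E := E) (G := G) S) (clFun_add E G S) (clFun_smul E G S)
  let f := linearOfCast (leftDeriv (E := E) (G := G) S) (leftDeriv_add S) (leftDeriv_smul S)
  have h1 := clifford_sum_commutator (R := Module.End ℂ (SmoothFun E G S)) S e (c := c) (p := f.comp M.vecL)
    (fun v w => clFun_mul_leftDeriv S v (M.vec w)) (clFun_commutator E G S) A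
  have h2 := h.casimir_g_mul (R := Module.End ℂ (SmoothFun E G S)) e w u f
  have h3 := h.sum_clifford_lieP (R := Module.End ℂ (SmoothFun E G S)) hA hAad e w c f
  have h4 : casimirImage B u (leftDeriv S) - ∑ r, ∑ s,
      (invGram (B.compl₁₂ M.incl.toLinearMap M.incl.toLinearMap) w r s : ℂ) •
        (leftDeriv S (M.incl (w r)) * leftDeriv S (M.incl (w s))) =
      ∑ b, leftDeriv S (M.vec (A (e b))) * leftDeriv S (M.vec (S.dualBasis e b)) := h2
  have h5 : M.dirac e * M.twistedDirac A.toLinearMap e -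
      M.twistedDirac A.toLinearMap e * M.dirac e = (Complex.I / S.hbar) •
        ∑ b, leftDeriv S (M.vec (A (e b))) * leftDeriv S (M.vec (S.dualBasis e b)) +
      ∑ b, ∑ a, clFun S (A (e b)) * clFun S (e a) *
        (leftDeriv S (M.vec (S.dualBasis e a)) * leftDeriv S (M.vec (S.dualBasis e b)) -
          leftDeriv S (M.vec (S.dualBasis e b)) * leftDeriv S (M.vec (S.dualBasis e a))) := h1
  have h6 : ∑ b, ∑ a, clFun S (A (e b)) * clFun S (e a) *
        leftDeriv S (M.incl (M.lieP (S.dualBasis e a) (S.dualBasis e b))) = ∑ r, ∑ s,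
      (invGram (B.compl₁₂ M.incl.toLinearMap M.incl.toLinearMap) w r s : ℂ) •
      ((∑ a, clFun S (e a) * clFun S (M.adp (w r) (S.dualBasis e a))) *
        leftDeriv S (M.incl (w s))) := h3
  rw [h5, h4]
  simp only [← leftDeriv_lie, ← incl_lieP]
  rw [h6]
  congr 1
  have hh := S.hbar_ne_zero
  simp only [Finset.smul_sum]
  refine Finset.sum_congr rfl fun r _ => Finset.sum_congr rfl fun s _ => ?_
  -- The factor `2i/ħ` undoes the normalisation `-iħ/2` of the quantization.
  rw [smul_comm, nuFun, smul_mul_assoc, smul_smul (2 * Complex.I / S.hbar),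
    show 2 * Complex.I / S.hbar * -(Complex.I * S.hbar / 2) = 1 by
      field_simp; rw [Complex.I_sq, neg_neg], one_smul]

variable [LieGroup 𝓘(ℝ, EK) ∞ K]

/-- The derivative of a spinor field along 𝔨 is not treated as a spinor field. Instead it is
rewritten through the quantization, and the second derivative passes through to `φ`; this reverses
the order of the two Clifford operators. -/
theorem Lift.leftDeriv_incl_mul (T : M.Lift) {χ : K →* Circle}
    (hχ : ContMDiff 𝓘(ℝ, EK) 𝓘(ℝ, ℂ) ∞ fun k => (χ k : ℂ)) {φ : SmoothFun E G S}
    (hφ : T.IsSpinorField χ φ) {ι : Type*} [Fintype ι] [DecidableEq ι] (e : Module.Basis ι ℝ V)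
    (U W : GroupLieAlgebra 𝓘(ℝ, EK) K) (g : G) :
    (leftDeriv S (M.incl U) (leftDeriv S (M.incl W) φ)).1 g =
      M.clNuAd W (M.clNuAd U (φ.1 g)) + (T.canCharLie χ U / 2) • M.clNuAd W (φ.1 g) +
        (T.canCharLie χ W / 2) • M.clNuAd U (φ.1 g) +
        (T.canCharLie χ W / 2 * (T.canCharLie χ U / 2)) • φ.1 g := by
  have hsp : ∀ U v w, S.Ω (M.adp U v) w = -S.Ω v (M.adp U w) := fun U v w =>
    eq_neg_of_add_eq_zero_left (M.Ω_adp T U v w)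
  have h1 : leftDeriv S (M.incl W) φ =
      -(nuFun S e (M.adp W) φ + (T.canCharLie χ W / 2) • φ) := by
    refine Subtype.ext (funext fun g => ?_)
    rw [T.leftDeriv_incl hχ hφ W g]
    exact congrArg (fun f => -(f + (T.canCharLie χ W / 2) • φ.1 g))
      (nuFun_apply S e (hsp W) φ g).symm
  have h2 : leftDeriv S (M.incl U) (nuFun S e (M.adp W) φ) =
      nuFun S e (M.adp W) (leftDeriv S (M.incl U) φ) :=
    congrArg (fun Q : Module.End ℂ (SmoothFun E G S) => Q φ)
      (nuFun_mul_leftDeriv S e (M.adp W) (M.incl U)).symm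
  have h3 : (leftDeriv S (M.incl U) (leftDeriv S (M.incl W) φ)).1 g =
      -(M.clNuAd W ((leftDeriv S (M.incl U) φ).1 g) +
        (T.canCharLie χ W / 2) • (leftDeriv S (M.incl U) φ).1 g) := by
    rw [h1, map_neg, map_add, map_smul, h2]
    exact congrArg (fun f => -(f + (T.canCharLie χ W / 2) • (leftDeriv S (M.incl U) φ).1 g))
      (nuFun_apply S e (hsp W) _ g)
  rw [h3, T.leftDeriv_incl hχ hφ U g]
  simp only [map_neg, map_add, map_smul]
  module

theorem SmoothFun.sum_apply {κ : Type*} (s : Finset κ) (ψ : κ → SmoothFun E G S) (g : G) :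
    (∑ i ∈ s, ψ i).1 g = ∑ i ∈ s, (ψ i).1 g := by
  induction s using Finset.cons_induction with
  | empty => rfl
  | cons a s ha ih =>
    rw [Finset.sum_cons, Finset.sum_cons, ← ih]
    rfl

/-- With `P`, `Q`, `Z` of order 2, 1, 0 in `N`, the Casimir of 𝔨 in derivatives is `P + Q + Z/4` and
the curvature sum is `-P - Q/2`. Weighting these by `-i/ħ` and `2i/ħ` gives the stated coefficients.
-/
theorem IsExtension.dirac_commutator_apply {A : V ≃ₗ[ℝ] V}
    {B : LinearMap.BilinForm ℝ (GroupLieAlgebra 𝓘(ℝ, E) G)} (h : M.IsExtension A B)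
    (hA : ∀ v w, S.Ω (A v) w = -S.Ω v (A w))
    (hAad : ∀ W v, A (M.adp W v) = M.adp W (A v)) (T : M.Lift) {χ : K →* Circle}
    (hχ : ContMDiff 𝓘(ℝ, EK) 𝓘(ℝ, ℂ) ∞ fun k => (χ k : ℂ)) {φ : SmoothFun E G S}
    (hφ : T.IsSpinorField χ φ)
    {ιV ιK ιG : Type*} [Fintype ιV] [DecidableEq ιV] [Fintype ιK] [DecidableEq ιK]
    [Fintype ιG] [DecidableEq ιG] (e : Module.Basis ιV ℝ V)
    (w : Module.Basis ιK ℝ (GroupLieAlgebra 𝓘(ℝ, EK) K))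
    (u : Module.Basis ιG ℝ (GroupLieAlgebra 𝓘(ℝ, E) G))
    {β : Matrix ιK ιK ℝ}
    (hβ : β = invGram (B.compl₁₂ M.incl.toLinearMap M.incl.toLinearMap) w) (g : G) :
    ((M.dirac e * M.twistedDirac A.toLinearMap e -
        M.twistedDirac A.toLinearMap e * M.dirac e) φ).1 g =
      (Complex.I / S.hbar) • (casimirImage B u (leftDeriv S) φ).1 g
        - (3 * Complex.I / S.hbar) • ∑ r, ∑ s, (β r s : ℂ) •
          M.clNuAd (w r) (M.clNuAd (w s) (φ.1 g))
        - (Complex.I / (4 * S.hbar)) •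
          (∑ r, ∑ s, (β r s : ℂ) * T.canCharLie χ (w r) * T.canCharLie χ (w s)) • φ.1 g
        - (2 * Complex.I / S.hbar) • ∑ r, ∑ s, ((β r s : ℂ) * T.canCharLie χ (w r)) •
          M.clNuAd (w s) (φ.1 g) := by
  have hsym : ∀ r s, β r s = β s r := fun r s => by rw [hβ]; exact invGram_symm h.symm_k w r s
  have hsp : ∀ U v w, S.Ω (M.adp U v) w = -S.Ω v (M.adp U w) := fun U v w =>
    eq_neg_of_add_eq_zero_left (M.Ω_adp T U v w)
  have h1 := congrArg (fun Q : Module.End ℂ (SmoothFun E G S) => (Q φ).1 g)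
    (h.dirac_commutator hA hAad e w u)
  rw [← hβ] at h1
  have h2 : ∀ F : ιK → ιK → Module.End ℂ (SmoothFun E G S),
      ((∑ r, ∑ s, (β r s : ℂ) • F r s) φ).1 g = ∑ r, ∑ s, (β r s : ℂ) • (F r s φ).1 g := by
    intro F
    simp only [LinearMap.sum_apply, SmoothFun.sum_apply]
    rfl
  set v := φ.1 g with hv
  set P := ∑ r, ∑ s, (β r s : ℂ) • M.clNuAd (w r) (M.clNuAd (w s) v) with hP
  set Q := ∑ r, ∑ s, ((β r s : ℂ) * T.canCharLie χ (w r)) • M.clNuAd (w s) v with hQ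
  set Z := ∑ r, ∑ s, (β r s : ℂ) * T.canCharLie χ (w r) * T.canCharLie χ (w s) with hZ
  -- The reversed order left by `leftDeriv_incl_mul` is harmless since the inverse Gram matrix is
  -- symmetric.
  have hP' : ∑ r, ∑ s, (β r s : ℂ) • M.clNuAd (w s) (M.clNuAd (w r) v) = P := by
    rw [Finset.sum_comm]
    refine Finset.sum_congr rfl fun r _ => Finset.sum_congr rfl fun s _ => ?_
    rw [hsym]
  have hQ' : ∑ r, ∑ s, ((β r s : ℂ) * T.canCharLie χ (w s)) • M.clNuAd (w r) v = Q := by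
    rw [Finset.sum_comm]
    refine Finset.sum_congr rfl fun r _ => Finset.sum_congr rfl fun s _ => ?_
    rw [hsym]
  have h3 : ∑ r, ∑ s, (β r s : ℂ) •
      ((leftDeriv S (M.incl (w r)) * leftDeriv S (M.incl (w s))) φ).1 g =
      P + Q + (Z / 4) • v := by
    have h4 : ∀ r s, (β r s : ℂ) •
        ((leftDeriv S (M.incl (w r)) * leftDeriv S (M.incl (w s))) φ).1 g =
        (β r s : ℂ) • M.clNuAd (w s) (M.clNuAd (w r) v) +
        (1 / 2 : ℂ) • ((β r s : ℂ) * T.canCharLie χ (w r)) • M.clNuAd (w s) v +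
        (1 / 2 : ℂ) • ((β r s : ℂ) * T.canCharLie χ (w s)) • M.clNuAd (w r) v +
        ((β r s : ℂ) * T.canCharLie χ (w r) * T.canCharLie χ (w s)) • (1 / 4 : ℂ) • v :=
        fun r s => by
      rw [Module.End.mul_apply, T.leftDeriv_incl_mul hχ hφ e (w r) (w s) g]
      module
    have h5 : ∑ r, ∑ s, ((β r s : ℂ) * T.canCharLie χ (w r) * T.canCharLie χ (w s)) •
        (1 / 4 : ℂ) • v = (Z / 4) • v := by
      simp only [← Finset.sum_smul]
      rw [smul_smul, ← hZ, mul_one_div]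
    simp only [h4, Finset.sum_add_distrib, ← Finset.smul_sum]
    rw [hP', hQ', ← hQ]
    rw [h5]
    module
  have h5 : ∑ r, ∑ s, (β r s : ℂ) •
      ((nuFun S e (M.adp (w r)) * leftDeriv S (M.incl (w s)) : Module.End ℂ (SmoothFun E G S)) φ).1 g = -P - (1 / 2 : ℂ) • Q := by
    have h6 : ∀ r s, (β r s : ℂ) •
        ((nuFun S e (M.adp (w r)) * leftDeriv S (M.incl (w s)) : Module.End ℂ (SmoothFun E G S)) φ).1 g =
        -((β r s : ℂ) • M.clNuAd (w r) (M.clNuAd (w s) v)) -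
        (1 / 2 : ℂ) • ((β r s : ℂ) * T.canCharLie χ (w s)) • M.clNuAd (w r) v := fun r s => by
      rw [Module.End.mul_apply, nuFun_apply S e (hsp (w r)), T.leftDeriv_incl hχ hφ (w s) g]
      change (β r s : ℂ) • M.clNuAd (w r) _ = _
      simp only [map_neg, map_add, map_smul]
      module
    simp only [h6, Finset.sum_sub_distrib, Finset.sum_neg_distrib, ← Finset.smul_sum]
    rw [hQ', ← hP]
  refine h1.trans ?_
  change (Complex.I / S.hbar) • ((casimirImage B u (leftDeriv S) φ).1 g - ((∑ r, ∑ s,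
    (β r s : ℂ) • (leftDeriv S (M.incl (w r)) * leftDeriv S (M.incl (w s)))) φ).1 g) +
    (2 * Complex.I / S.hbar) • ((∑ r, ∑ s, (β r s : ℂ) • (nuFun S e (M.adp (w r)) *
      leftDeriv S (M.incl (w s))) : Module.End ℂ (SmoothFun E G S)) φ).1 g = _
  rw [h2, h2, h3, h5]
  have hh := S.hbar_ne_zero
  match_scalars <;> field_simp <;> ring

end SymplecticSymmetricSpace

end

end MpcDirac


/-! ### The form and both versions of the commutator formula together. -/

theorem mainTheorem6 {V E EK G ιV ιK ιG : Type*} [NormedAddCommGroup V] [NormedSpace ℝ V]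
    [FiniteDimensional ℝ V] [NormedAddCommGroup E] [NormedSpace ℝ E] [FiniteDimensional ℝ E]
    [NormedAddCommGroup EK] [NormedSpace ℝ EK] [FiniteDimensional ℝ EK]
    [TopologicalSpace G] [ChartedSpace E G] [Group G] [LieGroup 𝓘(ℝ, E) ∞ G]
    (K : Subgroup G) [ChartedSpace EK K] [LieGroup 𝓘(ℝ, EK) ∞ K] (S : FockModel V)
    (M : SymplecticSymmetricSpace E EK S K) (A : V ≃ₗ[ℝ] V)
    (hA : ∀ v w, S.Ω (A v) w = -S.Ω v (A w)) (hAK : ∀ (k : K) (v : V), A (M.τ k v) = M.τ k (A v))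
    (T : M.Lift) (χ : K →* Circle)
    (hχ : ContMDiff 𝓘(ℝ, EK) 𝓘(ℝ, ℂ) ∞ fun k => (χ k : ℂ))
    [Fintype ιV] [DecidableEq ιV] [Fintype ιK] [DecidableEq ιK] [Fintype ιG] [DecidableEq ιG]
    (e : Module.Basis ιV ℝ V) (w : Module.Basis ιK ℝ (GroupLieAlgebra 𝓘(ℝ, EK) K))
    (u : Module.Basis ιG ℝ (GroupLieAlgebra 𝓘(ℝ, E) G)) :
    ∃ B : LinearMap.BilinForm ℝ (GroupLieAlgebra 𝓘(ℝ, E) G),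
      M.IsExtension A B ∧ (∀ B', M.IsExtension A B' → B' = B) ∧ B.Nondegenerate ∧
      (B.compl₁₂ M.incl.toLinearMap M.incl.toLinearMap).Nondegenerate ∧
      ∀ φ : SmoothFun E G S, T.IsSpinorField χ φ → ∀ g : G,
        let Bk : LinearMap.BilinForm ℝ (GroupLieAlgebra 𝓘(ℝ, EK) K) :=
          B.compl₁₂ M.incl.toLinearMap M.incl.toLinearMap
        let N : GroupLieAlgebra 𝓘(ℝ, EK) K → Module.End ℂ S.Smooth := M.clNuAd
        let χ' : GroupLieAlgebra 𝓘(ℝ, EK) K → ℂ := T.canCharLie χ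
        let Cg : Module.End ℂ (SmoothFun E G S) := casimirImage B u (leftDeriv S)
        let D := M.dirac e
        let DA := M.twistedDirac A.toLinearMap e
        ((D * DA - DA * D) φ).1 g =
            (Complex.I / S.hbar) • (Cg φ).1 g
              - (3 * Complex.I / S.hbar) • casimirImage Bk w N (φ.1 g)
              - (Complex.I / (4 * S.hbar)) •
                (∑ r, ∑ s, (invGram Bk w r s : ℂ) * χ' (w r) * χ' (w s)) • φ.1 g
              - (2 * Complex.I / S.hbar) •
                ∑ r, ∑ s, ((invGram Bk w r s : ℂ) * χ' (w r)) • N (w s) (φ.1 g) ∧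
        ((D * DA - DA * D) φ).1 g =
            (Complex.I / S.hbar) • ((Cg φ).1 g + casimirImage Bk w N (φ.1 g)
              - (4 : ℂ) • casimirImage Bk w
                (fun W => N W + ((1 / 4 : ℂ) * χ' W) • (1 : Module.End ℂ S.Smooth)) (φ.1 g)) := by
  have hAad : ∀ W v, A (M.adp W v) = M.adp W (A v) := fun W v =>
    M.adp_comm T (A := A.toLinearMap) hAK W v
  obtain ⟨B, hB⟩ := M.exists_isExtension hA hAK M.Ω_τ hAad (M.Ω_adp T)
  refine ⟨B, hB, fun B' hB' => M.isExtension_unique hB hB', hB.nondegenerate, hB.nondegenerate_k,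
    fun φ hφ g => ?_⟩
  intro Bk N χ' Cg D DA
  have key := hB.dirac_commutator_apply hA hAad T hχ hφ e w u rfl g
  have hN : casimirImage Bk w N (φ.1 g) =
      ∑ r, ∑ s, (invGram Bk w r s : ℂ) • N (w r) (N (w s) (φ.1 g)) := by
    simp only [casimirImage, LinearMap.sum_apply]
    rfl
  have hform : ((D * DA - DA * D) φ).1 g =
      (Complex.I / S.hbar) • (Cg φ).1 g
        - (3 * Complex.I / S.hbar) • casimirImage Bk w N (φ.1 g)
        - (Complex.I / (4 * S.hbar)) •
          (∑ r, ∑ s, (invGram Bk w r s : ℂ) * χ' (w r) * χ' (w s)) • φ.1 g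
        - (2 * Complex.I / S.hbar) •
          ∑ r, ∑ s, ((invGram Bk w r s : ℂ) * χ' (w r)) • N (w s) (φ.1 g) := by
    rw [hN]
    exact key
  refine ⟨hform, ?_⟩
  have hsym := invGram_symm (B := Bk) hB.symm_k w
  have hQ : ∑ r, ∑ s, ((invGram Bk w r s : ℂ) * χ' (w s)) • N (w r) (φ.1 g) =
      ∑ r, ∑ s, ((invGram Bk w r s : ℂ) * χ' (w r)) • N (w s) (φ.1 g) := by
    rw [Finset.sum_comm]
    refine Finset.sum_congr rfl fun r _ => Finset.sum_congr rfl fun s _ => ?_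
    rw [hsym]
  have hZ : ∑ r, ∑ s, ((invGram Bk w r s : ℂ) * χ' (w r) * χ' (w s)) • (1 / 16 : ℂ) • φ.1 g =
      (∑ r, ∑ s, (invGram Bk w r s : ℂ) * χ' (w r) * χ' (w s)) • (1 / 16 : ℂ) • φ.1 g := by
    simp only [← Finset.sum_smul]
  -- Completing the square: four times this is `4P + 2Q + Z/4`, so subtracting it from `P` leaves
  -- `-3P - 2Q - Z/4`, which explains the shift by `χ'_*/4`.
  have hC : casimirImage Bk w
      (fun W => N W + ((1 / 4 : ℂ) * χ' W) • (1 : Module.End ℂ S.Smooth)) (φ.1 g) =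
      casimirImage Bk w N (φ.1 g) + (1 / 2 : ℂ) •
        ∑ r, ∑ s, ((invGram Bk w r s : ℂ) * χ' (w r)) • N (w s) (φ.1 g) + (1 / 16 : ℂ) •
          (∑ r, ∑ s, (invGram Bk w r s : ℂ) * χ' (w r) * χ' (w s)) • φ.1 g := by
    have h1 : ∀ r s, ((invGram Bk w r s : ℂ) •
        ((N (w r) + ((1 / 4 : ℂ) * χ' (w r)) • (1 : Module.End ℂ S.Smooth)) *
          (N (w s) + ((1 / 4 : ℂ) * χ' (w s)) • (1 : Module.End ℂ S.Smooth)))) (φ.1 g) =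
        (invGram Bk w r s : ℂ) • N (w r) (N (w s) (φ.1 g)) +
        (1 / 4 : ℂ) • ((invGram Bk w r s : ℂ) * χ' (w s)) • N (w r) (φ.1 g) +
        (1 / 4 : ℂ) • ((invGram Bk w r s : ℂ) * χ' (w r)) • N (w s) (φ.1 g) +
        ((invGram Bk w r s : ℂ) * χ' (w r) * χ' (w s)) • (1 / 16 : ℂ) • φ.1 g := fun r s => by
      simp only [LinearMap.smul_apply, Module.End.mul_apply, LinearMap.add_apply,
        Module.End.one_apply, map_add, map_smul]
      module
    rw [hN, casimirImage, LinearMap.sum_apply]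
    simp only [LinearMap.sum_apply, h1, Finset.sum_add_distrib, ← Finset.smul_sum]
    rw [hQ, hZ]
    module
  rw [hform, hC]
  have hh := S.hbar_ne_zero
  match_scalars <;> field_simp <;> ring
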